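/- **Setting.** Let $d\ge 2$ and let $\Omega\subset\mathbb R^d$ be a bounded open set with Lipschitz boundary $\Gamma$ (polyhedral, since it is triangulated below); let $I=(0,T)$, $0<T<\infty$. Let $g(s)=\sum_{i=0}^N a_i s^{\alpha_i}$ with $N\ge1$, real exponents $0=\alpha_0<\alpha_1<\dots<\alpha_N$, $a_0,a_N>0$ and $a_1,\dots,a_{N-1}\ge0$. For $\xi\ge 0$ put $K(\xi)=1/g(s(\xi))$, where $s(\xi)\ge0$ is the unique non-negative solution of $s\,g(s)=\xi$, and let $$a=\frac{\alpha_N}{\alpha_N+1},\qquad \beta=2-a\in(1,2),\qquad \lambda=\frac{\beta}{\beta-1}.$$ Let $0<\phi_*<\phi^*$, $k\ge 0$, and let $\{\mathcal T_h\}_h$ be a quasiuniform family of (finite, face-to-face, simplicial) triangulations of $\overline\Omega$: for some $c>0$, each simplex of $\mathcal T_h$ contains a ball of radius $c\,h$, where $h$ is the maximal diameter of the simplices of $\mathcal T_h$. Let $\mathcal R_h\subset H^1(\Omega)$ be the space of continuous functions on $\overline\Omega$ that are polynomials of degree at most $k$ on each simplex of $\mathcal T_h$, and $\mathcal M_h$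 the space of (discontinuous) vector fields all of whose components are polynomials of degree at most $k$ in each simplex. Let $\pi$ be the $L^2(\Omega)$-orthogonal projection onto $\mathcal R_h$. The data are a porosity $\phi\in C^1(\Omega)$ with $\phi_*<\phi<\phi^*$ in $\Omega$, an initial density $\rho^0\in C(\overline\Omega)\cap C^1(\Omega)$, a boundary flux $\psi$ on $[0,T]\times\Gamma$ which is measurable in $x\in\Gamma$ for each $t$ and continuously differentiable in $t\in[0,T]$ for each $x$, and a source $f\in L^2(I;L^2(\Omega))$. A pair $(\rho_h,m_h)$ is a solution of the semidiscrete mixed problem if $\rho_h:[0,T]\to\mathcal R_h$ is absolutely continuous, $m_h(t)\in\mathcal M_h$ for a.e. $t\in I$, $\rho_h(0)=\pi\rho^0$, and for a.e. $t\in I$ $$\int_\Omega m_h\cdot z\,dx+\int_\Omega K(|\nabla\rho_h|)\nabla\rho_h\cdot z\,dx=0\quad\text{for all } z\in\mathcal M_h,$$ $$\int_\Omega \phi\,\rho_{h,t}\,r\,dx-\int_\Omega m_h\cdot\nabla r\,dx=\int_\Omega f\,r\,dx-\int_\Gamma\psi\,r\,d\sigma\quad\text{for all } r\in\mathcal R_h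 .$$ **Theorem 4.1.** There is a constant $C>0$, depending only on $d$, $\Omega$, $g$, $T$, $\phi_*$, $\phi^*$, $k$ and the family $\{\mathcal T_h\}_h$ (in particular independent of $h$, $\phi$, $\rho^0$, $\psi$, $f$), such that every solution $(\rho_h,m_h)$ of the semidiscrete problem over any mesh of the family satisfies $$\|\rho_h\|_{L^\infty(I;L^2(\Omega))}^2+\|\nabla\rho_h\|_{L^\beta(I;L^\beta(\Omega))}^\beta\le C\left(\|\rho^0\|_{L^2(\Omega)}^2+\mathcal A\right)$$ and $$\|\rho_{h,t}\|_{L^2(I;L^2(\Omega))}^2+\|\nabla\rho_h\|_{L^\infty(I;L^\beta(\Omega))}^\beta+\|m_h\|_{L^\infty(I;L^2(\Omega))}\le C\,\mathcal B,$$ where $$\mathcal A=1+\|\psi\|_{L^\infty(I;L^\infty(\Gamma))}^\lambda+\|f\|_{L^2(I;L^2(\Omega))}^2,$$ $$\mathcal B=\|\rho^0\|_{L^2(\Omega)}^2+\|\nabla\rho^0\|_{L^\beta(\Omega)}^\beta+\|\psi(0)\|_{L^2(\Gamma)}\|\rho^0\|_{L^2(\Gamma)}+\|\psi_t\|_{L^\infty(I;L^\infty(\Gamma))}^\lambda+\mathcal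 A .$$ (If a norm of the data on a right-hand side is infinite, the corresponding estimate is void.) -/

import Mathlib

open MeasureTheory Set
open scoped ENNReal NNReal

noncomputable section

namespace MixedFEM

/-- The ambient Euclidean space of dimension `d`. -/
abbrev Space (d : ℕ) : Type := EuclideanSpace ℝ (Fin d)

/-! ### Forchheimer polynomials and the degenerate conductivity -/

/-- A Forchheimer polynomial `g(s) = a₀ s^{α₀} + ⋯ + a_N s^{α_N}` with `N ≥ 1`, real exponents
`0 = α₀ < α₁ < ⋯ < α_N`, and coefficients `a₀, a_N > 0`, `a_i ≥ 0`. -/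
structure ForchheimerPoly where
  N : ℕ
  one_le_N : 1 ≤ N
  α : Fin (N + 1) → ℝ
  α_zero : α 0 = 0
  α_strictMono : StrictMono α
  a : Fin (N + 1) → ℝ
  a_nonneg : ∀ i, 0 ≤ a i
  a_zero_pos : 0 < a 0
  a_last_pos : 0 < a (Fin.last N)

namespace ForchheimerPoly

variable (g : ForchheimerPoly)

/-- The value `g(s)`, for `s ≥ 0`. -/
def eval (s : ℝ) : ℝ := ∑ i, g.a i * s ^ g.α i

lemma α_nonneg (i : Fin (g.N + 1)) : 0 ≤ g.α i := by
  rw [← g.α_zero]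
  exact g.α_strictMono.monotone (Fin.zero_le i)

lemma eval_mono {s t : ℝ} (hs : 0 ≤ s) (hst : s ≤ t) : g.eval s ≤ g.eval t :=
  Finset.sum_le_sum fun i _ =>
    mul_le_mul_of_nonneg_left (Real.rpow_le_rpow hs hst (g.α_nonneg i)) (g.a_nonneg i)

lemma a_zero_le_eval {s : ℝ} (hs : 0 ≤ s) : g.a 0 ≤ g.eval s := by
  have h := Finset.single_le_sum (f := fun i => g.a i * s ^ g.α i)
    (fun i _ => mul_nonneg (g.a_nonneg i) (Real.rpow_nonneg hs _)) (Finset.mem_univ 0)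
  simpa [eval, g.α_zero] using h

lemma continuous_eval : Continuous g.eval :=
  continuous_finsetSum _ fun i _ =>
    continuous_const.mul (Real.continuous_rpow_const (g.α_nonneg i))

/-- For every `ξ ≥ 0` the equation `s g(s) = ξ` has exactly one non-negative solution. -/
theorem existsUnique_root {ξ : ℝ} (hξ : 0 ≤ ξ) : ∃! s : ℝ, 0 ≤ s ∧ s * g.eval s = ξ := by
  have ha := g.a_zero_pos
  have hb : 0 ≤ ξ / g.a 0 := div_nonneg hξ ha.le
  have hc : ContinuousOn (fun s => s * g.eval s) (Icc 0 (ξ / g.a 0)) :=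
    (continuous_id.mul g.continuous_eval).continuousOn
  have hmem : ξ ∈ Icc (0 * g.eval 0) (ξ / g.a 0 * g.eval (ξ / g.a 0)) := by
    refine ⟨by simpa using hξ, ?_⟩
    calc ξ = ξ / g.a 0 * g.a 0 := by field_simp
      _ ≤ _ := mul_le_mul_of_nonneg_left (g.a_zero_le_eval hb) hb
  obtain ⟨s, hs, hsξ⟩ := intermediate_value_Icc hb hc hmem
  have key : ∀ u v : ℝ, 0 ≤ u → u < v → u * g.eval u < v * g.eval v := by
    intro u v hu huv
    have h1 := g.eval_mono hu huv.le
    have h2 := g.a_zero_le_eval (hu.trans huv.le)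
    nlinarith
  refine ⟨s, ⟨hs.1, hsξ⟩, ?_⟩
  rintro t ⟨ht, htξ⟩
  rcases lt_trichotomy t s with h | h | h
  · have := key t s ht h
    simp only at hsξ
    linarith
  · exact h
  · have := key s t hs.1 h
    simp only at hsξ
    linarith

/-- `s(ξ)`, the unique non-negative solution of `s g(s) = ξ` for `ξ ≥ 0`
(extended evenly to negative `ξ`, where it is never used). -/
def root (ξ : ℝ) : ℝ := (g.existsUnique_root (abs_nonneg ξ)).choose

/-- The conductivity `K(ξ) = 1 / g(s(ξ))`. -/
def K (ξ : ℝ) : ℝ := 1 / g.eval (g.root ξ)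

/-- The degree `α_N` of `g`. -/
def deg : ℝ := g.α (Fin.last g.N)

/-- `a = deg g / (deg g + 1)`. -/
def degeneracy : ℝ := g.deg / (g.deg + 1)

/-- `β = 2 - a`. -/
def β : ℝ := 2 - g.degeneracy

/-- `λ = β / (β - 1)`, the exponent conjugate to `β`. -/
def conjExp : ℝ := g.β / (g.β - 1)

end ForchheimerPoly

/-! ### Domains and triangulations -/

section Geometry

variable {d : ℕ}

/-- A bounded open set whose boundary is locally the graph of a Lipschitz function (of the
component orthogonal to a unit vector `e`), with the set lying locally on one side of it. -/
structure IsBoundedLipschitz (Ω : Set (Space d)) : Prop where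
  isOpen : IsOpen Ω
  isBounded : Bornology.IsBounded Ω
  locally_graph : ∀ x ∈ frontier Ω, ∃ e : Space d, ‖e‖ = 1 ∧ ∃ r > 0, ∃ L : ℝ≥0,
    ∃ γ : Space d → ℝ, LipschitzWith L γ ∧
      Ω ∩ Metric.ball x r =
        {y | γ (y - inner ℝ e y • e) < inner ℝ e y} ∩ Metric.ball x r

/-- The surface measure on the boundary of `Ω`. -/
def surface (Ω : Set (Space d)) : Measure (Space d) :=
  (μHE[d - 1]).restrict (frontier Ω)

/-- A (finite, face-to-face) triangulation of the closure of `Ω`. -/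
structure IsTriangulation (Ω : Set (Space d)) (𝒯 : Geometry.SimplicialComplex ℝ (Space d)) :
    Prop where
  finite : 𝒯.faces.Finite
  space_eq : 𝒯.space = closure Ω

/-- The mesh elements: the (closed) `d`-dimensional simplices of the triangulation. -/
def elements (𝒯 : Geometry.SimplicialComplex ℝ (Space d)) : Set (Set (Space d)) :=
  {S | ∃ s ∈ 𝒯.faces, s.card = d + 1 ∧ S = convexHull ℝ (s : Set (Space d))}

/-- The family `𝓣` of meshes is quasiuniform: for some `c > 0`, each element of each mesh contains
a ball of radius `c h`, where `h` is the maximal diameter of the elements of that mesh. -/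
def IsQuasiuniform (𝓣 : Set (Geometry.SimplicialComplex ℝ (Space d))) : Prop :=
  ∃ c > 0, ∀ 𝒯 ∈ 𝓣, ∀ S ∈ elements 𝒯, ∀ S' ∈ elements 𝒯,
    ∃ x, Metric.closedBall x (c * Metric.diam S') ⊆ S

/-- `u` agrees on `S` with a polynomial of total degree at most `k`. -/
def IsPolyOn (k : ℕ) (S : Set (Space d)) (u : Space d → ℝ) : Prop :=
  ∃ p : MvPolynomial (Fin d) ℝ, p.totalDegree ≤ k ∧
    ∀ x ∈ S, u x = MvPolynomial.eval (fun i => x i) p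

/-- The density space: the `H¹`-conforming piecewise polynomials of degree at most `k`. The function
is a polynomial on every closed element, hence it is continuous on the closure of the domain. -/
def densitySpace (𝒯 : Geometry.SimplicialComplex ℝ (Space d)) (k : ℕ) : Set (Space d → ℝ) :=
  {r | ∀ S ∈ elements 𝒯, IsPolyOn k S r}

/-- The momentum space: the vector fields all of whose components are (discontinuous) piecewise
polynomials of degree at most `k`, i.e. polynomials in the interior of every element. -/
def momentumSpace (𝒯 : Geometry.SimplicialComplex ℝ (Space d)) (k : ℕ) :
    Set (Space d → Space d) :=
  {z | ∀ S ∈ elements 𝒯, ∀ i, IsPolyOn k (interior S) (fun x => z x i)}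

end Geometry

/-! ### Norms and the semidiscrete problem -/

/-- The mixed norm of `L^p(0,T; L^q(μ))`, with values in `[0,∞]`. -/
def mixedNorm {X F : Type*} [MeasurableSpace X] [NormedAddCommGroup F] (T : ℝ) (p q : ℝ≥0∞)
    (μ : Measure X) (u : ℝ → X → F) : ℝ≥0∞ :=
  eLpNorm (fun t => eLpNorm (u t) q μ) p (volume.restrict (Ioo 0 T))

/-- The time derivative of a function of `(t, x)`. -/
def timeDeriv {X : Type*} (u : ℝ → X → ℝ) (t : ℝ) (x : X) : ℝ := deriv (fun s => u s x) t

section Problem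

variable {d : ℕ}

/-- `(ρ, m)` solves the semidiscrete mixed problem on `(0,T)` over the mesh `𝒯` with polynomial
degree `k`, porosity `φ`, source `f`, boundary flux `ψ` and initial density `ρ₀`. The discrete
density is absolutely continuous in time and the equations hold for almost every time; `initial`
says that `ρ 0` is the `L²`-projection of `ρ₀` onto the density space. -/
structure IsSemidiscreteSolution (Ω : Set (Space d)) (g : ForchheimerPoly) (T : ℝ) (k : ℕ)
    (𝒯 : Geometry.SimplicialComplex ℝ (Space d)) (φ ρ₀ : Space d → ℝ)
    (ψ f : ℝ → Space d → ℝ) (ρ : ℝ → Space d → ℝ) (m : ℝ → Space d → Space d) : Prop where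
  density_mem : ∀ t ∈ Icc 0 T, ρ t ∈ densitySpace 𝒯 k
  momentum_mem : ∀ᵐ t ∂volume.restrict (Ioo 0 T), m t ∈ momentumSpace 𝒯 k
  absolutelyContinuous : ∀ x ∈ closure Ω, AbsolutelyContinuousOnInterval (fun t => ρ t x) 0 T
  momentum_eq : ∀ᵐ t ∂volume.restrict (Ioo 0 T), ∀ z ∈ momentumSpace 𝒯 k,
    (∫ x in Ω, inner ℝ (m t x) (z x)) +
      ∫ x in Ω, inner ℝ (g.K ‖gradient (ρ t) x‖ • gradient (ρ t) x) (z x) = 0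
  density_eq : ∀ᵐ t ∂volume.restrict (Ioo 0 T), ∀ r ∈ densitySpace 𝒯 k,
    (∫ x in Ω, φ x * timeDeriv ρ t x * r x) - ∫ x in Ω, inner ℝ (m t x) (gradient r x) =
      (∫ x in Ω, f t x * r x) - ∫ x, ψ t x * r x ∂surface Ω
  initial : ∀ r ∈ densitySpace 𝒯 k, ∫ x in Ω, (ρ 0 x - ρ₀ x) * r x = 0

/-- `𝒜 = 1 + ‖ψ‖_{L^∞(I;L^∞(Γ))}^λ + ‖f‖²_{L²(I;L²(Ω))}`. -/
def boundA (Ω : Set (Space d)) (g : ForchheimerPoly) (T : ℝ) (ψ f : ℝ → Space d → ℝ) : ℝ≥0∞ :=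
  1 + mixedNorm T ∞ ∞ (surface Ω) ψ ^ g.conjExp + mixedNorm T 2 2 (volume.restrict Ω) f ^ 2

/-- `ℬ = ‖ρ⁰‖² + ‖∇ρ⁰‖_{L^β}^β + ‖ψ(0)‖_{L²(Γ)} ‖ρ⁰‖_{L²(Γ)} + ‖ψ_t‖_{L^∞(I;L^∞(Γ))}^λ + 𝒜`. -/
def boundB (Ω : Set (Space d)) (g : ForchheimerPoly) (T : ℝ) (ρ₀ : Space d → ℝ)
    (ψ f : ℝ → Space d → ℝ) : ℝ≥0∞ :=
  eLpNorm ρ₀ 2 (volume.restrict Ω) ^ 2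
    + eLpNorm (gradient ρ₀) (ENNReal.ofReal g.β) (volume.restrict Ω) ^ g.β
    + eLpNorm (ψ 0) 2 (surface Ω) * eLpNorm ρ₀ 2 (surface Ω)
    + mixedNorm T ∞ ∞ (surface Ω) (timeDeriv ψ) ^ g.conjExp
    + boundA Ω g T ψ f

end Problem

end MixedFEM

end

open MixedFEM

namespace MixedFEM

/-! ### Polynomials -/

section Polynomials

variable {d : ℕ}

/-! The two bounds are energy estimates, obtained by testing the semidiscrete equations with `ρ_h`
and with `ρ_{h,t}`. Gradients of discrete densities are admissible test momenta
(`gradient_mem_momentumSpace`), so the coupling term `∫ m_h · ∇r` can be replaced by the flux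
`K(|∇ρ_h|) ∇ρ_h` in both cases; testing the momentum equation with `m_h` itself bounds `m_h`
(`exists_momentum_bound`).

Let `P` be the primitive of `ξ ↦ K(ξ) ξ = s(ξ)`. It is convex, `v ↦ P(|v|)` is a potential of the
flux, and `s(ξ) ~ ξ^(β-1)` makes `P` comparable to `ξ^β` up to additive constants
(`exists_potential_le`, `exists_le_potential`). Put `J(t) = ∫ P(|∇ρ_h(t)|)`.

The first test gives `(½ ∫ φ ρ²)' + J ≤ ∫ f ρ - ∫_Γ ψ ρ`. The trace inequality from `W^{1,1}` to
`L¹` and Young's inequality with exponents `β`, `λ` absorb the boundary term into `J`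
(`exists_boundary_absorption`), and Gronwall's inequality concludes (`exists_energy_estimate`).

The second test gives `∫ φ ρ_t² + J' = ∫ f ρ_t - ∫_Γ ψ ρ_t`, whose last term is `-(∫_Γ ψ ρ)' + ∫_Γ
ψ_t ρ`. Both pieces are absorbed as before, the time integral of `J` being known from the first
estimate (`exists_derivative_estimate`). What remains is `J(0)`, that is, the `L^β` norm of `∇ π
ρ⁰`.

Hence the core is the stability of the `L²`-projection in `W^{1,p}`, `1 ≤ p ≤ 2`, uniformly over
quasiuniform meshes (`exists_projection_gradient_bound`). If `w` is a quasi-interpolant of `u`, then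
`π u - w = π (u - w)`; the inverse inequality costs `h^(-p)`, `L^p`-stability of `π` removes the
projection, and the approximation error `h^p ∫ |∇u|^p` pays for it. The quasi-interpolant takes its
vertex values from a local Poincaré inequality at scale `h`, proved by averaging over segments
inside interior cones. The `L^p`-stability follows from a weighted `L²` bound with slowly varying,
polynomially decaying weights (`exists_weighted_projection_bound`). Its test function must resemble
weight times `v` and yet be a finite element function of the same degree; it is built by a piecewise
projective change of variables (`exists_discrete_product`).

Differentiating the energies in time is a finite-dimensional matter: a discrete density is
determined by finitely many point values, and a convex function with a continuous subgradient
satisfies the chain rule along absolutely continuous curves (`energy_along_curve`). -/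

/-- The polynomial function on `Space d` given by `p`. -/
noncomputable def polyFun (p : MvPolynomial (Fin d) ℝ) (x : Space d) : ℝ := MvPolynomial.eval (fun i => x i) p

lemma analyticOnNhd_polyFun (p : MvPolynomial (Fin d) ℝ) :
    AnalyticOnNhd ℝ (polyFun p) univ := by
  have h := AnalyticOnNhd.eval_continuousLinearMap'
    (fun i : Fin d => (EuclideanSpace.proj i : Space d →L[ℝ] ℝ)) p
  simp only [PiLp.proj_apply] at h
  exact h

lemma contDiff_polyFun (p : MvPolynomial (Fin d) ℝ) {n : WithTop ℕ∞} :
    ContDiff ℝ n (polyFun p) :=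
  contDiffOn_univ.1 ((analyticOnNhd_polyFun p).contDiffOn uniqueDiffOn_univ)

lemma continuous_polyFun (p : MvPolynomial (Fin d) ℝ) : Continuous (polyFun p) :=
  (contDiff_polyFun p (n := 0)).continuous

lemma polyFun_ext {p q : MvPolynomial (Fin d) ℝ} (h : polyFun p = polyFun q) : p = q :=
  MvPolynomial.funext fun x => by
    simpa [polyFun] using congrFun h (WithLp.toLp 2 x)

/-- Homogenization: for `ℓ` and `N i` affine and `p` of degree at most `k`, the function
`ℓ ^ k * p (N / ℓ)` is a polynomial of degree at most `k`. -/
lemma exists_homogenization {k : ℕ} {p : MvPolynomial (Fin d) ℝ} (hp : p.totalDegree ≤ k)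
    {l : MvPolynomial (Fin d) ℝ} (hl : l.totalDegree ≤ 1)
    {N : Fin d → MvPolynomial (Fin d) ℝ} (hN : ∀ i, (N i).totalDegree ≤ 1) :
    ∃ q : MvPolynomial (Fin d) ℝ, q.totalDegree ≤ k ∧ ∀ x : Fin d → ℝ,
      MvPolynomial.eval x l ≠ 0 → MvPolynomial.eval x q = MvPolynomial.eval x l ^ k *
        MvPolynomial.eval (fun i => MvPolynomial.eval x (N i) / MvPolynomial.eval x l) p := by
  have hdeg : ∀ m ∈ p.support, ∑ i, m i ≤ k := fun m hm => by
    have := (MvPolynomial.le_totalDegree hm).trans hp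
    rwa [Finsupp.sum_fintype _ _ (by simp)] at this
  refine ⟨∑ m ∈ p.support, MvPolynomial.C (MvPolynomial.coeff m p) *
    (l ^ (k - ∑ i, m i) * ∏ i, N i ^ m i), ?_, ?_⟩
  · refine MvPolynomial.totalDegree_finsetSum_le fun m hm => ?_
    refine (MvPolynomial.totalDegree_mul _ _).trans ?_
    rw [MvPolynomial.totalDegree_C, zero_add]
    refine (MvPolynomial.totalDegree_mul _ _).trans ?_
    have h1 : (l ^ (k - ∑ i, m i)).totalDegree ≤ k - ∑ i, m i :=
      (MvPolynomial.totalDegree_pow _ _).trans (by nlinarith)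
    have h2 : (∏ i, N i ^ m i).totalDegree ≤ ∑ i, m i := by
      refine (MvPolynomial.totalDegree_finsetProd _ _).trans (Finset.sum_le_sum fun i _ => ?_)
      exact (MvPolynomial.totalDegree_pow _ _).trans (by nlinarith [hN i])
    have := hdeg m hm
    omega
  · intro x hx
    rw [MvPolynomial.eval_eq' _ p, Finset.mul_sum, map_sum]
    refine Finset.sum_congr rfl fun m hm => ?_
    simp only [map_mul, MvPolynomial.eval_C, map_pow, map_prod, div_pow, Finset.prod_div_distrib,
      Finset.prod_pow_eq_pow_sum]
    rw [pow_sub₀ _ hx (hdeg m hm)]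
    field_simp

/-- A linear functional on a finite-dimensional space is bounded by any definite seminorm. -/
lemma exists_bound_of_definite_seminorm {V : Type*} [AddCommGroup V] [Module ℝ V]
    [FiniteDimensional ℝ V] (N : Seminorm ℝ V) (hN : ∀ v, N v = 0 → v = 0) (f : V →ₗ[ℝ] ℝ) :
    ∃ C : ℝ, 0 ≤ C ∧ ∀ v, |f v| ≤ C * N v := by
  let _ : Norm V := ⟨N⟩
  have core : NormedSpace.Core ℝ V :=
    { norm_nonneg := fun v => apply_nonneg N v
      norm_smul := fun c v => map_smul_eq_mul N c v
      norm_triangle := fun v w => map_add_le_add N v w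
      norm_eq_zero_iff := fun v => ⟨hN v, fun h => by rw [h]; exact map_zero N⟩ }
  let _ : NormedAddCommGroup V := NormedAddCommGroup.ofCore core
  let _ : NormedSpace ℝ V := NormedSpace.ofCore core
  exact ⟨‖LinearMap.toContinuousLinearMap f‖, norm_nonneg _,
    fun v => (LinearMap.toContinuousLinearMap f).le_opNorm v⟩

/-- Equivalence of norms on the finite-dimensional space of polynomials of degree at most `k`: the
`L¹` norm over a ball is definite there by analyticity, so it bounds the coordinates in a fixed
basis, whose members are bounded and Lipschitz on the unit ball. -/
lemma exists_polyFun_bound_unit (d k : ℕ) {c : ℝ} (hc : 0 < c) :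
    ∃ C : ℝ, 0 < C ∧ ∀ p : MvPolynomial (Fin d) ℝ, p.totalDegree ≤ k →
      ∀ y ∈ Metric.closedBall (0 : Space d) 1,
        |polyFun p y| ≤ C * (∫ x in Metric.closedBall (0 : Space d) c, |polyFun p x|) ∧
        ∀ z ∈ Metric.closedBall (0 : Space d) 1, |polyFun p y - polyFun p z| ≤
          C * (∫ x in Metric.closedBall (0 : Space d) c, |polyFun p x|) * ‖y - z‖ := by
  let W := MvPolynomial.restrictTotalDegree (Fin d) ℝ k
  have hint : ∀ p : MvPolynomial (Fin d) ℝ,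
      IntegrableOn (fun x => |polyFun p x|) (Metric.closedBall (0 : Space d) c) := fun p =>
    (continuous_polyFun p).abs.continuousOn.integrableOn_compact (isCompact_closedBall _ _)
  let N : Seminorm ℝ W := Seminorm.of
    (fun p => ∫ x in Metric.closedBall (0 : Space d) c, |polyFun p.1 x|)
    (fun p q => by
      rw [← integral_add (hint _) (hint _)]
      refine integral_mono (hint _) ((hint _).add (hint _)) fun x => ?_
      simpa [polyFun] using abs_add_le _ _)
    (fun a p => by
      rw [← integral_const_mul]
      congr 1 with x
      simp [polyFun, abs_mul])
  have hN : ∀ p, N p = 0 → p = 0 := by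
    intro p hp
    have h0 : (fun x => |polyFun p.1 x|) =ᵐ[volume.restrict (Metric.closedBall (0 : Space d) c)]
        fun _ => 0 :=
      (setIntegral_eq_zero_iff_of_nonneg_ae (ae_of_all _ fun x => abs_nonneg _) (hint _)).1 hp
    have h1 : EqOn (fun x => |polyFun p.1 x|) (fun _ => 0) (Metric.closedBall (0 : Space d) c) := by
      refine Measure.eqOn_of_ae_eq h0 (continuous_polyFun _).abs.continuousOn continuousOn_const ?_
      rw [interior_closedBall _ hc.ne', closure_ball _ hc.ne']
    have h2 : polyFun p.1 = polyFun 0 := by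
      refine AnalyticOnNhd.eq_of_eventuallyEq (analyticOnNhd_polyFun _) (analyticOnNhd_polyFun _)
        (z₀ := 0) ?_
      filter_upwards [Metric.closedBall_mem_nhds (0 : Space d) hc] with x hx
      simpa [polyFun] using h1 hx
    exact Subtype.ext (polyFun_ext h2)
  let b := Module.finBasis ℝ W
  choose A hA0 hA using fun i => exists_bound_of_definite_seminorm N hN (b.coord i)
  have hL : ∀ i, ∃ K : ℝ≥0, LipschitzOnWith K (polyFun (b i).1)
      (Metric.closedBall (0 : Space d) 1) := fun i =>
    ContDiffOn.exists_lipschitzOnWith (n := 1) (contDiff_polyFun _).contDiffOn one_ne_zero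
      (convex_closedBall _ _) (isCompact_closedBall _ _)
  choose L hL using hL
  have hB : ∀ i, ∃ B : ℝ, ∀ y ∈ Metric.closedBall (0 : Space d) 1, ‖polyFun (b i).1 y‖ ≤ B :=
    fun i => (isCompact_closedBall _ _).exists_bound_of_continuousOn
      (continuous_polyFun _).continuousOn
  choose B hB using hB
  have hB0 : ∀ i, 0 ≤ B i := fun i => (norm_nonneg _).trans (hB i 0 (by simp))
  have hrep : ∀ (p : W) y, polyFun p.1 y = ∑ i, b.repr p i * polyFun (b i).1 y := by
    intro p y
    have h := congrArg (fun q : W => polyFun q.1 y) (b.sum_repr p)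
    simp only [polyFun, Submodule.coe_sum, Submodule.coe_smul, map_sum,
      MvPolynomial.smul_eval] at h
    exact h.symm
  have hNn : ∀ p, 0 ≤ N p := fun p => apply_nonneg N p
  -- One constant serves the sup bound and the Lipschitz bound, whence `B i + L i`; the `+ 1` only
  -- makes it positive.
  refine ⟨∑ i, A i * (B i + L i) + 1, ?_, fun p hp y hy => ?_⟩
  · have : 0 ≤ ∑ i, A i * (B i + L i) := Finset.sum_nonneg fun i _ =>
      mul_nonneg (hA0 i) (add_nonneg (hB0 i) (L i).2)
    linarith
  · let q : W := ⟨p, (MvPolynomial.mem_restrictTotalDegree _ _ _).2 hp⟩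
    change |polyFun q.1 y| ≤ _ * N q ∧ ∀ z ∈ _, |polyFun q.1 y - polyFun q.1 z| ≤ _ * N q * _
    have hc1 : ∀ i, |b.repr q i| ≤ A i * N q := fun i => hA i q
    constructor
    · rw [hrep]
      calc |∑ i, b.repr q i * polyFun (b i).1 y|
          ≤ ∑ i, |b.repr q i * polyFun (b i).1 y| := Finset.abs_sum_le_sum_abs _ _
        _ ≤ ∑ i, A i * (B i + L i) * N q := by
            refine Finset.sum_le_sum fun i _ => ?_
            rw [abs_mul]
            have h1 := hB i y hy
            rw [Real.norm_eq_abs] at h1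
            calc _ ≤ A i * N q * (B i + L i) := mul_le_mul (hc1 i)
                    (h1.trans (le_add_of_nonneg_right (L i).2)) (abs_nonneg _)
                    (mul_nonneg (hA0 i) (hNn q))
              _ = _ := by ring
        _ ≤ _ := by
            rw [← Finset.sum_mul]
            have := hNn q
            nlinarith
    · intro z hz
      rw [hrep, hrep, ← Finset.sum_sub_distrib]
      calc |∑ i, (b.repr q i * polyFun (b i).1 y - b.repr q i * polyFun (b i).1 z)|
          ≤ ∑ i, |b.repr q i * polyFun (b i).1 y - b.repr q i * polyFun (b i).1 z| :=
            Finset.abs_sum_le_sum_abs _ _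
        _ ≤ ∑ i, A i * (B i + L i) * N q * ‖y - z‖ := by
            refine Finset.sum_le_sum fun i _ => ?_
            rw [← mul_sub, abs_mul]
            have h1 := (hL i).dist_le_mul y hy z hz
            rw [Real.dist_eq, dist_eq_norm] at h1
            calc _ ≤ A i * N q * ((B i + L i) * ‖y - z‖) := mul_le_mul (hc1 i)
                    (h1.trans (mul_le_mul_of_nonneg_right (le_add_of_nonneg_left (hB0 i))
                      (norm_nonneg _))) (abs_nonneg _) (mul_nonneg (hA0 i) (hNn q))
              _ = _ := by ring
        _ ≤ _ := by
            rw [← Finset.sum_mul, ← Finset.sum_mul]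
            have := mul_nonneg (hNn q) (norm_nonneg (y - z))
            nlinarith

/-- Local estimates for polynomials on a ball of radius `h` in terms of the mean over the concentric
ball of radius `c h`. -/
lemma exists_polyFun_bound (d k : ℕ) {c : ℝ} (hc : 0 < c) :
    ∃ C : ℝ, 0 < C ∧ ∀ p : MvPolynomial (Fin d) ℝ, p.totalDegree ≤ k →
      ∀ (x : Space d) (h : ℝ), 0 < h → ∀ y ∈ Metric.closedBall x h,
        |polyFun p y| ≤ C * ((h ^ d)⁻¹ * ∫ x in Metric.closedBall x (c * h), |polyFun p x|) ∧
        ∀ z ∈ Metric.closedBall x h, |polyFun p y - polyFun p z| ≤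
          C * ((h ^ d)⁻¹ * ∫ x in Metric.closedBall x (c * h), |polyFun p x|) / h * ‖y - z‖ := by
  obtain ⟨C, hC, H⟩ := exists_polyFun_bound_unit d k hc
  refine ⟨C, hC, fun p hp x h hh => ?_⟩
  -- Rescaling to the unit ball: `q ξ = p (x + h ξ)` is a homogenization with denominator `1`, which
  -- keeps the degree at most `k`.
  obtain ⟨q, hq, hqe⟩ := exists_homogenization hp (l := 1) (by simp)
    (N := fun i => MvPolynomial.C (x i) + MvPolynomial.C h * MvPolynomial.X i) (fun i => by
      refine (MvPolynomial.totalDegree_add _ _).trans (max_le (by simp) ?_)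
      exact (MvPolynomial.totalDegree_mul _ _).trans (by simp))
  have hqp : ∀ ξ : Space d, polyFun q ξ = polyFun p (x + h • ξ) := by
    intro ξ
    rw [polyFun, hqe _ (by simp)]
    simp [polyFun]
  have hJ : ∫ ξ in Metric.closedBall (0 : Space d) c, |polyFun q ξ| =
      (h ^ d)⁻¹ * ∫ x in Metric.closedBall x (c * h), |polyFun p x| := by
    simp_rw [hqp]
    rw [Measure.setIntegral_comp_smul_of_pos volume (fun ξ => |polyFun p (x + ξ)|) _ hh]
    rw [smul_closedBall _ _ hc.le, smul_zero, Real.norm_of_nonneg hh.le, mul_comm h c]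
    rw [finrank_euclideanSpace_fin, smul_eq_mul]
    congr 1
    have := (measurePreserving_add_left volume x).setIntegral_preimage_emb
      (measurableEmbedding_addLeft x) (fun y => |polyFun p y|) (Metric.closedBall x (c * h))
    rw [← this]
    congr 2
    ext y
    simp
  have hmem : ∀ y ∈ Metric.closedBall x h, h⁻¹ • (y - x) ∈ Metric.closedBall (0 : Space d) 1 := by
    intro y hy
    rw [mem_closedBall_zero_iff, norm_smul, norm_inv, Real.norm_of_nonneg hh.le]
    rw [Metric.mem_closedBall, dist_eq_norm] at hy
    rw [inv_mul_le_iff₀ hh]; linarith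
  have hval : ∀ y, polyFun q (h⁻¹ • (y - x)) = polyFun p y := by
    intro y
    rw [hqp, smul_smul, mul_inv_cancel₀ hh.ne', one_smul, add_sub_cancel]
  intro y hy
  obtain ⟨h1, h2⟩ := H q hq _ (hmem y hy)
  rw [hval, hJ] at h1
  refine ⟨h1, fun z hz => ?_⟩
  have h3 := h2 _ (hmem z hz)
  rw [hval, hval, hJ, ← smul_sub, norm_smul, norm_inv, Real.norm_of_nonneg hh.le,
    sub_sub_sub_cancel_right] at h3
  exact h3.trans (le_of_eq (by ring))

/-! ### Functions that are polynomial on a set -/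

lemma IsPolyOn.mono_deg {k k' : ℕ} {S : Set (Space d)} {u : Space d → ℝ} (h : IsPolyOn k S u)
    (hk : k ≤ k') : IsPolyOn k' S u :=
  let ⟨p, hp, hu⟩ := h
  ⟨p, hp.trans hk, hu⟩

lemma IsPolyOn.congr {k : ℕ} {S : Set (Space d)} {u v : Space d → ℝ} (h : IsPolyOn k S u)
    (huv : EqOn v u S) : IsPolyOn k S v :=
  let ⟨p, hp, hu⟩ := h
  ⟨p, hp, fun x hx => (huv hx).trans (hu x hx)⟩

lemma IsPolyOn.add {k : ℕ} {S : Set (Space d)} {u v : Space d → ℝ} (hu : IsPolyOn k S u)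
    (hv : IsPolyOn k S v) : IsPolyOn k S (fun x => u x + v x) := by
  obtain ⟨p, hp, hu⟩ := hu
  obtain ⟨q, hq, hv⟩ := hv
  exact ⟨p + q, (MvPolynomial.totalDegree_add _ _).trans (max_le hp hq),
    fun x hx => by simp [hu x hx, hv x hx]⟩

lemma IsPolyOn.const_mul {k : ℕ} {S : Set (Space d)} {u : Space d → ℝ} (c : ℝ)
    (hu : IsPolyOn k S u) : IsPolyOn k S (fun x => c * u x) := by
  obtain ⟨p, hp, hu⟩ := hu
  refine ⟨MvPolynomial.C c * p, (MvPolynomial.totalDegree_mul _ _).trans (by simpa using hp),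
    fun x hx => by simp [hu x hx]⟩

lemma isPolyOn_const {k : ℕ} {S : Set (Space d)} (c : ℝ) : IsPolyOn k S (fun _ => c) :=
  ⟨MvPolynomial.C c, by simp, fun x _ => by simp⟩

lemma IsPolyOn.sub {k : ℕ} {S : Set (Space d)} {u v : Space d → ℝ} (hu : IsPolyOn k S u)
    (hv : IsPolyOn k S v) : IsPolyOn k S (fun x => u x - v x) := by
  simpa [sub_eq_add_neg] using hu.add (hv.const_mul (-1))

lemma IsPolyOn.sum {ι : Type*} {k : ℕ} {S : Set (Space d)} {u : ι → Space d → ℝ} (s : Finset ι)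
    (hu : ∀ i ∈ s, IsPolyOn k S (u i)) : IsPolyOn k S (fun x => ∑ i ∈ s, u i x) := by
  classical
  induction s using Finset.induction_on with
  | empty => simpa using isPolyOn_const 0
  | insert i s hi ih =>
    simp_rw [Finset.sum_insert hi]
    exact (hu i (by simp)).add (ih fun j hj => hu j (by simp [hj]))

lemma IsPolyOn.continuousOn {k : ℕ} {S : Set (Space d)} {u : Space d → ℝ} (hu : IsPolyOn k S u) :
    ContinuousOn u S := by
  obtain ⟨p, -, hu⟩ := hu
  exact (continuous_polyFun p).continuousOn.congr hu

lemma isPolyOn_clm (L : Space d →L[ℝ] ℝ) (S : Set (Space d)) : IsPolyOn 1 S L := by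
  refine ⟨∑ i, MvPolynomial.C (L (EuclideanSpace.single i 1)) * MvPolynomial.X i, ?_, ?_⟩
  · refine MvPolynomial.totalDegree_finsetSum_le fun i _ => ?_
    exact (MvPolynomial.totalDegree_mul _ _).trans (by simp)
  · intro x _
    have hx : x = ∑ i, x i • EuclideanSpace.single i (1 : ℝ) := by
      ext j
      simp [Pi.single_apply]
    conv_lhs => rw [hx]
    simp [mul_comm]

end Polynomials

/-! ### Geometry of the mesh -/

section Mesh

variable {d : ℕ}

/-- A Lipschitz domain lies on one side of its boundary: arbitrarily close to a boundary point there
are points strictly below the graph, and these are outside the closure. A mesh only fills the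
closure of `Ω`; this fact puts the interiors of its elements inside `Ω`. -/
lemma IsBoundedLipschitz.interior_closure_subset {Ω : Set (Space d)} (hΩ : IsBoundedLipschitz Ω) :
    interior (closure Ω) ⊆ Ω := by
  intro x hx
  by_contra hxΩ
  have hfr : x ∈ frontier Ω := ⟨interior_subset hx, fun h => hxΩ (interior_subset h)⟩
  obtain ⟨e, he, r, hr, L, γ, hγ, hloc⟩ := hΩ.locally_graph x hfr
  have hxγ : inner ℝ e x ≤ γ (x - inner ℝ e x • e) := by
    by_contra! h
    have : x ∈ Ω ∩ Metric.ball x r := by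
      rw [hloc]; exact ⟨h, Metric.mem_ball_self hr⟩
    exact hxΩ this.1
  have hmem : interior (closure Ω) ∩ Metric.ball x r ∈ nhds x :=
    Filter.inter_mem (isOpen_interior.mem_nhds hx) (Metric.ball_mem_nhds x hr)
  have htend : Filter.Tendsto (fun t : ℝ => x - t • e) (nhdsWithin 0 (Ioi 0)) (nhds x) := by
    have : Continuous fun t : ℝ => x - t • e := by fun_prop
    simpa using (this.tendsto 0).mono_left nhdsWithin_le_nhds
  obtain ⟨t, htm, ht⟩ := ((htend.eventually hmem).and self_mem_nhdsWithin).exists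
  have ht : 0 < t := ht
  have hopen : IsOpen ({y | inner ℝ e y < γ (y - inner ℝ e y • e)} ∩ Metric.ball x r) := by
    refine (isOpen_lt (by fun_prop) ?_).inter Metric.isOpen_ball
    exact hγ.continuous.comp (by fun_prop)
  have hbelow : x - t • e ∈ {y | inner ℝ e y < γ (y - inner ℝ e y • e)} ∩ Metric.ball x r := by
    refine ⟨?_, htm.2⟩
    have h1 : inner ℝ e (x - t • e) = inner ℝ e x - t := by
      rw [inner_sub_right, inner_smul_right, real_inner_self_eq_norm_sq, he]; ring
    have h2 : x - t • e - (inner ℝ e x - t) • e = x - inner ℝ e x • e := by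
      rw [sub_smul]; abel
    simp only [mem_ofPred_eq, h1, h2]
    linarith
  obtain ⟨y, hy, hyΩ⟩ := mem_closure_iff.1 (interior_subset htm.1) _ hopen hbelow
  have : y ∈ Ω ∩ Metric.ball x r := ⟨hyΩ, hy.2⟩
  rw [hloc] at this
  have h1 : γ (y - inner ℝ e y • e) < inner ℝ e y := this.1
  have h2 : inner ℝ e y < γ (y - inner ℝ e y • e) := hy.1
  exact lt_asymm h1 h2

lemma volume_convexHull_eq_zero {s : Finset (Space d)} (hs : s.card ≤ d) :
    volume (convexHull ℝ (s : Set (Space d))) = 0 := by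
  rcases s.eq_empty_or_nonempty with rfl | hne
  · simp
  refine measure_mono_null (convexHull_subset_affineSpan _)
    (Measure.addHaar_affineSubspace _ _ fun htop => ?_)
  obtain ⟨n, hn⟩ : ∃ n, s.card = n + 1 := ⟨s.card - 1, by have := hne.card_pos; omega⟩
  have h1 := finrank_vectorSpan_range_le ℝ ((↑) : s → Space d) (n := n) (by simpa using hn)
  rw [Subtype.range_coe_subtype] at h1
  have h2 : vectorSpan ℝ {x : Space d | x ∈ s} = ⊤ := by
    rw [← direction_affineSpan]
    have : affineSpan ℝ {x : Space d | x ∈ s} = ⊤ := htop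
    rw [this, AffineSubspace.direction_top]
  rw [h2, finrank_top, finrank_euclideanSpace_fin] at h1
  omega

/-- The finset of (vertex sets of) elements of a finite simplicial complex. -/
noncomputable def elts (𝒯 : Geometry.SimplicialComplex ℝ (Space d)) : Finset (Finset (Space d)) :=
  open Classical in
  if h : 𝒯.faces.Finite then {s ∈ h.toFinset | s.card = d + 1} else ∅

variable {Ω : Set (Space d)} {𝒯 : Geometry.SimplicialComplex ℝ (Space d)}

lemma IsTriangulation.mem_elts (hT : IsTriangulation Ω 𝒯) {s : Finset (Space d)} :
    s ∈ elts 𝒯 ↔ s ∈ 𝒯.faces ∧ s.card = d + 1 := by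
  simp [elts, hT.finite]

lemma IsTriangulation.mem_elements (hT : IsTriangulation Ω 𝒯) {s : Finset (Space d)}
    (hs : s ∈ elts 𝒯) : convexHull ℝ (s : Set (Space d)) ∈ elements 𝒯 :=
  ⟨s, (hT.mem_elts.1 hs).1, (hT.mem_elts.1 hs).2, rfl⟩

lemma IsTriangulation.exists_of_mem_elements (hT : IsTriangulation Ω 𝒯) {S : Set (Space d)}
    (hS : S ∈ elements 𝒯) : ∃ s ∈ elts 𝒯, S = convexHull ℝ (s : Set (Space d)) := by
  obtain ⟨s, hs, hc, rfl⟩ := hS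
  exact ⟨s, hT.mem_elts.2 ⟨hs, hc⟩, rfl⟩

lemma isCompact_simplex (s : Finset (Space d)) :
    IsCompact (convexHull ℝ (s : Set (Space d))) :=
  s.finite_toSet.isCompact_convexHull ℝ

lemma IsTriangulation.simplex_subset_closure (hT : IsTriangulation Ω 𝒯) {s : Finset (Space d)}
    (hs : s ∈ elts 𝒯) : convexHull ℝ (s : Set (Space d)) ⊆ closure Ω := by
  rw [← hT.space_eq]
  exact Geometry.SimplicialComplex.convexHull_subset_space (hT.mem_elts.1 hs).1

lemma IsTriangulation.card_le (hT : IsTriangulation Ω 𝒯) {s : Finset (Space d)}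
    (hs : s ∈ 𝒯.faces) (hs' : s ∉ elts 𝒯) : s.card ≤ d := by
  have h1 := (𝒯.indep hs).card_le_finrank_succ
  have h2 := Submodule.finrank_le (vectorSpan ℝ (range ((↑) : s → Space d)))
  rw [finrank_euclideanSpace_fin] at h2
  have h3 : s.card ≠ d + 1 := fun h => hs' (hT.mem_elts.2 ⟨hs, h⟩)
  rw [Fintype.card_coe] at h1
  omega

/-- Faces that are not elements are null sets, so the part of `Ω` outside the elements is open and
null, hence empty; the finite union of elements is closed. -/
lemma IsTriangulation.iUnion_simplex (hT : IsTriangulation Ω 𝒯) (hΩ : IsOpen Ω) :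
    ⋃ s ∈ elts 𝒯, convexHull ℝ (s : Set (Space d)) = closure Ω := by
  refine subset_antisymm (iUnion₂_subset fun s hs => hT.simplex_subset_closure hs) ?_
  have hcl : IsClosed (⋃ s ∈ elts 𝒯, convexHull ℝ (s : Set (Space d))) :=
    (elts 𝒯).finite_toSet.isClosed_biUnion fun s _ => (isCompact_simplex s).isClosed
  refine closure_minimal (fun x hx => ?_) hcl
  by_contra hxn
  have hU : IsOpen (Ω \ ⋃ s ∈ elts 𝒯, convexHull ℝ (s : Set (Space d))) := hΩ.sdiff hcl
  have h0 : volume (Ω \ ⋃ s ∈ elts 𝒯, convexHull ℝ (s : Set (Space d))) = 0 := by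
    refine measure_mono_null (t := ⋃ s ∈ 𝒯.faces \ (elts 𝒯 : Set (Finset (Space d))),
      convexHull ℝ (s : Set (Space d))) ?_ ?_
    · rintro y ⟨hy, hyn⟩
      have : y ∈ 𝒯.space := by rw [hT.space_eq]; exact subset_closure hy
      obtain ⟨s, hs, hys⟩ := Geometry.SimplicialComplex.mem_space_iff.1 this
      refine mem_iUnion₂.2 ⟨s, ⟨hs, fun hse => hyn (mem_iUnion₂.2 ⟨s, hse, hys⟩)⟩, hys⟩
    · refine (measure_biUnion_null_iff (hT.finite.subset sdiff_subset).countable).2 fun s hs => ?_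
      exact volume_convexHull_eq_zero (hT.card_le hs.1 hs.2)
  have := (hU.measure_eq_zero_iff volume).1 h0
  exact (this ▸ (⟨hx, hxn⟩ : x ∈ Ω \ _) : x ∈ (∅ : Set (Space d)))

lemma IsTriangulation.interior_simplex_subset (hT : IsTriangulation Ω 𝒯)
    (hΩ : IsBoundedLipschitz Ω) {s : Finset (Space d)} (hs : s ∈ elts 𝒯) :
    interior (convexHull ℝ (s : Set (Space d))) ⊆ Ω :=
  (interior_mono (hT.simplex_subset_closure hs)).trans hΩ.interior_closure_subset

/-- Two elements meet inside the hull of their common vertices. Distinct elements share at most `d`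
vertices, so their interiors meet in a set that is open and null. -/
lemma IsTriangulation.pairwiseDisjoint (hT : IsTriangulation Ω 𝒯) :
    (elts 𝒯 : Set (Finset (Space d))).PairwiseDisjoint
      fun s => interior (convexHull ℝ (s : Set (Space d))) := by
  classical
  intro s hs t ht hst
  rw [Function.onFun, Set.disjoint_iff_inter_eq_empty]
  have hs' := hT.mem_elts.1 hs
  have ht' := hT.mem_elts.1 ht
  rw [← (isOpen_interior.inter isOpen_interior).measure_eq_zero_iff volume]
  refine measure_mono_null ((inter_subset_inter interior_subset interior_subset).trans
    (𝒯.inter_subset_convexHull hs'.1 ht'.1)) ?_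
  rw [← Finset.coe_inter]
  refine volume_convexHull_eq_zero ?_
  by_contra! h
  have h1 : s ∩ t = s := Finset.eq_of_subset_of_card_le Finset.inter_subset_left (by omega)
  have h2 : s ∩ t = t := Finset.eq_of_subset_of_card_le Finset.inter_subset_right (by omega)
  exact hst (h1.symm.trans h2)

lemma simplex_ae_eq_interior (s : Finset (Space d)) :
    (convexHull ℝ (s : Set (Space d)) : Set (Space d)) =ᵐ[volume]
      interior (convexHull ℝ (s : Set (Space d))) := by
  have h := (convex_convexHull ℝ (s : Set (Space d))).addHaar_frontier volume
  refine (ae_eq_set.2 ⟨?_, ?_⟩)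
  · refine measure_mono_null ?_ h
    rw [(isCompact_simplex s).isClosed.frontier_eq]
  · simp [sdiff_eq_empty.2 interior_subset]

lemma IsTriangulation.ae_eq_iUnion (hT : IsTriangulation Ω 𝒯) (hΩ : IsBoundedLipschitz Ω) :
    Ω =ᵐ[volume] ⋃ s ∈ elts 𝒯, interior (convexHull ℝ (s : Set (Space d))) := by
  refine ae_eq_set.2 ⟨?_, ?_⟩
  · refine measure_mono_null (t := ⋃ s ∈ elts 𝒯, frontier (convexHull ℝ (s : Set (Space d)))) ?_ ?_
    · rintro y ⟨hy, hyn⟩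
      have : y ∈ ⋃ s ∈ elts 𝒯, convexHull ℝ (s : Set (Space d)) := by
        rw [hT.iUnion_simplex hΩ.isOpen]; exact subset_closure hy
      obtain ⟨s, hs, hys⟩ := mem_iUnion₂.1 this
      exact mem_iUnion₂.2 ⟨s, hs, subset_closure hys, fun h => hyn (mem_iUnion₂.2 ⟨s, hs, h⟩)⟩
    · exact (measure_biUnion_null_iff (elts 𝒯).countable_toSet).2 fun s _ =>
        (convex_convexHull ℝ _).addHaar_frontier volume
  · have h : (⋃ s ∈ elts 𝒯, interior (convexHull ℝ (s : Set (Space d)))) ⊆ Ω :=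
      iUnion₂_subset fun s hs => hT.interior_simplex_subset hΩ hs
    simp [sdiff_eq_empty.2 h]

lemma IsTriangulation.ae_mem_interior (hT : IsTriangulation Ω 𝒯) (hΩ : IsBoundedLipschitz Ω) :
    ∀ᵐ x, x ∈ Ω → ∃ s ∈ elts 𝒯, x ∈ interior (convexHull ℝ (s : Set (Space d))) := by
  filter_upwards [hT.ae_eq_iUnion hΩ] with x hx hxΩ
  have h : x ∈ ⋃ s ∈ elts 𝒯, interior (convexHull ℝ (s : Set (Space d))) := hx.mp hxΩ
  simpa using h

lemma IsTriangulation.setIntegral_eq_sum (hT : IsTriangulation Ω 𝒯) (hΩ : IsBoundedLipschitz Ω)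
    {u : Space d → ℝ} (hu : IntegrableOn u Ω) :
    ∫ x in Ω, u x = ∑ s ∈ elts 𝒯, ∫ x in convexHull ℝ (s : Set (Space d)), u x := by
  rw [setIntegral_congr_set (hT.ae_eq_iUnion hΩ), integral_biUnion_finset _
    (fun s _ => isOpen_interior.measurableSet) hT.pairwiseDisjoint
    (fun s hs => hu.mono_set (hT.interior_simplex_subset hΩ hs))]
  exact Finset.sum_congr rfl fun s _ => (setIntegral_congr_set (simplex_ae_eq_interior s)).symm

/-! ### Piecewise linear interpolation -/

lemma AffineIndependent_coeff_unique {s : Finset (Space d)}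
    (hs : AffineIndependent ℝ ((↑) : s → Space d)) {w w' : Space d → ℝ}
    (h1 : ∑ v ∈ s, w v = ∑ v ∈ s, w' v) (h2 : ∑ v ∈ s, w v • v = ∑ v ∈ s, w' v • v) :
    ∀ v ∈ s, w v = w' v := by
  have h := affineIndependent_iff.1 hs Finset.univ (fun v => w v - w' v) ?_ ?_
  · intro v hv
    have := h ⟨v, hv⟩ (Finset.mem_univ _)
    linarith
  · rw [Finset.univ_eq_attach, Finset.sum_attach s (fun v => w v - w' v), Finset.sum_sub_distrib, h1,
      sub_self]
  · rw [Finset.univ_eq_attach, Finset.sum_attach s (fun v => (w v - w' v) • v)]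
    simp_rw [sub_smul]
    rw [Finset.sum_sub_distrib, h2, sub_self]

/-- `w` is a system of barycentric coordinates of `x` with respect to the vertex set `s`. -/
def IsBary (s : Finset (Space d)) (w : Space d → ℝ) (x : Space d) : Prop :=
  (∀ v ∈ s, 0 ≤ w v) ∧ ∑ v ∈ s, w v = 1 ∧ ∑ v ∈ s, w v • v = x

lemma exists_isBary {s : Finset (Space d)} {x : Space d}
    (hx : x ∈ convexHull ℝ (s : Set (Space d))) : ∃ w, IsBary s w x :=
  Finset.mem_convexHull'.1 hx

lemma IsBary.mem {s : Finset (Space d)} {x : Space d} {w : Space d → ℝ} (h : IsBary s w x) :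
    x ∈ convexHull ℝ (s : Set (Space d)) :=
  Finset.mem_convexHull'.2 ⟨w, h⟩

/-- This is where face-to-face meshes matter: a point of two faces lies in the hull of the common
vertices, and affine independence makes its other barycentric coordinates vanish in either face.
Hence `interp` does not depend on the face chosen in its definition. -/
lemma IsBary.sum_eq (𝒯 : Geometry.SimplicialComplex ℝ (Space d)) {s t : Finset (Space d)}
    (hs : s ∈ 𝒯.faces) (ht : t ∈ 𝒯.faces) {x : Space d} {w w' : Space d → ℝ}
    (h : IsBary s w x) (h' : IsBary t w' x) (F : Space d → ℝ) :
    ∑ v ∈ s, w v * F v = ∑ v ∈ t, w' v * F v := by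
  classical
  have hx : x ∈ convexHull ℝ ((s ∩ t : Finset (Space d)) : Set (Space d)) := by
    rw [Finset.coe_inter]
    exact 𝒯.inter_subset_convexHull hs ht ⟨h.mem, h'.mem⟩
  obtain ⟨w₀, -, h1, h2⟩ := exists_isBary hx
  have key : ∀ {s' : Finset (Space d)} {w : Space d → ℝ}, s' ∈ 𝒯.faces → IsBary s' w x →
      s ∩ t ⊆ s' → ∑ v ∈ s', w v * F v = ∑ v ∈ s ∩ t, w₀ v * F v := by
    intro s' w hs' hw hsub
    have hu := AffineIndependent_coeff_unique (𝒯.indep hs') (w := w)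
      (w' := fun v => if v ∈ s ∩ t then w₀ v else 0) ?_ ?_
    · rw [← Finset.sum_subset hsub (f := fun v => w v * F v)]
      · exact Finset.sum_congr rfl fun v hv => by rw [hu v (hsub hv), if_pos hv]
      · intro v hv hvn
        rw [hu v hv, if_neg hvn, zero_mul]
    · rw [hw.2.1, Finset.sum_ite_mem, Finset.inter_eq_right.2 hsub, h1]
    · simp_rw [ite_smul, zero_smul]
      rw [hw.2.2, Finset.sum_ite_mem, Finset.inter_eq_right.2 hsub, h2]
  rw [key hs h Finset.inter_subset_left, key ht h' Finset.inter_subset_right]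

open Classical in
/-- The continuous piecewise linear interpolant of the vertex values `F`. -/
noncomputable def interp (𝒯 : Geometry.SimplicialComplex ℝ (Space d)) (F : Space d → ℝ)
    (x : Space d) : ℝ :=
  if h : ∃ sw : Finset (Space d) × (Space d → ℝ), sw.1 ∈ 𝒯.faces ∧ IsBary sw.1 sw.2 x then
    ∑ v ∈ h.choose.1, h.choose.2 v * F v
  else 0

lemma interp_eq {s : Finset (Space d)} (hs : s ∈ 𝒯.faces) {w : Space d → ℝ} {x : Space d}
    (hw : IsBary s w x) (F : Space d → ℝ) : interp 𝒯 F x = ∑ v ∈ s, w v * F v := by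
  have h : ∃ sw : Finset (Space d) × (Space d → ℝ), sw.1 ∈ 𝒯.faces ∧ IsBary sw.1 sw.2 x :=
    ⟨⟨s, w⟩, hs, hw⟩
  rw [interp, dif_pos h]
  exact IsBary.sum_eq 𝒯 h.choose_spec.1 hs h.choose_spec.2 hw F

/-- The `d + 1` vertices of an element form an affine basis, so barycentric coordinates on it are
restrictions of affine functions. -/
lemma isPolyOn_interp {s : Finset (Space d)} (hs : s ∈ 𝒯.faces) (hcard : s.card = d + 1)
    (F : Space d → ℝ) : IsPolyOn 1 (convexHull ℝ (s : Set (Space d))) (interp 𝒯 F) := by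
  have hind := 𝒯.indep hs
  have htop : affineSpan ℝ (range ((↑) : s → Space d)) = ⊤ := by
    rw [hind.affineSpan_eq_top_iff_card_eq_finrank_add_one]
    simpa using hcard
  let b : AffineBasis s ℝ (Space d) := ⟨(↑), hind, htop⟩
  have hcoord : ∀ v : s, IsPolyOn 1 (convexHull ℝ (s : Set (Space d))) (b.coord v) := by
    intro v
    rw [AffineMap.decomp (b.coord v)]
    exact (isPolyOn_clm (LinearMap.toContinuousLinearMap (b.coord v).linear) _).add
      (isPolyOn_const _)
  refine (IsPolyOn.sum Finset.univ fun v (_ : v ∈ Finset.univ) =>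
    (hcoord v).const_mul (F v)).congr fun x hx => ?_
  obtain ⟨w, hw⟩ := exists_isBary hx
  rw [interp_eq hs hw, ← Finset.sum_coe_sort]
  refine Finset.sum_congr rfl fun v _ => ?_
  have h1 : x = Finset.affineCombination ℝ Finset.univ b (fun v : s => w v) := by
    have hone : ∑ v : s, w v = 1 := by rw [Finset.sum_coe_sort s w]; exact hw.2.1
    rw [Finset.affineCombination_eq_linear_combination _ _ _ hone, ← hw.2.2,
      ← Finset.sum_coe_sort]
    rfl
  have h2 : b.coord v x = w v := by
    rw [h1]
    refine b.coord_apply_combination_of_mem (Finset.mem_univ v) ?_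
    rw [Finset.sum_coe_sort s w]; exact hw.2.1
  rw [h2, mul_comm]

/-! ### Basic properties of the finite element spaces -/

variable {k : ℕ}

lemma IsTriangulation.mem_densitySpace_iff (hT : IsTriangulation Ω 𝒯) {r : Space d → ℝ} :
    r ∈ densitySpace 𝒯 k ↔ ∀ s ∈ elts 𝒯, IsPolyOn k (convexHull ℝ (s : Set (Space d))) r := by
  refine ⟨fun h s hs => h _ (hT.mem_elements hs), fun h S hS => ?_⟩
  obtain ⟨s, hs, rfl⟩ := hT.exists_of_mem_elements hS
  exact h s hs

lemma densitySpace_sub {r r' : Space d → ℝ} (hr : r ∈ densitySpace 𝒯 k)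
    (hr' : r' ∈ densitySpace 𝒯 k) : (fun x => r x - r' x) ∈ densitySpace 𝒯 k :=
  fun S hS => (hr S hS).sub (hr' S hS)

lemma IsTriangulation.continuousOn (hT : IsTriangulation Ω 𝒯) (hΩ : IsOpen Ω)
    {r : Space d → ℝ} (hr : r ∈ densitySpace 𝒯 k) : ContinuousOn r (closure Ω) := by
  rw [← hT.iUnion_simplex hΩ]
  have h := LocallyFinite.continuousOn_iUnion (f := fun s : elts 𝒯 =>
    convexHull ℝ ((s : Finset (Space d)) : Set (Space d))) (g := r) (locallyFinite_of_finite _)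
    (fun _ => (isCompact_simplex _).isClosed)
    (fun s => (hr _ (hT.mem_elements s.2)).continuousOn)
  rwa [iUnion_subtype (fun s => s ∈ elts 𝒯)
    (fun s => convexHull ℝ ((s : Finset (Space d)) : Set (Space d)))] at h

lemma interp_mem_densitySpace (hT : IsTriangulation Ω 𝒯) (hk : 1 ≤ k) (F : Space d → ℝ) :
    interp 𝒯 F ∈ densitySpace 𝒯 k :=
  hT.mem_densitySpace_iff.2 fun _ hs =>
    (isPolyOn_interp (hT.mem_elts.1 hs).1 (hT.mem_elts.1 hs).2 F).mono_deg hk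

end Mesh

/-- Jensen's inequality for powers on a finite measure space. -/
lemma rpow_integral_le {X : Type*} [MeasurableSpace X] {μ : Measure X} [IsFiniteMeasure μ] {p : ℝ}
    (hp : 1 ≤ p) {f : X → ℝ} (hf0 : ∀ x, 0 ≤ f x) (hf : Integrable f μ)
    (hfp : Integrable (fun x => f x ^ p) μ) :
    (∫ x, f x ∂μ) ^ p ≤ μ.real univ ^ (p - 1) * ∫ x, f x ^ p ∂μ := by
  rcases eq_or_ne μ 0 with rfl | hμ
  · simp [Real.zero_rpow (by linarith : p ≠ 0)]
  have : NeZero μ := ⟨hμ⟩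
  have hm : 0 < μ.real univ := by
    rw [measureReal_def]; exact ENNReal.toReal_pos (by simpa using hμ) (measure_ne_top _ _)
  have h := (convexOn_rpow hp).map_average_le (μ := μ) (f := f)
    (Real.continuous_rpow_const (by linarith)).continuousOn isClosed_Ici (ae_of_all _ hf0) hf hfp
  rw [average_eq, average_eq, smul_eq_mul, smul_eq_mul, Real.mul_rpow (inv_nonneg.2 hm.le)
    (integral_nonneg hf0), Real.inv_rpow hm.le, inv_mul_le_iff₀ (Real.rpow_pos_of_pos hm _)] at h
  refine h.trans (le_of_eq ?_)
  rw [Real.rpow_sub_one hm.ne']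
  ring

lemma norm_gradient_eq {F : Type*} [NormedAddCommGroup F] [InnerProductSpace ℝ F] [CompleteSpace F]
    (u : F → ℝ) (x : F) : ‖gradient u x‖ = ‖fderiv ℝ u x‖ := by
  simp [gradient]

/-! ### Quasiuniform meshes, summable decay and local inverse estimates -/

section Quasi

variable {d : ℕ}

/-- A triangulation of `Ω` all of whose elements have diameter at most `h` and contain a ball of
radius `c h`, centred at the chosen point `ctr`. -/
structure QuasiMesh (Ω : Set (Space d)) (𝒯 : Geometry.SimplicialComplex ℝ (Space d)) (c h : ℝ)
    (ctr : Finset (Space d) → Space d) : Prop where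
  lip : IsBoundedLipschitz Ω
  tri : IsTriangulation Ω 𝒯
  c_pos : 0 < c
  h_pos : 0 < h
  dist_le : ∀ s ∈ elts 𝒯, ∀ x ∈ convexHull ℝ (s : Set (Space d)),
    ∀ y ∈ convexHull ℝ (s : Set (Space d)), dist x y ≤ h
  ball_subset : ∀ s ∈ elts 𝒯, Metric.closedBall (ctr s) (c * h) ⊆ convexHull ℝ (s : Set (Space d))

/-- The mesh size is the maximal diameter, attained at some element `s₀`; comparing every element
with `s₀` in the quasiuniformity condition gives inner balls of the single radius `c h`.
Nonemptiness of `Ω` provides an element, and `1 ≤ d` provides two vertices, so that `h > 0`. -/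
lemma exists_quasiMesh (hd : 1 ≤ d) {Ω : Set (Space d)} (hΩ : IsBoundedLipschitz Ω)
    (hne : Ω.Nonempty) {𝒯 : Geometry.SimplicialComplex ℝ (Space d)} (hT : IsTriangulation Ω 𝒯)
    {c : ℝ} (hc : 0 < c) (hq : ∀ S ∈ elements 𝒯, ∀ S' ∈ elements 𝒯,
      ∃ x, Metric.closedBall x (c * Metric.diam S') ⊆ S) :
    ∃ h ctr, QuasiMesh Ω 𝒯 c h ctr := by
  have hEne : (elts 𝒯).Nonempty := by
    obtain ⟨x, hx⟩ := hne
    have : x ∈ ⋃ s ∈ elts 𝒯, convexHull ℝ (s : Set (Space d)) := by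
      rw [hT.iUnion_simplex hΩ.isOpen]; exact subset_closure hx
    obtain ⟨s, hs, -⟩ := mem_iUnion₂.1 this
    exact ⟨s, hs⟩
  obtain ⟨s₀, hs₀, hmax⟩ := (elts 𝒯).exists_max_image
    (fun s => Metric.diam (convexHull ℝ (s : Set (Space d)))) hEne
  have hb : ∀ s : Finset (Space d), Bornology.IsBounded (convexHull ℝ (s : Set (Space d))) :=
    fun s => (isCompact_simplex s).isBounded
  have hex : ∀ s : Finset (Space d), ∃ x, s ∈ elts 𝒯 → Metric.closedBall x
      (c * Metric.diam (convexHull ℝ (s₀ : Set (Space d)))) ⊆ convexHull ℝ (s : Set (Space d)) := by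
    intro s
    by_cases hs : s ∈ elts 𝒯
    · obtain ⟨x, hx⟩ := hq _ (hT.mem_elements hs) _ (hT.mem_elements hs₀)
      exact ⟨x, fun _ => hx⟩
    · exact ⟨0, fun h => (hs h).elim⟩
  choose ctr hctr using hex
  refine ⟨Metric.diam (convexHull ℝ (s₀ : Set (Space d))), ctr, hΩ, hT, hc, ?_, ?_,
    fun s hs => hctr s hs⟩
  · obtain ⟨a, ha, b, hb', hab⟩ := Finset.one_lt_card.1
      (by rw [(hT.mem_elts.1 hs₀).2]; omega : 1 < s₀.card)
    refine (dist_pos.2 hab).trans_le (Metric.dist_le_diam_of_mem (hb s₀) ?_ ?_)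
    · exact subset_convexHull ℝ _ ha
    · exact subset_convexHull ℝ _ hb'
  · exact fun s hs x hx y hy => (Metric.dist_le_diam_of_mem (hb s) hx hy).trans (hmax s hs)

/-- The mean absolute value of `v` over an element, up to the normalization `h ^ d`. -/
noncomputable def emean (h : ℝ) (s : Finset (Space d)) (v : Space d → ℝ) : ℝ :=
  (h ^ d)⁻¹ * ∫ x in convexHull ℝ (s : Set (Space d)), |v x|

/-- The volume of the unit ball. -/
noncomputable def ballVol (d : ℕ) : ℝ := volume.real (Metric.closedBall (0 : Space d) 1)

lemma ballVol_pos (d : ℕ) : 0 < ballVol d :=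
  ENNReal.toReal_pos (Metric.measure_closedBall_pos _ _ one_pos).ne' measure_closedBall_lt_top.ne

lemma volume_real_closedBall (x : Space d) {r : ℝ} (hr : 0 ≤ r) :
    volume.real (Metric.closedBall x r) = r ^ d * ballVol d := by
  rw [Measure.real, Measure.addHaar_closedBall' _ _ hr, ENNReal.toReal_mul,
    ENNReal.toReal_ofReal (pow_nonneg hr _), finrank_euclideanSpace_fin]
  rfl

namespace QuasiMesh

variable {Ω : Set (Space d)} {𝒯 : Geometry.SimplicialComplex ℝ (Space d)} {c h : ℝ}
  {ctr : Finset (Space d) → Space d} (M : QuasiMesh Ω 𝒯 c h ctr)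
include M

lemma ctr_mem {s : Finset (Space d)} (hs : s ∈ elts 𝒯) :
    ctr s ∈ convexHull ℝ (s : Set (Space d)) :=
  M.ball_subset s hs (Metric.mem_closedBall_self (mul_pos M.c_pos M.h_pos).le)

lemma subset_ball {s : Finset (Space d)} (hs : s ∈ elts 𝒯) :
    convexHull ℝ (s : Set (Space d)) ⊆ Metric.closedBall (ctr s) h :=
  fun x hx => M.dist_le s hs x hx _ (M.ctr_mem hs)

lemma volume_real_le {s : Finset (Space d)} (hs : s ∈ elts 𝒯) :
    volume.real (convexHull ℝ (s : Set (Space d))) ≤ h ^ d * ballVol d := by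
  rw [← volume_real_closedBall (ctr s) M.h_pos.le]
  exact measureReal_mono (M.subset_ball hs) measure_closedBall_lt_top.ne

lemma emean_nonneg (s : Finset (Space d)) (v : Space d → ℝ) : 0 ≤ emean h s v :=
  mul_nonneg (inv_nonneg.2 (pow_nonneg M.h_pos.le _)) (integral_nonneg fun _ => abs_nonneg _)

lemma integral_abs_eq (s : Finset (Space d)) (v : Space d → ℝ) :
    ∫ x in convexHull ℝ (s : Set (Space d)), |v x| = h ^ d * emean h s v := by
  rw [emean, mul_inv_cancel_left₀ (pow_pos M.h_pos _).ne']

end QuasiMesh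

/-- Polynomial decay away from a point is uniformly summable over the elements of a mesh. -/
lemma exists_sum_decay_le (d : ℕ) {c : ℝ} (hc : 0 < c) :
    ∃ C : ℝ, 0 < C ∧ ∀ {Ω : Set (Space d)} {𝒯 : Geometry.SimplicialComplex ℝ (Space d)} {h : ℝ}
      {ctr : Finset (Space d) → Space d}, QuasiMesh Ω 𝒯 c h ctr → ∀ y : Space d,
      ∑ s ∈ elts 𝒯, ((1 + dist (ctr s) y / h) ^ (d + 1))⁻¹ ≤ C := by
  have hint : Integrable (fun x : Space d => ((1 + ‖x‖) ^ (d + 1))⁻¹) := by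
    -- The exponent `d + 1` is the first integer above the dimension, so the profile is integrable.
    have := integrable_one_add_norm (E := Space d) (μ := volume) (r := (d + 1 : ℕ))
      (by rw [finrank_euclideanSpace_fin]; push_cast; linarith)
    refine this.congr (ae_of_all _ fun x => ?_)
    simp only
    rw [Real.rpow_neg (by positivity), Real.rpow_natCast]
  set I : ℝ := ∫ x : Space d, ((1 + ‖x‖) ^ (d + 1))⁻¹ with hI
  have hI0 : 0 ≤ I := integral_nonneg fun x => by positivity
  have hb := ballVol_pos d
  refine ⟨(2 ^ (d + 1) * I + 1) / (c ^ d * ballVol d), by positivity, ?_⟩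
  intro Ω 𝒯 h ctr M y
  have hh := M.h_pos
  rw [le_div_iff₀ (by positivity), Finset.sum_mul]
  let G : Space d → ℝ := fun x => ((1 + dist x y / h) ^ (d + 1))⁻¹
  have hGeq : G = fun x => ((1 + ‖h⁻¹ • (x - y)‖) ^ (d + 1))⁻¹ := by
    funext x
    simp only [G]
    rw [norm_smul, norm_inv, Real.norm_of_nonneg hh.le, dist_eq_norm, div_eq_inv_mul]
  have hGint : Integrable G := by
    rw [hGeq]
    have h1 := hint.comp_smul (inv_ne_zero hh.ne')
    exact h1.comp_sub_right y
  have hGval : ∫ x, G x = h ^ d * I := by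
    rw [hGeq, integral_sub_right_eq_self (fun x : Space d => ((1 + ‖h⁻¹ • x‖) ^ (d + 1))⁻¹) y,
      Measure.integral_comp_smul volume (fun x : Space d => ((1 + ‖x‖) ^ (d + 1))⁻¹) h⁻¹]
    rw [finrank_euclideanSpace_fin, smul_eq_mul, inv_pow, inv_inv, abs_of_pos (by positivity)]
  have hG0 : ∀ x, 0 ≤ G x := fun x => by simp only [G]; positivity
  -- Comparison of the sum with an integral: an element has volume at least `(c h)^d` times that of
  -- the unit ball, and moving inside it lowers the profile by a factor of at most `2^(d+1)`.
  have helem : ∀ s ∈ elts 𝒯, ((1 + dist (ctr s) y / h) ^ (d + 1))⁻¹ * (c ^ d * ballVol d) ≤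
      2 ^ (d + 1) * (h ^ d)⁻¹ * ∫ x in interior (convexHull ℝ (s : Set (Space d))), G x := by
    intro s hs
    have hlow : ∀ x ∈ interior (convexHull ℝ (s : Set (Space d))),
        ((1 + dist (ctr s) y / h) ^ (d + 1))⁻¹ ≤ 2 ^ (d + 1) * G x := by
      intro x hx
      have hx' := M.subset_ball hs (interior_subset hx)
      simp only [G]
      have h1 : 1 + dist x y / h ≤ 2 * (1 + dist (ctr s) y / h) := by
        have : dist x y ≤ h + dist (ctr s) y :=
          (dist_triangle x (ctr s) y).trans (add_le_add hx' le_rfl)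
        have h3 : dist x y / h ≤ 1 + dist (ctr s) y / h := by
          rw [div_le_iff₀ hh, add_mul, div_mul_cancel₀ _ hh.ne', one_mul]; exact this
        have : 0 ≤ dist (ctr s) y / h := by positivity
        linarith
      have h2 : (1 + dist x y / h) ^ (d + 1) ≤ (2 * (1 + dist (ctr s) y / h)) ^ (d + 1) :=
        pow_le_pow_left₀ (by positivity) h1 _
      rw [mul_pow] at h2
      rw [inv_le_iff_one_le_mul₀ (by positivity), mul_assoc, ← div_eq_inv_mul,
        ← mul_div_assoc, le_div_iff₀ (by positivity), one_mul]
      exact h2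
    have hvol : c ^ d * ballVol d * h ^ d ≤
        volume.real (interior (convexHull ℝ (s : Set (Space d)))) := by
      rw [← measureReal_congr (simplex_ae_eq_interior s)]
      calc c ^ d * ballVol d * h ^ d = (c * h) ^ d * ballVol d := by ring
        _ = volume.real (Metric.closedBall (ctr s) (c * h)) :=
          (volume_real_closedBall _ (by positivity)).symm
        _ ≤ _ := measureReal_mono (M.ball_subset s hs) (isCompact_simplex s).measure_lt_top.ne
    have h3 : ((1 + dist (ctr s) y / h) ^ (d + 1))⁻¹ *
        volume.real (interior (convexHull ℝ (s : Set (Space d)))) ≤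
        2 ^ (d + 1) * ∫ x in interior (convexHull ℝ (s : Set (Space d))), G x := by
      rw [← integral_const_mul, mul_comm, ← smul_eq_mul, ← setIntegral_const]
      have hfin : volume (interior (convexHull ℝ (s : Set (Space d)))) < ⊤ :=
        (measure_mono interior_subset).trans_lt (isCompact_simplex s).measure_lt_top
      refine setIntegral_mono_on (integrableOn_const hfin.ne) (hGint.integrableOn.const_mul _)
        isOpen_interior.measurableSet hlow
    have h4 : 0 ≤ ((1 + dist (ctr s) y / h) ^ (d + 1))⁻¹ := by positivity
    have h5 := mul_le_mul_of_nonneg_left hvol h4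
    have hhd : 0 < h ^ d := by positivity
    rw [mul_right_comm, ← div_eq_mul_inv, le_div_iff₀ hhd]
    linarith
  refine (Finset.sum_le_sum helem).trans ?_
  rw [← Finset.mul_sum, ← integral_biUnion_finset _ (fun s _ => isOpen_interior.measurableSet)
    M.tri.pairwiseDisjoint (fun s _ => hGint.integrableOn)]
  have h6 : ∫ x in ⋃ s ∈ elts 𝒯, interior (convexHull ℝ (s : Set (Space d))), G x ≤ h ^ d * I := by
    rw [← hGval]
    exact setIntegral_le_integral hGint (ae_of_all _ hG0)
  calc _ ≤ 2 ^ (d + 1) * (h ^ d)⁻¹ * (h ^ d * I) := by gcongr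
    _ = 2 ^ (d + 1) * I := by field_simp
    _ ≤ _ := by linarith

/-- Local estimates for polynomials on the elements of a mesh: bound, inverse inequality. -/
lemma exists_elem_bound (d k : ℕ) {c : ℝ} (hc : 0 < c) :
    ∃ C : ℝ, 0 < C ∧ ∀ {Ω : Set (Space d)} {𝒯 : Geometry.SimplicialComplex ℝ (Space d)} {h : ℝ}
      {ctr : Finset (Space d) → Space d}, QuasiMesh Ω 𝒯 c h ctr → ∀ s ∈ elts 𝒯,
      ∀ v : Space d → ℝ, IsPolyOn k (convexHull ℝ (s : Set (Space d))) v →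
      (∀ y ∈ convexHull ℝ (s : Set (Space d)), |v y| ≤ C * emean h s v) ∧
      (∀ y ∈ convexHull ℝ (s : Set (Space d)), ∀ z ∈ convexHull ℝ (s : Set (Space d)),
        |v y - v z| ≤ C * emean h s v / h * ‖y - z‖) ∧
      ∀ y ∈ interior (convexHull ℝ (s : Set (Space d))),
        ‖gradient v y‖ ≤ C * emean h s v / h := by
  obtain ⟨C, hC, H⟩ := exists_polyFun_bound d k hc
  refine ⟨C, hC, ?_⟩
  rintro Ω 𝒯 h ctr M s hs v ⟨p, hp, hv⟩
  have hh := M.h_pos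
  have hmean : (h ^ d)⁻¹ * ∫ x in Metric.closedBall (ctr s) (c * h), |polyFun p x| ≤
      emean h s v := by
    have h1 : ∫ x in convexHull ℝ (s : Set (Space d)), |v x| =
        ∫ x in convexHull ℝ (s : Set (Space d)), |polyFun p x| :=
      setIntegral_congr_fun (isCompact_simplex s).isClosed.measurableSet
        fun x hx => by simp only [hv x hx, polyFun]
    rw [emean, h1]
    refine mul_le_mul_of_nonneg_left ?_ (by positivity)
    exact setIntegral_mono_set
      ((continuous_polyFun p).abs.continuousOn.integrableOn_compact (isCompact_simplex s))
      (ae_of_all _ fun x => abs_nonneg _) (M.ball_subset s hs).eventuallyLE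
  have hlip : ∀ y ∈ convexHull ℝ (s : Set (Space d)), ∀ z ∈ convexHull ℝ (s : Set (Space d)),
        |v y - v z| ≤ C * emean h s v / h * ‖y - z‖ := fun y hy z hz => by
    rw [hv y hy, hv z hz]
    refine ((H p hp _ h hh y (M.subset_ball hs hy)).2 z (M.subset_ball hs hz)).trans ?_
    gcongr
  refine ⟨fun y hy => ?_, hlip, fun y hy => ?_⟩
  · rw [hv y hy]
    exact (H p hp _ h hh y (M.subset_ball hs hy)).1.trans (by gcongr)
  · rw [norm_gradient_eq]
    have h0 : 0 ≤ C * emean h s v / h :=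
      div_nonneg (mul_nonneg hC.le (M.emean_nonneg s v)) hh.le
    refine norm_fderiv_le_of_lip' ℝ h0 ?_
    filter_upwards [isOpen_interior.mem_nhds hy] with z hz
    exact hlip z (interior_subset hz) y (interior_subset hy)

end Quasi

/-! ### Weighted stability of the `L²`-projection -/

section Projection

variable {d : ℕ}

lemma abs_weighted_sub_le {s : Finset (Space d)} {w F : Space d → ℝ} {a η : ℝ}
    (hw0 : ∀ v ∈ s, 0 ≤ w v) (hw1 : ∑ v ∈ s, w v = 1) (hF : ∀ v ∈ s, |F v - a| ≤ η) :
    |∑ v ∈ s, w v * F v - a| ≤ η := by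
  have h1 : ∑ v ∈ s, w v * F v - a = ∑ v ∈ s, w v * (F v - a) := by
    simp_rw [mul_sub]
    rw [Finset.sum_sub_distrib, ← Finset.sum_mul, hw1, one_mul]
  rw [h1]
  calc _ ≤ ∑ v ∈ s, |w v * (F v - a)| := Finset.abs_sum_le_sum_abs _ _
    _ ≤ ∑ v ∈ s, w v * η := Finset.sum_le_sum fun v hv => by
        rw [abs_mul, abs_of_nonneg (hw0 v hv)]
        exact mul_le_mul_of_nonneg_left (hF v hv) (hw0 v hv)
    _ = η := by rw [← Finset.sum_mul, hw1, one_mul]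

/-- A discrete substitute for the product of a slowly varying weight with a finite element
function. -/
lemma exists_discrete_product (d k : ℕ) {c : ℝ} (hc : 0 < c) :
    ∃ C : ℝ, 0 < C ∧ ∀ {Ω : Set (Space d)} {𝒯 : Geometry.SimplicialComplex ℝ (Space d)} {h : ℝ}
      {ctr : Finset (Space d) → Space d}, QuasiMesh Ω 𝒯 c h ctr →
      ∀ (η : ℝ), η ≤ 1 / 2 → ∀ v ∈ densitySpace 𝒯 k, ∀ ω : Space d → ℝ, (∀ x, 0 < ω x) →
      (∀ x y, dist x y ≤ h → |ω x - ω y| ≤ η * ω y) →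
      ∃ r ∈ densitySpace 𝒯 k, ∀ s ∈ elts 𝒯, ∀ x ∈ convexHull ℝ (s : Set (Space d)),
        |r x - ω (ctr s) ^ k * v x| ≤ C * η * ω (ctr s) ^ k * emean h s v := by
  obtain ⟨C, hC, H⟩ := exists_elem_bound d k hc
  -- `k 2^k` comes from the variation of the factor `(l / ω)^k` over an element, and `4` from the
  -- displacement `4 η h` of the map `Φ` below.
  refine ⟨C * (k * 2 ^ k + 4), by positivity, ?_⟩
  intro Ω 𝒯 h ctr M η hη2 v hv ω hω hωη
  have hh := M.h_pos
  have hη0 : 0 ≤ η := by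
    have := (abs_nonneg _).trans (hωη 0 0 (by simpa using hh.le))
    nlinarith [hω 0]
  -- The map `Φ` reweights barycentric coordinates by `ω` and renormalizes by `l`: it is projective
  -- on each element, maps the element into itself and moves points by `O(η h)`. Since `l` and the
  -- numerators of `Φ` are affine on elements, `l^k · (v ∘ Φ)` is the homogenization of `v` and
  -- stays of degree at most `k`, unlike a product of `v` with an interpolated weight.
  set l : Space d → ℝ := interp 𝒯 ω with hl
  set Φ : Space d → Space d := fun x =>
    WithLp.toLp 2 fun i => interp 𝒯 (fun v => ω v * v i) x / l x with hΦ
  have hbary : ∀ s ∈ elts 𝒯, ∀ x ∈ convexHull ℝ (s : Set (Space d)), |l x - ω x| ≤ η * ω x ∧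
      Φ x ∈ convexHull ℝ (s : Set (Space d)) ∧ ‖Φ x - x‖ ≤ 4 * η * h := by
    intro s hs x hx
    have hsf := (M.tri.mem_elts.1 hs).1
    obtain ⟨w, hw⟩ := exists_isBary hx
    have hvx : ∀ v ∈ s, |ω v - ω x| ≤ η * ω x := fun v hv' =>
      hωη v x (M.dist_le s hs v (subset_convexHull ℝ _ hv') x hx)
    have hlx : l x = ∑ v ∈ s, w v * ω v := interp_eq hsf hw ω
    have h1 : |l x - ω x| ≤ η * ω x := by
      rw [hlx]; exact abs_weighted_sub_le hw.1 hw.2.1 hvx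
    have hωx := hω x
    have hlpos : ω x / 2 ≤ l x := by
      have := (abs_le.1 h1).1
      nlinarith
    have hl0 : 0 < l x := by linarith
    have hΦx : Φ x = ∑ v ∈ s, (w v * ω v / l x) • v := by
      ext i
      simp only [hΦ]
      rw [interp_eq hsf hw]
      simp only [WithLp.ofLp_sum, WithLp.ofLp_smul, Finset.sum_apply, Pi.smul_apply, smul_eq_mul]
      rw [Finset.sum_div]
      exact Finset.sum_congr rfl fun v _ => by ring
    have hw' : IsBary s (fun v => w v * ω v / l x) (Φ x) := by
      refine ⟨fun v hv' => div_nonneg (mul_nonneg (hw.1 v hv') (hω v).le) hl0.le, ?_, hΦx.symm⟩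
      rw [← Finset.sum_div, ← hlx, div_self hl0.ne']
    refine ⟨h1, hw'.mem, ?_⟩
    have h2 : Φ x - x = ∑ v ∈ s, (w v * ω v / l x - w v) • (v - x) := by
      simp_rw [smul_sub, Finset.sum_sub_distrib]
      rw [← Finset.sum_smul, Finset.sum_sub_distrib, hw'.2.1, hw.2.1, sub_self, zero_smul,
        sub_zero]
      simp_rw [sub_smul]
      rw [Finset.sum_sub_distrib, ← hΦx, hw.2.2]
    rw [h2]
    calc _ ≤ ∑ v ∈ s, ‖(w v * ω v / l x - w v) • (v - x)‖ := norm_sum_le _ _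
      _ ≤ ∑ v ∈ s, w v * (4 * η * h) := by
          refine Finset.sum_le_sum fun v hv' => ?_
          rw [norm_smul, ← dist_eq_norm v x]
          have h3 : dist v x ≤ h := M.dist_le s hs v (subset_convexHull ℝ _ hv') x hx
          have h4 : w v * ω v / l x - w v = w v * ((ω v - l x) / l x) := by
            field_simp
          -- Both `ω v` and `l x` are within `η ω x` of `ω x`, and `l x ≥ ω x / 2`.
          have h5 : |(ω v - l x) / l x| ≤ 4 * η := by
            rw [abs_div, abs_of_pos hl0, div_le_iff₀ hl0]
            have := hvx v hv'
            have h6 : |ω v - l x| ≤ η * ω x + η * ω x := by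
              calc |ω v - l x| = |(ω v - ω x) - (l x - ω x)| := by ring_nf
                _ ≤ _ := (abs_sub _ _).trans (add_le_add this h1)
            nlinarith
          rw [h4, Real.norm_eq_abs, abs_mul, abs_of_nonneg (hw.1 v hv'), mul_assoc]
          refine mul_le_mul_of_nonneg_left ?_ (hw.1 v hv')
          exact mul_le_mul h5 h3 dist_nonneg (by positivity)
      _ = _ := by rw [← Finset.sum_mul, hw.2.1, one_mul]
  have hlpos : ∀ s ∈ elts 𝒯, ∀ x ∈ convexHull ℝ (s : Set (Space d)), 0 < l x := by
    intro s hs x hx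
    have := (abs_le.1 (hbary s hs x hx).1).1
    nlinarith [hω x]
  refine ⟨fun x => l x ^ k * v (Φ x), M.tri.mem_densitySpace_iff.2 fun s hs => ?_, ?_⟩
  · have hsm := M.tri.mem_elts.1 hs
    obtain ⟨p, hp, hvp⟩ := M.tri.mem_densitySpace_iff.1 hv s hs
    obtain ⟨q, hq, hlq⟩ := isPolyOn_interp hsm.1 hsm.2 ω
    choose N hN hNe using fun i : Fin d => isPolyOn_interp hsm.1 hsm.2 (fun v => ω v * v i)
    obtain ⟨P, hP, hPe⟩ := exists_homogenization hp hq hN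
    refine ⟨P, hP, fun x hx => ?_⟩
    have hne : MvPolynomial.eval (fun i => x i) q ≠ 0 := by
      rw [← hlq x hx]; exact (hlpos s hs x hx).ne'
    simp only
    rw [hPe _ hne, ← hlq x hx, hvp _ (hbary s hs x hx).2.1]
    congr 3
    funext i
    simp only [hΦ]
    rw [hNe i x hx]
  · intro s hs x hx
    obtain ⟨hl1, hΦ1, hΦ2⟩ := hbary s hs x hx
    obtain ⟨E1, E2, -⟩ := H M s hs v (M.tri.mem_densitySpace_iff.1 hv s hs)
    set W := ω (ctr s) with hW
    have hW0 : 0 < W := hω _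
    have hV := M.emean_nonneg s v
    set V := emean h s v with hVdef
    have hl2 : |l x / W - 1| ≤ η ∧ |l x / W| ≤ 2 := by
      have hsf := (M.tri.mem_elts.1 hs).1
      obtain ⟨w, hw⟩ := exists_isBary hx
      have h1 : |l x - W| ≤ η * W := by
        rw [hl, interp_eq hsf hw]
        exact abs_weighted_sub_le hw.1 hw.2.1 fun v hv' => hωη v _
          (M.dist_le s hs v (subset_convexHull ℝ _ hv') _ (M.ctr_mem hs))
      have h2 : l x / W - 1 = (l x - W) / W := by field_simp
      have h3 : |l x / W - 1| ≤ η := by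
        rw [h2, abs_div, abs_of_pos hW0, div_le_iff₀ hW0]; exact h1
      refine ⟨h3, ?_⟩
      rw [abs_le] at h3 ⊢
      constructor <;> linarith
    have h3 : |(l x / W) ^ k - 1| ≤ η * (k * 2 ^ k) := by
      have h4 := abs_pow_sub_pow_le (l x / W) 1 k
      rw [one_pow, abs_one] at h4
      have h5 : max |l x / W| 1 ^ (k - 1) ≤ 2 ^ k := by
        calc max |l x / W| 1 ^ (k - 1) ≤ (2 : ℝ) ^ (k - 1) :=
              pow_le_pow_left₀ (by positivity) (max_le hl2.2 (by norm_num)) _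
          _ ≤ 2 ^ k := pow_le_pow_right₀ (by norm_num) (by omega)
      calc _ ≤ _ := h4
        _ ≤ η * k * 2 ^ k := by gcongr; exact hl2.1
        _ = _ := by ring
    have h6 : l x ^ k * v (Φ x) - W ^ k * v x =
        W ^ k * (((l x / W) ^ k - 1) * v (Φ x) + (v (Φ x) - v x)) := by
      rw [div_pow]; field_simp; ring
    have h7 : |v (Φ x) - v x| ≤ C * V * (4 * η) := by
      refine (E2 _ hΦ1 x hx).trans ?_
      calc C * V / h * ‖Φ x - x‖ ≤ C * V / h * (4 * η * h) := by gcongr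
        _ = _ := by field_simp
    calc |l x ^ k * v (Φ x) - W ^ k * v x|
        = W ^ k * |((l x / W) ^ k - 1) * v (Φ x) + (v (Φ x) - v x)| := by
          rw [h6, abs_mul, abs_of_pos (pow_pos hW0 k)]
      _ ≤ W ^ k * (η * (k * 2 ^ k) * (C * V) + C * V * (4 * η)) := by
          refine mul_le_mul_of_nonneg_left ((abs_add_le _ _).trans (add_le_add ?_ h7))
            (by positivity)
          rw [abs_mul]
          exact mul_le_mul h3 (E1 _ hΦ1) (abs_nonneg _) (by positivity)
      _ = _ := by ring

/-- Weighted stability of the `L²`-projection onto the finite element space, for slowly varying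
weights. -/
lemma exists_weighted_projection_bound (d k : ℕ) {c : ℝ} (hc : 0 < c) :
    ∃ η : ℝ, 0 < η ∧ ∃ C : ℝ, 0 < C ∧
      ∀ {Ω : Set (Space d)} {𝒯 : Geometry.SimplicialComplex ℝ (Space d)} {h : ℝ}
      {ctr : Finset (Space d) → Space d}, QuasiMesh Ω 𝒯 c h ctr →
      ∀ v ∈ densitySpace 𝒯 k, ∀ u : Space d → ℝ, ContinuousOn u (closure Ω) →
      (∀ r ∈ densitySpace 𝒯 k, ∫ x in Ω, (v x - u x) * r x = 0) →
      ∀ ω : Space d → ℝ, (∀ x, 0 < ω x) →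
      (∀ x y, dist x y ≤ h → |ω x - ω y| ≤ η * ω y) →
      ∑ s ∈ elts 𝒯, ω (ctr s) ^ k * emean h s v ^ 2 ≤
        C * ∑ s ∈ elts 𝒯, ω (ctr s) ^ k * emean h s u ^ 2 := by
  obtain ⟨C₁, hC₁, H₁⟩ := exists_elem_bound d k hc
  obtain ⟨C₂, hC₂, H₂⟩ := exists_discrete_product d k hc
  have hB := ballVol_pos d
  set B := ballVol d with hBdef
  -- The first bound is what the discrete product requires, the second yields `|r| ≤ (C₁ + 1) ω^k
  -- V`, and the third makes the error of the discrete product at most half of the left-hand side.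
  set η := min (1 / 2) (min (1 / C₂) (1 / (C₂ * (2 * B)))) with hη
  have hη0 : 0 < η := by positivity
  have hη1 : η ≤ 1 / 2 := min_le_left _ _
  have hη2 : C₂ * η ≤ 1 := by
    have : η ≤ 1 / C₂ := (min_le_right _ _).trans (min_le_left _ _)
    rw [le_div_iff₀ hC₂] at this; linarith
  have hη3 : C₂ * η * (2 * B) ≤ 1 := by
    have : η ≤ 1 / (C₂ * (2 * B)) := (min_le_right _ _).trans (min_le_right _ _)
    rw [le_div_iff₀ (by positivity)] at this; linarith
  refine ⟨η, hη0, 4 * B ^ 2 * (C₁ + 1) ^ 2, by positivity, ?_⟩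
  intro Ω 𝒯 h ctr M v hv u hu horth ω hω hωη
  obtain ⟨r, hr, hrv⟩ := H₂ M η hη1 v hv ω hω hωη
  have hh := M.h_pos
  have hcomp : IsCompact (closure Ω) := M.lip.isBounded.isCompact_closure
  have hvc := M.tri.continuousOn M.lip.isOpen hv
  have hrc := M.tri.continuousOn M.lip.isOpen hr
  have hintg : ∀ f : Space d → ℝ, ContinuousOn f (closure Ω) → IntegrableOn f Ω := fun f hf =>
    (hf.integrableOn_compact hcomp).mono_set subset_closure
  have hints : ∀ f : Space d → ℝ, ContinuousOn f (closure Ω) → ∀ s ∈ elts 𝒯,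
      IntegrableOn f (convexHull ℝ (s : Set (Space d))) := fun f hf s hs =>
    (hf.integrableOn_compact hcomp).mono_set (M.tri.simplex_subset_closure hs)
  have hvv : ContinuousOn (fun x => v x * v x) (closure Ω) := hvc.mul hvc
  have hvrc : ContinuousOn (fun x => v x * r x) (closure Ω) := hvc.mul hrc
  have hurc : ContinuousOn (fun x => u x * r x) (closure Ω) := hu.mul hrc
  have hva : ContinuousOn (fun x => |v x|) (closure Ω) := hvc.abs
  have hua : ContinuousOn (fun x => |u x|) (closure Ω) := hu.abs
  have hmeas : ∀ s : Finset (Space d), MeasurableSet (convexHull ℝ (s : Set (Space d))) :=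
    fun s => (isCompact_simplex s).isClosed.measurableSet
  have hvr : ∑ s ∈ elts 𝒯, ∫ x in convexHull ℝ (s : Set (Space d)), v x * r x =
      ∑ s ∈ elts 𝒯, ∫ x in convexHull ℝ (s : Set (Space d)), u x * r x := by
    rw [← M.tri.setIntegral_eq_sum M.lip (hintg _ hvrc),
      ← M.tri.setIntegral_eq_sum M.lip (hintg _ hurc), ← sub_eq_zero,
      ← integral_sub (hintg _ hvrc) (hintg _ hurc), ← horth r hr]
    congr 1 with x
    ring
  -- Orthogonality is global, so the elementwise estimate retains the difference of the pairings of
  -- `v` and `u` with `r`; it has no sign on one element, but its sum over the mesh vanishes.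
  have helem : ∀ s ∈ elts 𝒯, h ^ d * (ω (ctr s) ^ k * emean h s v ^ 2) ≤
      4 * B ^ 2 * (C₁ + 1) ^ 2 * h ^ d * (ω (ctr s) ^ k * emean h s u ^ 2) +
      4 * B * ((∫ x in convexHull ℝ (s : Set (Space d)), v x * r x) -
        ∫ x in convexHull ℝ (s : Set (Space d)), u x * r x) := by
    intro s hs
    set K := convexHull ℝ (s : Set (Space d)) with hK
    set W := ω (ctr s) ^ k with hW
    have hW0 : 0 < W := pow_pos (hω _) _
    have hV0 := M.emean_nonneg s v
    have hU0 := M.emean_nonneg s u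
    have hIv := M.integral_abs_eq s v
    have hIu := M.integral_abs_eq s u
    set V := emean h s v with hV
    set U := emean h s u with hU
    obtain ⟨E1, -, -⟩ := H₁ M s hs v (M.tri.mem_densitySpace_iff.1 hv s hs)
    have hKsub := M.tri.simplex_subset_closure hs
    have hfin : IsFiniteMeasure (volume.restrict K) :=
      ⟨by rw [Measure.restrict_apply_univ]; exact (isCompact_simplex s).measure_lt_top⟩
    have hv2 : h ^ d * V ^ 2 ≤ B * ∫ x in K, v x * v x := by
      have h1 := rpow_integral_le (μ := volume.restrict K) (p := 2) (by norm_num)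
        (f := fun x => |v x|) (fun x => abs_nonneg _) (hints _ hva s hs) (by
          simp only [Real.rpow_two, sq, abs_mul_abs_self]
          exact hints _ hvv s hs)
      simp only [Real.rpow_two, sq_abs] at h1
      rw [hIv, measureReal_restrict_apply_univ] at h1
      norm_num at h1
      have h2 := M.volume_real_le hs
      have h3 : 0 ≤ ∫ x in K, v x ^ 2 := integral_nonneg fun x => sq_nonneg _
      have h4 : (h ^ d * V) ^ 2 ≤ h ^ d * B * ∫ x in K, v x ^ 2 :=
        h1.trans (mul_le_mul_of_nonneg_right h2 h3)
      have h5 : 0 < h ^ d := by positivity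
      have h6 : h ^ d * (h ^ d * V ^ 2) ≤ h ^ d * (B * ∫ x in K, v x ^ 2) := by
        linarith [h4, sq_nonneg V, mul_pow (h ^ d) V 2]
      simpa [sq] using le_of_mul_le_mul_left h6 h5
    have hvr' : W * (∫ x in K, v x * v x) ≤
        (∫ x in K, v x * r x) + C₂ * η * W * V * (h ^ d * V) := by
      rw [← hIv, ← integral_const_mul, ← integral_const_mul, ← integral_add
        (hints _ hvrc s hs) ((hints _ hva s hs).const_mul _)]
      refine setIntegral_mono_on ((hints _ hvv s hs).const_mul _)
        ((hints _ hvrc s hs).add ((hints _ hva s hs).const_mul _)) (hmeas s) ?_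
      intro x hx
      have h1 := hrv s hs x hx
      have h2 : W * (v x * v x) - v x * r x = -(v x * (r x - W * v x)) := by ring
      have h3 : -(v x * (r x - W * v x)) ≤ |v x| * |r x - W * v x| := by
        rw [← abs_mul]; exact neg_le_abs _
      have h4 := mul_le_mul_of_nonneg_left h1 (abs_nonneg (v x))
      linarith
    have hur' : (∫ x in K, u x * r x) ≤ (C₁ + 1) * W * V * (h ^ d * U) := by
      rw [← hIu, ← integral_const_mul]
      refine setIntegral_mono_on (hints _ hurc s hs)
        ((hints _ hua s hs).const_mul _) (hmeas s) ?_
      intro x hx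
      have h1 := hrv s hs x hx
      have h2 := E1 x hx
      have h3 : |r x| ≤ (C₁ + 1) * W * V := by
        have h4 : |r x| ≤ |r x - W * v x| + W * |v x| := by
          have := abs_add_le (r x - W * v x) (W * v x)
          rw [sub_add_cancel, abs_mul, abs_of_pos hW0] at this
          exact this
        have h5 := mul_le_mul_of_nonneg_left h2 hW0.le
        have h6 : C₂ * η * W * V ≤ W * V := by
          rw [mul_assoc]; exact mul_le_of_le_one_left (mul_nonneg hW0.le hV0) hη2
        linarith
      calc u x * r x ≤ |u x| * |r x| := by rw [← abs_mul]; exact le_abs_self _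
        _ ≤ |u x| * ((C₁ + 1) * W * V) := mul_le_mul_of_nonneg_left h3 (abs_nonneg _)
        _ = _ := by ring
    have hhd : 0 < h ^ d := by positivity
    set X := ∫ x in K, v x * v x
    set Y := ∫ x in K, v x * r x
    set Z := ∫ x in K, u x * r x
    have e1 : W * (h ^ d * V ^ 2) ≤ B * (W * X) := by
      calc _ ≤ W * (B * X) := mul_le_mul_of_nonneg_left hv2 hW0.le
        _ = _ := by ring
    have e2 : B * (W * X) ≤ B * Y + B * (C₂ * η * W * V * (h ^ d * V)) := by
      rw [← mul_add]; exact mul_le_mul_of_nonneg_left hvr' hB.le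
    have e3 : B * (C₂ * η * W * V * (h ^ d * V)) ≤ W * (h ^ d * V ^ 2) / 2 := by
      have : 0 ≤ W * (h ^ d * V ^ 2) := by positivity
      have := mul_le_mul_of_nonneg_right hη3 this
      linarith
    -- Young's inequality, weighted so that exactly one copy of `W h^d V²` is left to be absorbed:
    -- the preceding bounds control two copies by `4 B Y`.
    have e4 : 4 * B * ((C₁ + 1) * W * V * (h ^ d * U)) ≤
        W * h ^ d * (V ^ 2 + 4 * B ^ 2 * (C₁ + 1) ^ 2 * U ^ 2) := by
      have : 0 ≤ W * h ^ d * (V - 2 * B * (C₁ + 1) * U) ^ 2 := by positivity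
      linarith
    have e5 : 4 * B * Z ≤ 4 * B * ((C₁ + 1) * W * V * (h ^ d * U)) :=
      mul_le_mul_of_nonneg_left hur' (by positivity)
    linarith
  have hsum := Finset.sum_le_sum helem
  rw [Finset.sum_add_distrib, ← Finset.mul_sum, ← Finset.mul_sum, ← Finset.mul_sum,
    Finset.sum_sub_distrib, hvr, sub_self, mul_zero, add_zero] at hsum
  have hhd : 0 < h ^ d := by positivity
  refine le_of_mul_le_mul_left ?_ hhd
  linarith

end Projection

/-! ### `L^p`-stability of the projection and the inverse inequality -/

lemma rpow_sum_le_sum_rpow {ι : Type*} (s : Finset ι) {f : ι → ℝ} (hf : ∀ i ∈ s, 0 ≤ f i) {p : ℝ}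
    (hp0 : 0 < p) (hp1 : p ≤ 1) : (∑ i ∈ s, f i) ^ p ≤ ∑ i ∈ s, f i ^ p := by
  refine Finset.le_sum_of_subadditive_on_pred (fun x : ℝ => x ^ p) (fun x => 0 ≤ x)
    (by simp [Real.zero_rpow hp0.ne']) (fun x y hx hy => ?_) (fun x y => add_nonneg) f hf
  lift x to ℝ≥0 using hx
  lift y to ℝ≥0 using hy
  exact_mod_cast NNReal.rpow_add_le_add_rpow x y hp0.le hp1

section

variable {d : ℕ}

lemma measurable_gradient (u : Space d → ℝ) : Measurable (gradient u) :=
  (InnerProductSpace.toDual ℝ (Space d)).symm.continuous.measurable.comp (measurable_fderiv ℝ u)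

lemma IsPolyOn.exists_gradient_bound {k : ℕ} {S : Set (Space d)} (hS : IsCompact S)
    {u : Space d → ℝ} (hu : IsPolyOn k S u) :
    ∃ B : ℝ, 0 ≤ B ∧ ∀ x ∈ interior S, ‖gradient u x‖ ≤ B := by
  obtain ⟨p, -, hp⟩ := hu
  obtain ⟨B, hB⟩ := hS.exists_bound_of_continuousOn
    ((contDiff_polyFun p (n := 1)).continuous_fderiv one_ne_zero).continuousOn
  refine ⟨max B 0, le_max_right _ _, fun x hx => ?_⟩
  rw [norm_gradient_eq]
  have h1 : fderiv ℝ u x = fderiv ℝ (polyFun p) x := by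
    refine Filter.EventuallyEq.fderiv_eq ?_
    filter_upwards [isOpen_interior.mem_nhds hx] with y hy
    exact hp y (interior_subset hy)
  rw [h1]
  exact (hB x (interior_subset hx)).trans (le_max_left _ _)

variable {Ω : Set (Space d)} {𝒯 : Geometry.SimplicialComplex ℝ (Space d)} {k : ℕ}

lemma IsTriangulation.exists_gradient_bound (hT : IsTriangulation Ω 𝒯)
    (hΩ : IsBoundedLipschitz Ω) {v : Space d → ℝ} (hv : v ∈ densitySpace 𝒯 k) :
    ∃ B : ℝ, 0 ≤ B ∧ ∀ᵐ x ∂volume.restrict Ω, ‖gradient v x‖ ≤ B := by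
  choose! B hB0 hB using fun s (hs : s ∈ elts 𝒯) =>
    (hT.mem_densitySpace_iff.1 hv s hs).exists_gradient_bound (isCompact_simplex s)
  refine ⟨∑ s ∈ elts 𝒯, B s, Finset.sum_nonneg hB0, ?_⟩
  rw [ae_restrict_iff' hΩ.isOpen.measurableSet]
  filter_upwards [hT.ae_mem_interior hΩ] with x hx hxΩ
  obtain ⟨s, hs, hxs⟩ := hx hxΩ
  exact (hB s hs x hxs).trans (Finset.single_le_sum hB0 hs)

lemma IsBoundedLipschitz.isFiniteMeasure (hΩ : IsBoundedLipschitz Ω) :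
    IsFiniteMeasure (volume.restrict Ω) :=
  ⟨by rw [Measure.restrict_apply_univ]; exact hΩ.isBounded.measure_lt_top⟩

lemma IsTriangulation.memLp_gradient (hT : IsTriangulation Ω 𝒯)
    (hΩ : IsBoundedLipschitz Ω) {v : Space d → ℝ} (hv : v ∈ densitySpace 𝒯 k) (p : ℝ≥0∞) :
    MemLp (gradient v) p (volume.restrict Ω) := by
  obtain ⟨B, -, hB⟩ := hT.exists_gradient_bound hΩ hv
  have := hΩ.isFiniteMeasure
  exact MemLp.of_bound (measurable_gradient v).aestronglyMeasurable B hB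

lemma IsTriangulation.integrableOn_gradient_rpow (hT : IsTriangulation Ω 𝒯)
    (hΩ : IsBoundedLipschitz Ω) {v : Space d → ℝ} (hv : v ∈ densitySpace 𝒯 k) {p : ℝ}
    (hp : 0 ≤ p) : IntegrableOn (fun x => ‖gradient v x‖ ^ p) Ω := by
  obtain ⟨B, -, hB⟩ := hT.exists_gradient_bound hΩ hv
  have := hΩ.isFiniteMeasure
  refine Integrable.of_bound
    ((measurable_gradient v).norm.pow_const p).aestronglyMeasurable (B ^ p) ?_
  filter_upwards [hB] with x hx
  rw [Real.norm_of_nonneg (by positivity)]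
  exact Real.rpow_le_rpow (norm_nonneg _) hx hp

namespace QuasiMesh

variable {c h : ℝ} {ctr : Finset (Space d) → Space d}

/-- Jensen's inequality on the element. Its volume is at most `h^d` times that of the unit ball, so
the powers of `h` cancel except for one factor `h^d`. -/
lemma emean_rpow_le (M : QuasiMesh Ω 𝒯 c h ctr) {s : Finset (Space d)} (hs : s ∈ elts 𝒯)
    {u : Space d → ℝ} (hu : ContinuousOn u (convexHull ℝ (s : Set (Space d)))) {p : ℝ}
    (hp : 1 ≤ p) : h ^ d * emean h s u ^ p ≤
      ballVol d ^ (p - 1) * ∫ x in convexHull ℝ (s : Set (Space d)), |u x| ^ p := by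
  have hfin : IsFiniteMeasure (volume.restrict (convexHull ℝ (s : Set (Space d)))) :=
    ⟨by rw [Measure.restrict_apply_univ]; exact (isCompact_simplex s).measure_lt_top⟩
  have hua : ContinuousOn (fun x => |u x|) (convexHull ℝ (s : Set (Space d))) := hu.abs
  have hup : ContinuousOn (fun x => |u x| ^ p) (convexHull ℝ (s : Set (Space d))) :=
    hua.rpow_const fun x _ => Or.inr (by linarith)
  have h1 := rpow_integral_le (μ := volume.restrict (convexHull ℝ (s : Set (Space d)))) hp
    (fun x => abs_nonneg (u x)) (hua.integrableOn_compact (isCompact_simplex s))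
    (hup.integrableOn_compact (isCompact_simplex s))
  rw [measureReal_restrict_apply_univ, M.integral_abs_eq] at h1
  have hH : 0 < h ^ d := pow_pos M.h_pos _
  have hJ : 0 ≤ ∫ x in convexHull ℝ (s : Set (Space d)), |u x| ^ p :=
    integral_nonneg fun x => by positivity
  have h2 := h1.trans (mul_le_mul_of_nonneg_right (Real.rpow_le_rpow measureReal_nonneg
    (M.volume_real_le hs) (by linarith : 0 ≤ p - 1)) hJ)
  rw [Real.mul_rpow hH.le (M.emean_nonneg s u), Real.mul_rpow hH.le (ballVol_pos d).le] at h2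
  have h3 : (h ^ d) ^ p = (h ^ d) ^ (p - 1) * h ^ d := by
    rw [Real.rpow_sub_one hH.ne', div_mul_cancel₀ _ hH.ne']
  rw [h3, mul_assoc, mul_assoc] at h2
  exact le_of_mul_le_mul_left h2 (Real.rpow_pos_of_pos hH _)

end QuasiMesh

/-- `L^p`-stability of the `L²`-projection, for `1 ≤ p ≤ 2`. -/
lemma exists_projection_rpow_bound (d : ℕ) {k : ℕ} (hk : 1 ≤ k) {c : ℝ} (hc : 0 < c) {p : ℝ}
    (hp1 : 1 ≤ p) (hp2 : p ≤ 2) :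
    ∃ C : ℝ, 0 < C ∧
      ∀ {Ω : Set (Space d)} {𝒯 : Geometry.SimplicialComplex ℝ (Space d)} {h : ℝ}
      {ctr : Finset (Space d) → Space d}, QuasiMesh Ω 𝒯 c h ctr →
      ∀ v ∈ densitySpace 𝒯 k, ∀ u : Space d → ℝ, ContinuousOn u (closure Ω) →
      (∀ r ∈ densitySpace 𝒯 k, ∫ x in Ω, (v x - u x) * r x = 0) →
      ∑ s ∈ elts 𝒯, h ^ d * emean h s v ^ p ≤ C * ∫ x in Ω, |u x| ^ p := by
  obtain ⟨η, hη, C₁, hC₁, H₁⟩ := exists_weighted_projection_bound d k hc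
  obtain ⟨C₂, hC₂, H₂⟩ := exists_sum_decay_le d hc
  -- The weight `ω = (1 + δ t)^(-m)` enters a quadratic estimate that is later raised to the power
  -- `p / 2`; the doubled exponent then still leaves decay of order at least `d + 1`, which is
  -- summable over the mesh. `δ` is so small that `ω` varies by the admissible relative amount `η`
  -- over distance `h`.
  set m : ℕ := 2 * (d + 1) with hm
  have hm0 : 0 < m := by omega
  set δ : ℝ := min 1 (η / (m * 2 ^ m)) with hδ
  have hm0' : (0 : ℝ) < m := by exact_mod_cast hm0
  have hδ0 : 0 < δ := by positivity
  have hδ1 : δ ≤ 1 := min_le_left _ _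
  have hδη : δ * m * 2 ^ m ≤ η := by
    have : δ ≤ η / (m * 2 ^ m) := min_le_right _ _
    rw [le_div_iff₀ (by positivity)] at this
    linarith
  have hB := ballVol_pos d
  refine ⟨C₁ ^ (p / 2) * (δ ^ (d + 1))⁻¹ * C₂ * ballVol d ^ (p - 1), by positivity, ?_⟩
  intro Ω 𝒯 h ctr M v hv u hu horth
  have hh := M.h_pos
  have hU0 : ∀ s, 0 ≤ emean h s u := fun s => M.emean_nonneg s u
  have hV0 : ∀ s, 0 ≤ emean h s v := fun s => M.emean_nonneg s v
  -- Off-diagonal decay of the projection: the weight centred at `s₀` equals `1` there, so the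
  -- weighted bound controls the single mean on `s₀`. The power `p / 2 ≤ 1` is subadditive and
  -- splits the sum on the right.
  have hone : ∀ s₀ ∈ elts 𝒯, emean h s₀ v ^ p ≤ C₁ ^ (p / 2) * (δ ^ (d + 1))⁻¹ *
      ∑ s ∈ elts 𝒯, ((1 + dist (ctr s) (ctr s₀) / h) ^ (d + 1))⁻¹ * emean h s u ^ p := by
    intro s₀ hs₀
    set T : Space d → ℝ := fun x => 1 + δ * (dist x (ctr s₀) / h) with hT
    have hT1 : ∀ x, 1 ≤ T x := fun x => by
      have : 0 ≤ δ * (dist x (ctr s₀) / h) := by positivity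
      simp only [hT]; linarith
    have hT0 : ∀ x, 0 < T x := fun x => by linarith [hT1 x]
    have hTd : ∀ x y, dist x y ≤ h → T x ≤ T y + δ := by
      intro x y hxy
      have h1 : dist x (ctr s₀) ≤ h + dist y (ctr s₀) :=
        (dist_triangle x y _).trans (add_le_add hxy le_rfl)
      have h2 : dist x (ctr s₀) / h ≤ 1 + dist y (ctr s₀) / h := by
        rw [div_le_iff₀ hh, add_mul, div_mul_cancel₀ _ hh.ne', one_mul]; exact h1
      have := mul_le_mul_of_nonneg_left h2 hδ0.le
      simp only [hT]; linarith
    set ω : Space d → ℝ := fun x => (T x ^ m)⁻¹ with hω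
    have hω0 : ∀ x, 0 < ω x := fun x => inv_pos.2 (pow_pos (hT0 x) _)
    have hωη : ∀ x y, dist x y ≤ h → |ω x - ω y| ≤ η * ω y := by
      intro x y hxy
      have hx := hT0 x
      have hy := hT0 y
      have e1 : ω x - ω y = ω y * ((T y / T x) ^ m - 1) := by
        simp only [hω, div_pow]
        field_simp
      have hq1 : |T y / T x - 1| ≤ δ := by
        have : T y / T x - 1 = (T y - T x) / T x := by field_simp
        rw [this, abs_div, abs_of_pos hx, div_le_iff₀ hx]
        have a1 := hTd x y hxy
        have a2 := hTd y x (by rwa [dist_comm])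
        have a3 : δ ≤ δ * T x := le_mul_of_one_le_right hδ0.le (hT1 x)
        rw [abs_le]; constructor <;> linarith
      have hq2 : |T y / T x| ≤ 2 := by
        rw [abs_le] at hq1 ⊢
        constructor <;> linarith
      have e2 : |(T y / T x) ^ m - 1| ≤ η := by
        have h4 := abs_pow_sub_pow_le (T y / T x) 1 m
        rw [one_pow, abs_one] at h4
        have h5 : max |T y / T x| 1 ^ (m - 1) ≤ 2 ^ m := by
          calc max |T y / T x| 1 ^ (m - 1) ≤ (2 : ℝ) ^ (m - 1) :=
                pow_le_pow_left₀ (by positivity) (max_le hq2 (by norm_num)) _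
            _ ≤ 2 ^ m := pow_le_pow_right₀ (by norm_num) (by omega)
        calc _ ≤ _ := h4
          _ ≤ δ * m * 2 ^ m := by gcongr
          _ ≤ _ := hδη
      rw [e1, abs_mul, abs_of_pos (hω0 y), mul_comm]
      exact mul_le_mul_of_nonneg_right e2 (hω0 y).le
    have hmain := H₁ M v hv u hu horth ω hω0 hωη
    have hω1 : ω (ctr s₀) = 1 := by simp [hω, hT]
    have h1 : emean h s₀ v ^ 2 ≤ C₁ * ∑ s ∈ elts 𝒯, ω (ctr s) ^ k * emean h s u ^ 2 := by
      refine le_trans ?_ hmain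
      have := Finset.single_le_sum (f := fun s => ω (ctr s) ^ k * emean h s v ^ 2)
        (fun s _ => mul_nonneg (pow_nonneg (hω0 _).le _) (sq_nonneg _)) hs₀
      simpa [hω1] using this
    have hp2' : 0 < p / 2 := by linarith
    have hsq : ∀ a : ℝ, 0 ≤ a → (a ^ 2) ^ (p / 2) = a ^ p := by
      intro a ha
      rw [← Real.rpow_natCast, ← Real.rpow_mul ha]
      congr 1; push_cast; ring
    have hterm : ∀ s ∈ elts 𝒯, (ω (ctr s) ^ k * emean h s u ^ 2) ^ (p / 2) ≤
        (δ ^ (d + 1))⁻¹ * (((1 + dist (ctr s) (ctr s₀) / h) ^ (d + 1))⁻¹ * emean h s u ^ p) := by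
      intro s hs
      rw [Real.mul_rpow (pow_nonneg (hω0 _).le _) (sq_nonneg _), hsq _ (hU0 s), ← mul_assoc]
      refine mul_le_mul_of_nonneg_right ?_ (Real.rpow_nonneg (hU0 s) _)
      set t := dist (ctr s) (ctr s₀) / h with ht
      have ht0 : 0 ≤ t := by positivity
      set q := (T (ctr s) ^ (d + 1))⁻¹ with hq
      have hq0 : 0 < q := inv_pos.2 (pow_pos (hT0 _) _)
      have hq1 : q ≤ 1 := inv_le_one_of_one_le₀ (one_le_pow₀ (hT1 _))
      have hωq : ω (ctr s) = q ^ 2 := by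
        simp only [hω, hq, inv_pow, ← pow_mul, hm]
        congr 2; ring
      -- Here `1 ≤ k` is essential: as `ω ≤ 1`, its `k`-th power decays at least as fast as `ω`
      -- itself, whereas `k = 0` would give no decay.
      have h2 : ω (ctr s) ^ k ≤ q ^ 2 := by
        rw [← hωq]
        refine pow_le_of_le_one (hω0 _).le ?_ (by omega)
        rw [hωq]; exact pow_le_one₀ hq0.le hq1
      calc (ω (ctr s) ^ k) ^ (p / 2) ≤ (q ^ 2) ^ (p / 2) :=
            Real.rpow_le_rpow (pow_nonneg (hω0 _).le _) h2 hp2'.le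
        _ = q ^ p := hsq q hq0.le
        _ ≤ q ^ (1 : ℝ) := Real.rpow_le_rpow_of_exponent_ge hq0 hq1 hp1
        _ = q := Real.rpow_one q
        _ ≤ (δ ^ (d + 1))⁻¹ * ((1 + t) ^ (d + 1))⁻¹ := by
            rw [← mul_inv, ← mul_pow]
            refine inv_anti₀ (by positivity) (pow_le_pow_left₀ (by positivity) ?_ _)
            simp only [hT]
            linarith
    calc emean h s₀ v ^ p = (emean h s₀ v ^ 2) ^ (p / 2) := (hsq _ (hV0 s₀)).symm
      _ ≤ (C₁ * ∑ s ∈ elts 𝒯, ω (ctr s) ^ k * emean h s u ^ 2) ^ (p / 2) :=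
          Real.rpow_le_rpow (sq_nonneg _) h1 hp2'.le
      _ = C₁ ^ (p / 2) * (∑ s ∈ elts 𝒯, ω (ctr s) ^ k * emean h s u ^ 2) ^ (p / 2) :=
          Real.mul_rpow hC₁.le (Finset.sum_nonneg fun s _ =>
            mul_nonneg (pow_nonneg (hω0 _).le _) (sq_nonneg _))
      _ ≤ C₁ ^ (p / 2) * ∑ s ∈ elts 𝒯, (ω (ctr s) ^ k * emean h s u ^ 2) ^ (p / 2) := by
          gcongr
          exact rpow_sum_le_sum_rpow _ (fun s _ =>
            mul_nonneg (pow_nonneg (hω0 _).le _) (sq_nonneg _)) hp2' (by linarith)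
      _ ≤ C₁ ^ (p / 2) * ∑ s ∈ elts 𝒯, (δ ^ (d + 1))⁻¹ *
          (((1 + dist (ctr s) (ctr s₀) / h) ^ (d + 1))⁻¹ * emean h s u ^ p) := by
          gcongr with s hs
          exact hterm s hs
      _ = _ := by rw [← Finset.mul_sum, mul_assoc]
  have hcomp : IsCompact (closure Ω) := M.lip.isBounded.isCompact_closure
  have hup : ContinuousOn (fun x => |u x| ^ p) (closure Ω) :=
    ContinuousOn.rpow_const hu.abs fun x _ => Or.inr (by linarith)
  rw [M.tri.setIntegral_eq_sum M.lip ((hup.integrableOn_compact hcomp).mono_set subset_closure)]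
  calc ∑ s₀ ∈ elts 𝒯, h ^ d * emean h s₀ v ^ p
      ≤ ∑ s₀ ∈ elts 𝒯, h ^ d * (C₁ ^ (p / 2) * (δ ^ (d + 1))⁻¹ *
      ∑ s ∈ elts 𝒯, ((1 + dist (ctr s) (ctr s₀) / h) ^ (d + 1))⁻¹ * emean h s u ^ p) := by
        gcongr with s₀ hs₀
        exact hone s₀ hs₀
    -- Schur's argument: the decay kernel is symmetric, so after exchanging the sums its inner sum
    -- is bounded uniformly in `s`.
    _ = C₁ ^ (p / 2) * (δ ^ (d + 1))⁻¹ * ∑ s ∈ elts 𝒯, (h ^ d * emean h s u ^ p) *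
          ∑ s₀ ∈ elts 𝒯, ((1 + dist (ctr s₀) (ctr s) / h) ^ (d + 1))⁻¹ := by
        simp_rw [Finset.mul_sum]
        rw [Finset.sum_comm]
        refine Finset.sum_congr rfl fun s _ => Finset.sum_congr rfl fun s₀ _ => ?_
        rw [dist_comm (ctr s)]
        ring
    _ ≤ C₁ ^ (p / 2) * (δ ^ (d + 1))⁻¹ * ∑ s ∈ elts 𝒯, (ballVol d ^ (p - 1) *
          ∫ x in convexHull ℝ (s : Set (Space d)), |u x| ^ p) * C₂ := by
        refine mul_le_mul_of_nonneg_left (Finset.sum_le_sum fun s hs => mul_le_mul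
          (M.emean_rpow_le hs (hu.mono (M.tri.simplex_subset_closure hs)) hp1) (H₂ M _)
          (Finset.sum_nonneg fun _ _ => by positivity) ?_) (by positivity)
        exact mul_nonneg (by positivity) (integral_nonneg fun _ => by positivity)
    _ = _ := by
        simp_rw [Finset.mul_sum]
        exact Finset.sum_congr rfl fun s _ => by ring

/-- Inverse inequality: the gradient of a finite element function. -/
lemma exists_gradient_rpow_bound (d k : ℕ) {c : ℝ} (hc : 0 < c) {p : ℝ} (hp : 1 ≤ p) :
    ∃ C : ℝ, 0 < C ∧
      ∀ {Ω : Set (Space d)} {𝒯 : Geometry.SimplicialComplex ℝ (Space d)} {h : ℝ}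
      {ctr : Finset (Space d) → Space d}, QuasiMesh Ω 𝒯 c h ctr →
      ∀ v ∈ densitySpace 𝒯 k,
      ∀ s ∈ elts 𝒯, ∫ x in convexHull ℝ (s : Set (Space d)), ‖gradient v x‖ ^ p ≤
        C * (h ^ p)⁻¹ * (h ^ d * emean h s v ^ p) := by
  obtain ⟨C, hC, H⟩ := exists_elem_bound d k hc
  have hB := ballVol_pos d
  refine ⟨C ^ p * ballVol d, by positivity, ?_⟩
  intro Ω 𝒯 h ctr M v hv s hs
  obtain ⟨-, -, E⟩ := H M s hs v (M.tri.mem_densitySpace_iff.1 hv s hs)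
  have hh := M.h_pos
  have hV := M.emean_nonneg s v
  rw [setIntegral_congr_set (simplex_ae_eq_interior s)]
  have hfin : volume (interior (convexHull ℝ (s : Set (Space d)))) < ⊤ :=
    (measure_mono interior_subset).trans_lt (isCompact_simplex s).measure_lt_top
  have h1 := norm_setIntegral_le_of_norm_le_const (μ := volume) (C := (C * emean h s v / h) ^ p)
    hfin (f := fun x => ‖gradient v x‖ ^ p) (fun x hx => by
      rw [Real.norm_of_nonneg (by positivity)]
      exact Real.rpow_le_rpow (norm_nonneg _) (E x hx) (by linarith))
  refine (le_abs_self _).trans (h1.trans ?_)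
  have h2 : volume.real (interior (convexHull ℝ (s : Set (Space d)))) ≤ h ^ d * ballVol d := by
    rw [← measureReal_congr (simplex_ae_eq_interior s)]
    exact M.volume_real_le hs
  rw [Real.div_rpow (by positivity) hh.le, Real.mul_rpow hC.le hV]
  calc _ ≤ C ^ p * emean h s v ^ p / h ^ p * (h ^ d * ballVol d) := by gcongr
    _ = _ := by ring

end

/-! ### A local Poincaré inequality in Lipschitz domains -/

section Poincare

variable {d : ℕ}

/-- Uniform interior cone property. -/
lemma IsBoundedLipschitz.uniform_cone {Ω : Set (Space d)} (hΩ : IsBoundedLipschitz Ω) :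
    ∃ ε : ℝ, 0 < ε ∧ ε ≤ 1 ∧ ∃ r : ℝ, 0 < r ∧ ∀ v ∈ closure Ω, ∃ e : Space d, ‖e‖ ≤ 1 ∧
      ∀ z ∈ Ω ∩ Metric.ball v r, ∀ t, 0 < t → t ≤ r → ∀ y : Space d, ‖y‖ ≤ ε * t →
        z + t • e + y ∈ Ω := by
  refine IsCompact.induction_on (p := fun S => ∃ ε : ℝ, 0 < ε ∧ ε ≤ 1 ∧ ∃ r : ℝ, 0 < r ∧
      ∀ v ∈ S, ∃ e : Space d, ‖e‖ ≤ 1 ∧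
      ∀ z ∈ Ω ∩ Metric.ball v r, ∀ t, 0 < t → t ≤ r → ∀ y : Space d, ‖y‖ ≤ ε * t →
        z + t • e + y ∈ Ω) hΩ.isBounded.isCompact_closure ?_ ?_ ?_ ?_
  · exact ⟨1, one_pos, le_rfl, 1, one_pos, fun v hv => hv.elim⟩
  · rintro S S' hS ⟨ε, hε, hε1, r, hr, H⟩
    exact ⟨ε, hε, hε1, r, hr, fun v hv => H v (hS hv)⟩
  · rintro S S' ⟨ε, hε, hε1, r, hr, H⟩ ⟨ε', hε', hε1', r', hr', H'⟩
    refine ⟨min ε ε', lt_min hε hε', (min_le_left _ _).trans hε1, min r r', lt_min hr hr', ?_⟩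
    rintro v (hv | hv)
    · obtain ⟨e, he, K⟩ := H v hv
      exact ⟨e, he, fun z hz t ht htr y hy => K z
        ⟨hz.1, Metric.ball_subset_ball (min_le_left _ _) hz.2⟩ t ht (htr.trans (min_le_left _ _)) y
        (hy.trans (mul_le_mul_of_nonneg_right (min_le_left _ _) ht.le))⟩
    · obtain ⟨e, he, K⟩ := H' v hv
      exact ⟨e, he, fun z hz t ht htr y hy => K z
        ⟨hz.1, Metric.ball_subset_ball (min_le_right _ _) hz.2⟩ t ht (htr.trans (min_le_right _ _))
        y (hy.trans (mul_le_mul_of_nonneg_right (min_le_right _ _) ht.le))⟩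
  · intro x hx
    -- A cone condition on a ball around `x` holds, with half the radius, around every centre in the
    -- half ball; this is the local uniformity that compactness needs.
    suffices h : ∃ r : ℝ, 0 < r ∧ ∃ ε : ℝ, 0 < ε ∧ ε ≤ 1 ∧ ∃ e : Space d, ‖e‖ ≤ 1 ∧
        ∀ z ∈ Ω ∩ Metric.ball x r, ∀ t, 0 < t → t ≤ r → ∀ y : Space d, ‖y‖ ≤ ε * t →
        z + t • e + y ∈ Ω by
      obtain ⟨r, hr, ε, hε, hε1, e, he, H⟩ := h
      refine ⟨Metric.ball x (r / 2), mem_nhdsWithin_of_mem_nhds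
        (Metric.ball_mem_nhds x (by positivity)), ε, hε, hε1, r / 2, by positivity,
        fun v hv => ⟨e, he, fun z hz t ht htr => H z ⟨hz.1, ?_⟩ t ht (by linarith)⟩⟩
      have h1 := hz.2
      rw [Metric.mem_ball] at hv h1 ⊢
      linarith [dist_triangle z v x]
    by_cases hxΩ : x ∈ Ω
    · obtain ⟨r, hr, hb⟩ := Metric.isOpen_iff.1 hΩ.isOpen x hxΩ
      -- In the interior no direction is needed: the cone is a ball, with axis `e = 0`.
      refine ⟨r / 2, by positivity, 1, one_pos, le_rfl, 0, by simp, ?_⟩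
      intro z hz t ht htr y hy
      refine hb ?_
      have h1 := hz.2
      rw [Metric.mem_ball, dist_eq_norm] at h1 ⊢
      have : z + t • (0 : Space d) + y - x = (z - x) + y := by simp; abel
      rw [this]
      linarith [norm_add_le (z - x) y]
    · have hfr : x ∈ frontier Ω := ⟨hx, fun h => hxΩ (interior_subset h)⟩
      obtain ⟨e, he, r, hr, L, γ, hγ, hloc⟩ := hΩ.locally_graph x hfr
      have hL0 : (0 : ℝ) ≤ L := L.2
      -- A perturbation `y` lowers the height by at most `‖y‖` and raises the graph by at most `2 L
      -- ‖y‖`, so `(1 + 2 L) ‖y‖ ≤ t` keeps the point above it. Three moves of size `r / 3` stay in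
      -- the graph chart.
      refine ⟨r / 3, by positivity, 1 / (1 + 2 * L), by positivity, ?_, e, he.le, ?_⟩
      · rw [div_le_one (by positivity)]; linarith
      intro z hz t ht htr y hy
      have hz1 : z ∈ Ω ∩ Metric.ball x r :=
        ⟨hz.1, Metric.ball_subset_ball (by linarith) hz.2⟩
      rw [hloc] at hz1
      have hzγ : γ (z - inner ℝ e z • e) < inner ℝ e z := hz1.1
      have hε1 : 1 / (1 + 2 * (L : ℝ)) ≤ 1 := by
        rw [div_le_one (by positivity)]; linarith
      have hyt : ‖y‖ ≤ t := hy.trans (mul_le_of_le_one_left ht.le hε1)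
      have hy2 : (1 + 2 * (L : ℝ)) * ‖y‖ ≤ t := by
        have := mul_le_mul_of_nonneg_left hy (by positivity : (0 : ℝ) ≤ 1 + 2 * L)
        rwa [← mul_assoc, mul_one_div_cancel (by positivity), one_mul] at this
      have hp : z + t • e + y ∈ {y | γ (y - inner ℝ e y • e) < inner ℝ e y} ∩ Metric.ball x r := by
        constructor
        · have e1 : inner ℝ e (z + t • e + y) = inner ℝ e z + t + inner ℝ e y := by
            rw [inner_add_right, inner_add_right, inner_smul_right, real_inner_self_eq_norm_sq, he]
            ring
          have e2 : z + t • e + y - (inner ℝ e z + t + inner ℝ e y) • e =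
              (z - inner ℝ e z • e) + (y - inner ℝ e y • e) := by
            rw [add_smul, add_smul]; abel
          have hey : |inner ℝ e y| ≤ ‖y‖ := by
            have := abs_real_inner_le_norm e y
            rwa [he, one_mul] at this
          have e3 : ‖y - inner ℝ e y • e‖ ≤ 2 * ‖y‖ := by
            refine (norm_sub_le _ _).trans ?_
            rw [norm_smul, he, mul_one, Real.norm_eq_abs]
            linarith
          have e4 := hγ.dist_le_mul ((z - inner ℝ e z • e) + (y - inner ℝ e y • e))
            (z - inner ℝ e z • e)
          rw [dist_self_add_left, Real.dist_eq] at e4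
          have e5 := (abs_le.1 e4).2
          have e6 := mul_le_mul_of_nonneg_left e3 hL0
          have e7 := (abs_le.1 hey).1
          simp only [mem_ofPred_eq, e1, e2]
          linarith
        · have h1 := hz.2
          rw [Metric.mem_ball, dist_eq_norm] at h1 ⊢
          have : z + t • e + y - x = (z - x) + t • e + y := by abel
          rw [this]
          have h2 := norm_add_le (z - x + t • e) y
          have h3 := norm_add_le (z - x) (t • e)
          rw [norm_smul, he, mul_one, Real.norm_of_nonneg ht.le] at h3
          linarith
      rw [← hloc] at hp
      exact hp.1

lemma lintegral_comp_affine (F : Space d → ℝ≥0∞) (hF : Measurable F) {a : ℝ} (ha : 1 / 2 ≤ a)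
    (b : Space d) : ∫⁻ x, F (a • x + b) ≤ 2 ^ d * ∫⁻ x, F x := by
  have ha0 : 0 < a := by linarith
  have h1 : ∫⁻ x, F (a • x + b) = ∫⁻ x, F (x + b) ∂(Measure.map (fun x => a • x) volume) := by
    rw [lintegral_map (f := fun x => F (x + b)) (hF.comp (measurable_add_const b)) (measurable_const_smul a)]
  rw [h1, Measure.map_addHaar_smul _ ha0.ne', lintegral_smul_measure,
    lintegral_add_right_eq_self, finrank_euclideanSpace_fin, smul_eq_mul]
  refine mul_le_mul_left ?_ _
  rw [abs_of_pos (by positivity), ← inv_pow]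
  have : a⁻¹ ≤ 2 := by
    rw [inv_le_comm₀ ha0 (by norm_num)]; linarith
  calc ENNReal.ofReal (a⁻¹ ^ d) ≤ ENNReal.ofReal (2 ^ d) :=
        ENNReal.ofReal_le_ofReal (pow_le_pow_left₀ (by positivity) this _)
    _ = 2 ^ d := by rw [ENNReal.ofReal_pow (by norm_num)]; norm_num

lemma lintegral_rpow_le {X : Type*} [MeasurableSpace X] {μ : Measure X} [IsProbabilityMeasure μ]
    {p : ℝ} (hp : 1 ≤ p) {f : X → ℝ≥0∞} (hf : AEMeasurable f μ) :
    (∫⁻ x, f x ∂μ) ^ p ≤ ∫⁻ x, f x ^ p ∂μ := by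
  have h := eLpNorm'_le_eLpNorm'_of_exponent_le one_pos hp μ hf.aestronglyMeasurable
  simp only [eLpNorm', enorm_eq_self, ENNReal.rpow_one, div_one] at h
  have h2 := ENNReal.rpow_le_rpow h (by linarith : 0 ≤ p)
  rwa [← ENNReal.rpow_mul, one_div_mul_cancel (by linarith), ENNReal.rpow_one] at h2

/-- The fundamental theorem of calculus along a segment. -/
lemma enorm_sub_rpow_le_lintegral {Ω : Set (Space d)} (hΩ : IsOpen Ω) {u : Space d → ℝ}
    (hu : ContDiffOn ℝ 1 u Ω) {x q : Space d}
    (hseg : ∀ s ∈ Icc (0 : ℝ) 1, x + s • (q - x) ∈ Ω) {p : ℝ} (hp : 1 ≤ p) :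
    ‖u q - u x‖ₑ ^ p ≤ ‖q - x‖ₑ ^ p *
      ∫⁻ s in Ioc (0 : ℝ) 1, ‖gradient u (x + s • (q - x))‖ₑ ^ p := by
  set φ : ℝ → Space d := fun s => x + s • (q - x) with hφ
  have hφc : Continuous φ := by fun_prop
  have hder : ∀ s ∈ uIcc (0 : ℝ) 1, HasDerivAt (fun s => u (φ s)) (fderiv ℝ u (φ s) (q - x)) s := by
    intro s hs
    rw [uIcc_of_le zero_le_one] at hs
    have h1 : DifferentiableAt ℝ u (φ s) :=
      (hu.differentiableOn one_ne_zero).differentiableAt (hΩ.mem_nhds (hseg s hs))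
    have h2 : HasDerivAt φ (q - x) s := by
      simpa [hφ] using ((hasDerivAt_id s).smul_const (q - x)).const_add x
    exact h1.hasFDerivAt.comp_hasDerivAt s h2
  have hcont : ContinuousOn (fun s => fderiv ℝ u (φ s) (q - x)) (uIcc (0 : ℝ) 1) := by
    rw [uIcc_of_le zero_le_one]
    have h1 := (hu.continuousOn_fderiv_of_isOpen hΩ le_rfl).comp hφc.continuousOn
      (s := Icc (0 : ℝ) 1) (fun s hs => hseg s hs)
    exact h1.clm_apply continuousOn_const
  have hftc := intervalIntegral.integral_eq_sub_of_hasDerivAt hder hcont.intervalIntegrable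
  have e0 : u (φ 1) = u q := by simp [hφ]
  have e1 : u (φ 0) = u x := by simp [hφ]
  rw [intervalIntegral.integral_of_le zero_le_one, e0, e1] at hftc
  rw [← hftc]
  have hmeas : Measurable fun s => ‖gradient u (φ s)‖ₑ :=
    ((measurable_gradient u).comp hφc.measurable).enorm
  have h1 : ‖∫ s in Ioc (0 : ℝ) 1, fderiv ℝ u (φ s) (q - x)‖ₑ ≤
      ‖q - x‖ₑ * ∫⁻ s in Ioc (0 : ℝ) 1, ‖gradient u (φ s)‖ₑ := by
    refine (enorm_integral_le_lintegral_enorm _).trans ?_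
    rw [← lintegral_const_mul _ hmeas]
    refine lintegral_mono fun s => ?_
    rw [mul_comm]
    have : ‖gradient u (φ s)‖ₑ = ‖fderiv ℝ u (φ s)‖ₑ := by
      rw [← ofReal_norm, ← ofReal_norm, norm_gradient_eq]
    rw [this]
    exact ContinuousLinearMap.le_opENorm _ _
  have hprob : IsProbabilityMeasure (volume.restrict (Ioc (0 : ℝ) 1)) := ⟨by simp⟩
  calc _ ≤ (‖q - x‖ₑ * ∫⁻ s in Ioc (0 : ℝ) 1, ‖gradient u (φ s)‖ₑ) ^ p :=
        ENNReal.rpow_le_rpow h1 (by linarith)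
    _ = ‖q - x‖ₑ ^ p * (∫⁻ s in Ioc (0 : ℝ) 1, ‖gradient u (φ s)‖ₑ) ^ p :=
        ENNReal.mul_rpow_of_nonneg _ _ (by linarith)
    _ ≤ _ := by
        gcongr
        exact lintegral_rpow_le hp hmeas.aemeasurable

/-- Averaging over segments joining two sets of comparable size. -/
lemma lintegral_segments_le {G : Space d → ℝ≥0∞} (hG : Measurable G) (E D : Set (Space d))
    (hED : volume E ≤ volume D) :
    ∫⁻ q in D, ∫⁻ x in E, ∫⁻ s in Ioc (0 : ℝ) 1, G (x + s • (q - x)) ≤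
      volume D * (2 ^ d * ∫⁻ x, G x) := by
  have hm3 : Measurable fun z : (Space d × Space d) × ℝ => G (z.1.2 + z.2 • (z.1.1 - z.1.2)) :=
    hG.comp (by fun_prop)
  have hsw1 : ∀ q, ∫⁻ x in E, ∫⁻ s in Ioc (0 : ℝ) 1, G (x + s • (q - x)) =
      ∫⁻ s in Ioc (0 : ℝ) 1, ∫⁻ x in E, G (x + s • (q - x)) := fun q =>
    lintegral_lintegral_swap (Measurable.aemeasurable (hG.comp (by fun_prop :
      Measurable fun z : Space d × ℝ => z.1 + z.2 • (q - z.1))))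
  simp_rw [hsw1]
  rw [lintegral_lintegral_swap]
  swap
  · refine Measurable.aemeasurable ?_
    refine Measurable.lintegral_prod_right'
      (f := fun z : (Space d × ℝ) × Space d => G (z.2 + z.1.2 • (z.1.1 - z.2))) ?_
    exact hG.comp (by fun_prop)
  have hs : ∀ s ∈ Ioc (0 : ℝ) 1, ∫⁻ q in D, ∫⁻ x in E, G (x + s • (q - x)) ≤
      volume D * (2 ^ d * ∫⁻ x, G x) := by
    intro s hs
    -- For fixed `s` the point `(1 - s) x + s q` is a dilation of `x` by `1 - s` and of `q` by `s`.
    -- One of these factors is at least `1/2`, and substituting in that variable costs at most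
    -- `2^d`.
    rcases le_total s (1 / 2) with h | h
    · calc _ ≤ ∫⁻ q in D, (2 ^ d * ∫⁻ x, G x) := by
            refine lintegral_mono fun q => ?_
            refine (setLIntegral_le_lintegral _ _).trans ?_
            refine le_trans (le_of_eq ?_) (lintegral_comp_affine G hG (a := 1 - s) (by linarith)
              (s • q))
            congr 1 with x
            congr 1
            rw [smul_sub, sub_smul, one_smul]; abel
        _ = _ := by rw [setLIntegral_const, mul_comm]
    · rw [lintegral_lintegral_swap]
      · calc _ ≤ ∫⁻ x in E, (2 ^ d * ∫⁻ x, G x) := by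
              refine lintegral_mono fun x => ?_
              refine (setLIntegral_le_lintegral _ _).trans ?_
              refine le_trans (le_of_eq ?_) (lintegral_comp_affine G hG h (x - s • x))
              congr 1 with q
              congr 1
              rw [smul_sub]; abel
          _ = volume E * (2 ^ d * ∫⁻ x, G x) := by rw [setLIntegral_const, mul_comm]
          _ ≤ _ := by gcongr
      · exact Measurable.aemeasurable (hG.comp (by fun_prop :
          Measurable fun z : Space d × Space d => z.2 + s • (z.1 - z.2)))
  calc _ ≤ ∫⁻ s in Ioc (0 : ℝ) 1, volume D * (2 ^ d * ∫⁻ x, G x) :=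
        setLIntegral_mono measurable_const hs
    _ = _ := by simp

/-- Local Poincaré inequality at scale `h`, uniformly in the centre. -/
lemma IsBoundedLipschitz.exists_local_poincare {Ω : Set (Space d)} (hΩ : IsBoundedLipschitz Ω)
    {p : ℝ} (hp : 1 ≤ p) :
    ∃ h₀ : ℝ, 0 < h₀ ∧ ∃ R : ℝ, 1 ≤ R ∧ ∃ C : ℝ, 0 < C ∧ ∀ h, 0 < h → h ≤ h₀ →
      ∀ v ∈ closure Ω, ∀ u : Space d → ℝ, ContDiffOn ℝ 1 u Ω →
      ∃ a : ℝ, ∫⁻ x in Ω ∩ Metric.closedBall v h, ‖u x - a‖ₑ ^ p ≤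
        ENNReal.ofReal (C * h ^ p) *
          ∫⁻ x in Ω ∩ Metric.closedBall v (R * h), ‖gradient u x‖ₑ ^ p := by
  obtain ⟨ε, hε, hε1, r, hr, hcone⟩ := hΩ.uniform_cone
  -- The target ball `D` is `M h` away along the cone axis. At parameter `s` a segment from `E` to
  -- `D` deviates from the axis by at most `2 h s = ε (s M h)`, so it stays in the cone, hence in
  -- `Ω`.
  set M := 2 / ε with hM
  have hMε : ε * M = 2 := by rw [hM]; field_simp
  have hM2 : 2 ≤ M := by rw [hM, le_div_iff₀ hε]; linarith
  refine ⟨r / M, by positivity, M + 1, by linarith, (M + 2) ^ p * 2 ^ d, by positivity, ?_⟩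
  intro h hh hhr v hv u hu
  obtain ⟨e, he, hcone⟩ := hcone v hv
  have hMh : M * h ≤ r := by rw [le_div_iff₀ (by linarith)] at hhr; linarith
  set E := Ω ∩ Metric.closedBall v h with hE
  set D := Metric.closedBall (v + (M * h) • e) h with hD
  set A := Ω ∩ Metric.closedBall v ((M + 1) * h) with hA
  have hAm : MeasurableSet A := hΩ.isOpen.measurableSet.inter Metric.isClosed_closedBall.measurableSet
  set G : Space d → ℝ≥0∞ := A.indicator fun x => ‖gradient u x‖ₑ ^ p with hG
  have hGm : Measurable G := (((measurable_gradient u).enorm).pow_const p).indicator hAm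
  have hEm : MeasurableSet E := hΩ.isOpen.measurableSet.inter Metric.isClosed_closedBall.measurableSet
  have hDvol : volume D = volume (Metric.closedBall v h) := by
    rw [hD, Measure.addHaar_closedBall_center, ← Measure.addHaar_closedBall_center volume v]
  have hED : volume E ≤ volume D := hDvol ▸ measure_mono inter_subset_right
  have hD0 : volume D ≠ 0 := (Metric.measure_closedBall_pos _ _ hh).ne'
  have hDt : volume D ≠ ⊤ := measure_closedBall_lt_top.ne
  have hFm : Measurable fun q => ∫⁻ x in E, ∫⁻ s in Ioc (0 : ℝ) 1, G (x + s • (q - x)) := by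
    refine Measurable.lintegral_prod_right' (f := fun z : Space d × Space d =>
      ∫⁻ s in Ioc (0 : ℝ) 1, G (z.2 + s • (z.1 - z.2))) ?_
    refine Measurable.lintegral_prod_right' (f := fun z : (Space d × Space d) × ℝ =>
      G (z.1.2 + z.2 • (z.1.1 - z.1.2))) ?_
    exact hGm.comp (by fun_prop)
  -- The constant subtracted will be `u q`, for a point `q` of `D` whose segment integral does not
  -- exceed the average over `D`.
  obtain ⟨q, hq, hqle⟩ := exists_le_setLAverage hD0 hDt hFm.aemeasurable
  have hqle2 : ∫⁻ x in E, ∫⁻ s in Ioc (0 : ℝ) 1, G (x + s • (q - x)) ≤ 2 ^ d * ∫⁻ x, G x := by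
    refine hqle.trans ?_
    rw [setLAverage_eq]
    refine ENNReal.div_le_of_le_mul ?_
    rw [mul_comm]
    exact lintegral_segments_le hGm E D hED
  have hseg : ∀ x ∈ E, ∀ s ∈ Icc (0 : ℝ) 1, x + s • (q - x) ∈ A := by
    intro x hx s hs
    have hxv : ‖x - v‖ ≤ h := by simpa [dist_eq_norm] using hx.2
    have hqv : ‖q - (v + (M * h) • e)‖ ≤ h := by simpa [hD, dist_eq_norm] using hq
    constructor
    · rcases hs.1.eq_or_lt with rfl | hs0
      · simpa using hx.1
      · have h1 : x + s • (q - x) = x + (s * (M * h)) • e +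
            s • ((q - (v + (M * h) • e)) - (x - v)) := by
          simp only [smul_sub, smul_add, smul_smul]; abel
        rw [h1]
        refine hcone x ⟨hx.1, ?_⟩ _ (by positivity) ?_ _ ?_
        · rw [Metric.mem_ball, dist_eq_norm]
          have : 2 * h ≤ M * h := mul_le_mul_of_nonneg_right hM2 hh.le
          linarith
        · exact (mul_le_of_le_one_left (by positivity) hs.2).trans hMh
        · rw [norm_smul, Real.norm_of_nonneg hs.1]
          have h2 := norm_sub_le (q - (v + (M * h) • e)) (x - v)
          have h3 : ε * (s * (M * h)) = s * (2 * h) := by rw [← hMε]; ring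
          rw [h3]
          exact mul_le_mul_of_nonneg_left (by linarith) hs.1
    · refine (convex_closedBall v ((M + 1) * h)).add_smul_sub_mem ?_ ?_ hs
      · rw [Metric.mem_closedBall, dist_eq_norm]; nlinarith
      · rw [Metric.mem_closedBall, dist_eq_norm]
        have h4 : q - v = (q - (v + (M * h) • e)) + (M * h) • e := by abel
        rw [h4]
        have h5 : ‖(M * h) • e‖ ≤ M * h := by
          rw [norm_smul, Real.norm_of_nonneg (by positivity)]
          exact mul_le_of_le_one_right (by positivity) he
        linarith [norm_add_le (q - (v + (M * h) • e)) ((M * h) • e)]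
  have hdist : ∀ x ∈ E, ‖q - x‖ₑ ≤ ENNReal.ofReal ((M + 2) * h) := by
    intro x hx
    have hxv : ‖x - v‖ ≤ h := by simpa [dist_eq_norm] using hx.2
    have hqv : ‖q - (v + (M * h) • e)‖ ≤ h := by simpa [hD, dist_eq_norm] using hq
    rw [← ofReal_norm]
    refine ENNReal.ofReal_le_ofReal ?_
    have h4 : q - x = (q - (v + (M * h) • e)) + (M * h) • e - (x - v) := by abel
    rw [h4]
    have h5 : ‖(M * h) • e‖ ≤ M * h := by
      rw [norm_smul, Real.norm_of_nonneg (by positivity)]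
      exact mul_le_of_le_one_right (by positivity) he
    linarith [norm_add_le (q - (v + (M * h) • e)) ((M * h) • e),
      norm_sub_le ((q - (v + (M * h) • e)) + (M * h) • e) (x - v)]
  refine ⟨u q, ?_⟩
  have hpt : ∀ x ∈ E, ‖u x - u q‖ₑ ^ p ≤ ENNReal.ofReal ((M + 2) * h) ^ p *
      ∫⁻ s in Ioc (0 : ℝ) 1, G (x + s • (q - x)) := by
    intro x hx
    have h1 := enorm_sub_rpow_le_lintegral hΩ.isOpen hu (x := x) (q := q)
      (fun s hs => (hseg x hx s hs).1) hp
    have h2 : ‖u x - u q‖ₑ = ‖u q - u x‖ₑ := by rw [← enorm_neg, neg_sub]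
    rw [h2]
    refine h1.trans (mul_le_mul' (ENNReal.rpow_le_rpow (hdist x hx) (by linarith)) ?_)
    refine setLIntegral_mono' measurableSet_Ioc fun s hs => ?_
    rw [hG, indicator_of_mem (hseg x hx s ⟨hs.1.le, hs.2⟩)]
  have hconst : ENNReal.ofReal ((M + 2) ^ p * 2 ^ d * h ^ p) =
      ENNReal.ofReal ((M + 2) * h) ^ p * 2 ^ d := by
    rw [ENNReal.ofReal_rpow_of_nonneg (by positivity) (by linarith),
      Real.mul_rpow (by positivity) hh.le, mul_right_comm, ENNReal.ofReal_mul (by positivity)]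
    congr 1
    rw [ENNReal.ofReal_pow (by norm_num)]; norm_num
  have hGA : ∫⁻ x, G x = ∫⁻ x in A, ‖gradient u x‖ₑ ^ p := by
    rw [hG, lintegral_indicator hAm]
  have hIm : Measurable fun x => ∫⁻ s in Ioc (0 : ℝ) 1, G (x + s • (q - x)) :=
    Measurable.lintegral_prod_right' (f := fun z : Space d × ℝ => G (z.1 + z.2 • (q - z.1)))
      (hGm.comp (by fun_prop))
  calc _ ≤ ∫⁻ x in E, ENNReal.ofReal ((M + 2) * h) ^ p *
        ∫⁻ s in Ioc (0 : ℝ) 1, G (x + s • (q - x)) := setLIntegral_mono' hEm hpt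
    _ = ENNReal.ofReal ((M + 2) * h) ^ p *
        ∫⁻ x in E, ∫⁻ s in Ioc (0 : ℝ) 1, G (x + s • (q - x)) := lintegral_const_mul _ hIm
    _ ≤ ENNReal.ofReal ((M + 2) * h) ^ p * (2 ^ d * ∫⁻ x, G x) := by gcongr
    _ = _ := by rw [hconst, ← hGA, mul_assoc]

end Poincare

/-! ### Quasi-interpolation and `W^{1,p}`-stability of the projection -/

lemma add_rpow_le_two_rpow {a b p : ℝ} (ha : 0 ≤ a) (hb : 0 ≤ b) (hp : 0 ≤ p) :
    (a + b) ^ p ≤ 2 ^ p * (a ^ p + b ^ p) := by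
  have h1 : a + b ≤ 2 * max a b := by
    linarith [le_max_left a b, le_max_right a b]
  have hm : 0 ≤ max a b := ha.trans (le_max_left _ _)
  have h2 : (max a b) ^ p ≤ a ^ p + b ^ p := by
    rcases max_choice a b with h | h <;> rw [h]
    · linarith [Real.rpow_nonneg hb p]
    · linarith [Real.rpow_nonneg ha p]
  calc (a + b) ^ p ≤ (2 * max a b) ^ p := Real.rpow_le_rpow (by positivity) h1 hp
    _ = 2 ^ p * (max a b) ^ p := Real.mul_rpow (by norm_num) hm
    _ ≤ _ := by gcongr

section Stability

variable {d : ℕ}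

/-- Sums over elements of integrals over neighbourhoods of the elements of comparable size. -/
lemma exists_overlap_bound (d : ℕ) {c : ℝ} (hc : 0 < c) {R : ℝ} (hR : 0 ≤ R) :
    ∃ C : ℝ, 0 < C ∧
      ∀ {Ω : Set (Space d)} {𝒯 : Geometry.SimplicialComplex ℝ (Space d)} {h : ℝ}
      {ctr : Finset (Space d) → Space d}, QuasiMesh Ω 𝒯 c h ctr →
      ∀ g : Space d → ℝ, (∀ x, 0 ≤ g x) → IntegrableOn g Ω →
      ∑ s ∈ elts 𝒯, ∫ x in Ω ∩ Metric.closedBall (ctr s) (R * h), g x ≤ C * ∫ x in Ω, g x := by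
  obtain ⟨C, hC, H⟩ := exists_sum_decay_le d hc
  refine ⟨(1 + R) ^ (d + 1) * C, by positivity, ?_⟩
  intro Ω 𝒯 h ctr M g hg0 hg
  have hh := M.h_pos
  have hΩm := M.lip.isOpen.measurableSet
  have h1 : ∀ s, ∫ x in Ω ∩ Metric.closedBall (ctr s) (R * h), g x =
      ∫ x in Ω, (Metric.closedBall (ctr s) (R * h)).indicator g x := fun s => by
    rw [setIntegral_indicator Metric.isClosed_closedBall.measurableSet]
  simp_rw [h1]
  have hint : ∀ s ∈ elts 𝒯, IntegrableOn ((Metric.closedBall (ctr s) (R * h)).indicator g) Ω :=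
    fun s _ => hg.indicator Metric.isClosed_closedBall.measurableSet
  rw [← integral_finsetSum _ hint, ← integral_const_mul]
  refine integral_mono (integrable_finsetSum _ hint) (hg.const_mul _) fun y => ?_
  -- The indicator of a ball of radius `R h` lies below a multiple of the decay profile, so finite
  -- overlap follows from the summability of that profile.
  have h2 : ∀ s ∈ elts 𝒯, (Metric.closedBall (ctr s) (R * h)).indicator g y ≤
      (1 + R) ^ (d + 1) * ((1 + dist (ctr s) y / h) ^ (d + 1))⁻¹ * g y := by
    intro s _
    by_cases hy : y ∈ Metric.closedBall (ctr s) (R * h)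
    · rw [indicator_of_mem hy]
      refine le_mul_of_one_le_left (hg0 y) ?_
      rw [Metric.mem_closedBall, dist_comm] at hy
      have h3 : dist (ctr s) y / h ≤ R := by rwa [div_le_iff₀ hh]
      rw [← div_eq_mul_inv, one_le_div (by positivity)]
      exact pow_le_pow_left₀ (by positivity) (by linarith) _
    · rw [indicator_of_notMem hy]
      have := hg0 y
      positivity
  refine (Finset.sum_le_sum h2).trans ?_
  rw [← Finset.sum_mul, ← Finset.mul_sum]
  exact mul_le_mul_of_nonneg_right (mul_le_mul_of_nonneg_left (H M y) (by positivity)) (hg0 y)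

/-- The interpolant is a convex combination of vertex values, so the worst vertex bounds its
distance to `a`; the sum replaces the maximum to make the bound integrable term by term. -/
lemma abs_interp_sub_le {𝒯 : Geometry.SimplicialComplex ℝ (Space d)} {s : Finset (Space d)}
    (hs : s ∈ 𝒯.faces) {x : Space d} (hx : x ∈ convexHull ℝ (s : Set (Space d)))
    (F : Space d → ℝ) (a : ℝ) {p : ℝ} (hp : 0 ≤ p) :
    |a - interp 𝒯 F x| ^ p ≤ ∑ v ∈ s, |a - F v| ^ p := by
  obtain ⟨w, hw⟩ := exists_isBary hx
  obtain ⟨v₀, hv₀, hmax⟩ := s.exists_max_image (fun v => |F v - a|)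
    (Geometry.SimplicialComplex.nonempty_of_mem_faces hs)
  have h1 : |a - interp 𝒯 F x| ≤ |a - F v₀| := by
    rw [abs_sub_comm, interp_eq hs hw, abs_sub_comm a]
    exact abs_weighted_sub_le hw.1 hw.2.1 hmax
  exact (Real.rpow_le_rpow (abs_nonneg _) h1 hp).trans
    (Finset.single_le_sum (f := fun v => |a - F v| ^ p) (fun v _ => by positivity) hv₀)

/-- Quasi-interpolation of functions on a Lipschitz domain by piecewise linear functions. -/
lemma IsBoundedLipschitz.exists_quasiInterpolant {Ω : Set (Space d)} (hΩ : IsBoundedLipschitz Ω)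
    {c : ℝ} (hc : 0 < c) {p : ℝ} (hp : 1 ≤ p) :
    ∃ h₀ : ℝ, 0 < h₀ ∧ ∃ C : ℝ, 0 < C ∧
      ∀ {𝒯 : Geometry.SimplicialComplex ℝ (Space d)} {h : ℝ}
      {ctr : Finset (Space d) → Space d}, QuasiMesh Ω 𝒯 c h ctr → h ≤ h₀ →
      ∀ u : Space d → ℝ, ContinuousOn u (closure Ω) → ContDiffOn ℝ 1 u Ω →
      IntegrableOn (fun x => ‖gradient u x‖ ^ p) Ω →
      ∃ w ∈ densitySpace 𝒯 1,
        ∫ x in Ω, |u x - w x| ^ p ≤ C * h ^ p * ∫ x in Ω, ‖gradient u x‖ ^ p ∧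
        ∫ x in Ω, ‖gradient w x‖ ^ p ≤ C * ∫ x in Ω, ‖gradient u x‖ ^ p := by
  obtain ⟨h₀, hh₀, R, hR, C₁, hC₁, H₁⟩ := hΩ.exists_local_poincare hp
  obtain ⟨C₂, hC₂, H₂⟩ := exists_overlap_bound d hc (by linarith : 0 ≤ R + 1)
  obtain ⟨C₃, hC₃, H₃⟩ := exists_gradient_rpow_bound d 1 hc hp
  have hB := ballVol_pos d
  have hp0 : 0 ≤ p := by linarith
  set Ci := (d + 1 : ℝ) * C₁ with hCi
  set Cg := C₃ * (ballVol d ^ (p - 1) * (2 ^ p * (Ci + C₁))) with hCg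
  have hCi0 : 0 < Ci := by positivity
  have hCg0 : 0 < Cg := by positivity
  refine ⟨h₀, hh₀, (Ci + Cg) * C₂, by positivity, ?_⟩
  intro 𝒯 h ctr M hhh u hu hu1 hg
  have hh := M.h_pos
  have hvert : ∀ v, ∃ a : ℝ, v ∈ closure Ω →
      ∫⁻ x in Ω ∩ Metric.closedBall v h, ‖u x - a‖ₑ ^ p ≤ ENNReal.ofReal (C₁ * h ^ p) *
          ∫⁻ x in Ω ∩ Metric.closedBall v (R * h), ‖gradient u x‖ₑ ^ p := by
    intro v
    by_cases hv : v ∈ closure Ω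
    · obtain ⟨a, ha⟩ := H₁ h hh hhh v hv u hu1
      exact ⟨a, fun _ => ha⟩
    · exact ⟨0, fun hv' => (hv hv').elim⟩
  -- The vertex value is the constant of the local Poincaré inequality around that vertex, since the
  -- `L^p` norm of the gradient need not control point values of `u`.
  choose F hF using hvert
  set g : Space d → ℝ := fun x => ‖gradient u x‖ ^ p with hgdef
  have hg0 : ∀ x, 0 ≤ g x := fun x => by positivity
  have hcomp : IsCompact (closure Ω) := hΩ.isBounded.isCompact_closure
  have hKcont : ∀ s ∈ elts 𝒯, ∀ f : Space d → ℝ, ContinuousOn f (closure Ω) →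
      IntegrableOn (fun x => |f x| ^ p) (convexHull ℝ (s : Set (Space d))) := fun s hs f hf =>
    (ContinuousOn.rpow_const (hf.mono (M.tri.simplex_subset_closure hs)).abs fun x _ =>
      Or.inr hp0).integrableOn_compact (isCompact_simplex s)
  have hloc : ∀ s ∈ elts 𝒯, ∀ v ∈ s, ∫ x in convexHull ℝ (s : Set (Space d)), |u x - F v| ^ p ≤
      C₁ * h ^ p * ∫ x in Ω ∩ Metric.closedBall (ctr s) ((R + 1) * h), g x := by
    intro s hs v hv
    have hvK : v ∈ convexHull ℝ (s : Set (Space d)) := subset_convexHull ℝ _ hv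
    have hvΩ := M.tri.simplex_subset_closure hs hvK
    have hF1 := hF v hvΩ
    have hgsub : Ω ∩ Metric.closedBall v (R * h) ⊆
        Ω ∩ Metric.closedBall (ctr s) ((R + 1) * h) := by
      refine inter_subset_inter_right _ (Metric.closedBall_subset_closedBall' ?_)
      have := M.dist_le s hs v hvK _ (M.ctr_mem hs)
      linarith
    have hKsub : interior (convexHull ℝ (s : Set (Space d))) ⊆ Ω ∩ Metric.closedBall v h :=
      fun x hx => ⟨M.tri.interior_simplex_subset hΩ hs hx,
        M.dist_le s hs x (interior_subset hx) v hvK⟩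
    have hgS : IntegrableOn g (Ω ∩ Metric.closedBall (ctr s) ((R + 1) * h)) :=
      hg.mono_set inter_subset_left
    have hgI : 0 ≤ ∫ x in Ω ∩ Metric.closedBall (ctr s) ((R + 1) * h), g x :=
      integral_nonneg fun x => hg0 x
    have hint := hKcont s hs (fun x => u x - F v) (hu.sub continuousOn_const)
    rw [← ENNReal.ofReal_le_ofReal_iff (by positivity),
      ofReal_integral_eq_lintegral_ofReal hint (ae_of_all _ fun x => by positivity),
      ENNReal.ofReal_mul (by positivity),
      ofReal_integral_eq_lintegral_ofReal hgS (ae_of_all _ hg0)]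
    have hconv : ∀ y : ℝ, ENNReal.ofReal (|y| ^ p) = ‖y‖ₑ ^ p := fun y => by
      rw [← ENNReal.ofReal_rpow_of_nonneg (abs_nonneg y) hp0, ← Real.norm_eq_abs, ofReal_norm]
    have hconv2 : ∀ x, ENNReal.ofReal (g x) = ‖gradient u x‖ₑ ^ p := fun x => by
      rw [hgdef, ← ENNReal.ofReal_rpow_of_nonneg (norm_nonneg _) hp0, ofReal_norm]
    simp_rw [hconv, hconv2]
    rw [setLIntegral_congr (simplex_ae_eq_interior s)]
    exact (lintegral_mono_set hKsub).trans (hF1.trans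
      (mul_le_mul_right (lintegral_mono_set hgsub) _))
  set w := interp 𝒯 F with hw
  have hwS : w ∈ densitySpace 𝒯 1 := interp_mem_densitySpace M.tri le_rfl F
  have hwc : ContinuousOn w (closure Ω) := M.tri.continuousOn hΩ.isOpen hwS
  have hsum := H₂ M g hg0 hg
  set I : Finset (Space d) → ℝ := fun s =>
    ∫ x in Ω ∩ Metric.closedBall (ctr s) ((R + 1) * h), g x with hI
  have hI0 : ∀ s, 0 ≤ I s := fun s => integral_nonneg fun x => hg0 x
  have hG0 : 0 ≤ ∫ x in Ω, g x := integral_nonneg hg0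
  have happrox : ∀ s ∈ elts 𝒯, ∫ x in convexHull ℝ (s : Set (Space d)), |u x - w x| ^ p ≤
      Ci * h ^ p * I s := by
    intro s hs
    have hsm := M.tri.mem_elts.1 hs
    calc _ ≤ ∫ x in convexHull ℝ (s : Set (Space d)), ∑ v ∈ s, |u x - F v| ^ p := by
          refine setIntegral_mono_on (hKcont s hs (fun x => u x - w x) (hu.sub hwc))
            (integrable_finsetSum _ fun v _ => hKcont s hs (fun x => u x - F v)
              (hu.sub continuousOn_const)) (isCompact_simplex s).isClosed.measurableSet
            fun x hx => abs_interp_sub_le hsm.1 hx F (u x) hp0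
      _ = ∑ v ∈ s, ∫ x in convexHull ℝ (s : Set (Space d)), |u x - F v| ^ p :=
          integral_finsetSum _ fun v _ => hKcont s hs (fun x => u x - F v)
              (hu.sub continuousOn_const)
      _ ≤ ∑ v ∈ s, C₁ * h ^ p * I s := Finset.sum_le_sum (hloc s hs)
      _ = _ := by
          rw [Finset.sum_const, hsm.2, nsmul_eq_mul]; push_cast; ring
  have hgrad : ∀ s ∈ elts 𝒯, ∫ x in convexHull ℝ (s : Set (Space d)), ‖gradient w x‖ ^ p ≤
      Cg * I s := by
    intro s hs
    have hsm := M.tri.mem_elts.1 hs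
    obtain ⟨v₀, hv₀⟩ := Geometry.SimplicialComplex.nonempty_of_mem_faces hsm.1
    -- Subtracting a vertex value keeps the gradient and makes the function small: `|w - F v₀| ≤ |u
    -- - w| + |u - F v₀|` gains a factor `h` in `L^p`, which the inverse inequality then spends.
    set w₀ : Space d → ℝ := fun x => w x - F v₀ with hw₀
    have hw₀S : w₀ ∈ densitySpace 𝒯 1 :=
      densitySpace_sub hwS fun S _ => isPolyOn_const _
    have hw₀c : ContinuousOn w₀ (closure Ω) := hwc.sub continuousOn_const
    have e1 : ∀ x, gradient w x = gradient w₀ x := fun x => by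
      simp only [gradient, hw₀, fderiv_sub_const]
    simp_rw [e1]
    have e2 := H₃ M w₀ hw₀S s hs
    have e3 := M.emean_rpow_le hs (hw₀c.mono (M.tri.simplex_subset_closure hs)) hp
    have e4 : ∫ x in convexHull ℝ (s : Set (Space d)), |w₀ x| ^ p ≤
        2 ^ p * ((Ci + C₁) * h ^ p * I s) := by
      calc _ ≤ ∫ x in convexHull ℝ (s : Set (Space d)),
            2 ^ p * (|u x - w x| ^ p + |u x - F v₀| ^ p) := by
            refine integral_mono (hKcont s hs w₀ hw₀c)
              (((hKcont s hs (fun x => u x - w x) (hu.sub hwc)).add (hKcont s hs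
              (fun x => u x - F v₀) (hu.sub continuousOn_const))).const_mul _) fun x => ?_
            refine le_trans (Real.rpow_le_rpow (abs_nonneg _) ?_ hp0)
              (add_rpow_le_two_rpow (abs_nonneg _) (abs_nonneg _) hp0)
            have : w₀ x = (u x - F v₀) - (u x - w x) := by simp only [hw₀]; ring
            rw [this, add_comm]
            exact abs_sub _ _
        _ = 2 ^ p * ((∫ x in convexHull ℝ (s : Set (Space d)), |u x - w x| ^ p) +
            ∫ x in convexHull ℝ (s : Set (Space d)), |u x - F v₀| ^ p) := by
            rw [integral_const_mul, integral_add (hKcont s hs (fun x => u x - w x) (hu.sub hwc))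
              (hKcont s hs (fun x => u x - F v₀) (hu.sub continuousOn_const))]
        _ ≤ _ := by
            rw [add_mul, add_mul]
            gcongr
            · exact happrox s hs
            · exact hloc s hs v₀ hv₀
    have hhp : 0 < h ^ p := Real.rpow_pos_of_pos hh p
    calc _ ≤ _ := e2
      _ ≤ C₃ * (h ^ p)⁻¹ * (ballVol d ^ (p - 1) * (2 ^ p * ((Ci + C₁) * h ^ p * I s))) := by
          exact mul_le_mul_of_nonneg_left (e3.trans (mul_le_mul_of_nonneg_left e4
            (by positivity))) (by positivity)
      _ = _ := by rw [hCg]; field_simp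
  have huw : ContinuousOn (fun x => |u x - w x| ^ p) (closure Ω) :=
    ContinuousOn.rpow_const (hu.sub hwc).abs fun x _ => Or.inr hp0
  refine ⟨w, hwS, ?_, ?_⟩
  · rw [M.tri.setIntegral_eq_sum hΩ ((huw.integrableOn_compact hcomp).mono_set subset_closure)]
    have hhp : 0 < h ^ p := Real.rpow_pos_of_pos hh p
    calc _ ≤ ∑ s ∈ elts 𝒯, Ci * h ^ p * I s := Finset.sum_le_sum happrox
      _ ≤ Ci * h ^ p * (C₂ * ∫ x in Ω, g x) := by
          rw [← Finset.mul_sum]; gcongr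
      _ ≤ (Ci + Cg) * h ^ p * (C₂ * ∫ x in Ω, g x) := by gcongr; linarith
      _ = _ := by ring
  · rw [M.tri.setIntegral_eq_sum hΩ (M.tri.integrableOn_gradient_rpow hΩ hwS hp0)]
    calc _ ≤ ∑ s ∈ elts 𝒯, Cg * I s := Finset.sum_le_sum hgrad
      _ ≤ Cg * (C₂ * ∫ x in Ω, g x) := by
          rw [← Finset.mul_sum]; gcongr
      _ ≤ (Ci + Cg) * (C₂ * ∫ x in Ω, g x) := by gcongr; linarith
      _ = _ := by ring

lemma IsTriangulation.ae_differentiableAt {Ω : Set (Space d)} (hΩ : IsBoundedLipschitz Ω)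
    {𝒯 : Geometry.SimplicialComplex ℝ (Space d)} (hT : IsTriangulation Ω 𝒯) :
    ∀ᵐ x ∂volume.restrict Ω, ∀ (k : ℕ), ∀ v ∈ densitySpace 𝒯 k, DifferentiableAt ℝ v x := by
  rw [ae_restrict_iff' hΩ.isOpen.measurableSet]
  filter_upwards [hT.ae_mem_interior hΩ] with x hx hxΩ k v hv
  obtain ⟨s, hs, hxs⟩ := hx hxΩ
  obtain ⟨p, -, hp⟩ := hT.mem_densitySpace_iff.1 hv s hs
  refine ((contDiff_polyFun p (n := 1)).differentiable one_ne_zero x).congr_of_eventuallyEq ?_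
  filter_upwards [isOpen_interior.mem_nhds hxs] with y hy
  exact hp y (interior_subset hy)

/-- Stability of the `L²`-projection in `W^{1,p}`, `1 ≤ p ≤ 2`. -/
lemma IsBoundedLipschitz.exists_projection_gradient_bound {Ω : Set (Space d)}
    (hΩ : IsBoundedLipschitz Ω) (k : ℕ) {c : ℝ} (hc : 0 < c) {p : ℝ} (hp1 : 1 ≤ p) (hp2 : p ≤ 2) :
    ∃ C : ℝ, 0 < C ∧
      ∀ {𝒯 : Geometry.SimplicialComplex ℝ (Space d)} {h : ℝ}
      {ctr : Finset (Space d) → Space d}, QuasiMesh Ω 𝒯 c h ctr →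
      ∀ v ∈ densitySpace 𝒯 k, ∀ u : Space d → ℝ, ContinuousOn u (closure Ω) →
      ContDiffOn ℝ 1 u Ω → IntegrableOn (fun x => ‖gradient u x‖ ^ p) Ω →
      (∀ r ∈ densitySpace 𝒯 k, ∫ x in Ω, (v x - u x) * r x = 0) →
      ∫ x in Ω, ‖gradient v x‖ ^ p ≤
        C * ((∫ x in Ω, ‖gradient u x‖ ^ p) + (∫ x in Ω, u x ^ 2) + 1) := by
  have hp0 : 0 ≤ p := by linarith
  have hfin := hΩ.isFiniteMeasure
  -- For `k = 0` discrete functions are constant on each element and the gradient vanishes almost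
  -- everywhere; the decay argument needs `k ≥ 1`.
  rcases Nat.eq_zero_or_pos k with rfl | hk
  · refine ⟨1, one_pos, ?_⟩
    intro 𝒯 h ctr M v hv u hu hu1 hg horth
    have h0 : ∫ x in Ω, ‖gradient v x‖ ^ p = 0 := by
      rw [M.tri.setIntegral_eq_sum hΩ (M.tri.integrableOn_gradient_rpow hΩ hv hp0)]
      refine Finset.sum_eq_zero fun s hs => ?_
      rw [setIntegral_congr_set (simplex_ae_eq_interior s)]
      refine setIntegral_eq_zero_of_forall_eq_zero fun x hx => ?_
      obtain ⟨q, hq, hvq⟩ := M.tri.mem_densitySpace_iff.1 hv s hs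
      have hq0 : q.totalDegree = 0 := Nat.le_zero.1 hq
      rw [MvPolynomial.totalDegree_eq_zero_iff_eq_C] at hq0
      have h1 : v =ᶠ[nhds x] fun _ => q.coeff 0 := by
        filter_upwards [isOpen_interior.mem_nhds hx] with y hy
        rw [hvq y (interior_subset hy), hq0]
        simp
      rw [h1.gradient_eq, gradient_fun_const, norm_zero, Real.zero_rpow (by linarith)]
    rw [h0]
    have h1 : 0 ≤ ∫ x in Ω, ‖gradient u x‖ ^ p := integral_nonneg fun x => by positivity
    have h2 : 0 ≤ ∫ x in Ω, u x ^ 2 := integral_nonneg fun x => sq_nonneg _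
    linarith
  obtain ⟨h₀, hh₀, C₁, hC₁, H₁⟩ := hΩ.exists_quasiInterpolant hc hp1
  obtain ⟨C₂, hC₂, H₂⟩ := exists_projection_rpow_bound d hk hc hp1 hp2
  obtain ⟨C₃, hC₃, H₃⟩ := exists_gradient_rpow_bound d k hc hp1
  set A := volume.real Ω with hA
  have hA0 : 0 ≤ A := measureReal_nonneg
  set K₁ := 2 ^ p * (C₃ * C₂ * C₁ + C₁) with hK₁
  set K₂ := C₃ * C₂ * (h₀ ^ p)⁻¹ * (1 + A) with hK₂
  refine ⟨K₁ + K₂, by positivity, ?_⟩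
  intro 𝒯 h ctr M v hv u hu hu1 hg horth
  have hh := M.h_pos
  have hcomp : IsCompact (closure Ω) := hΩ.isBounded.isCompact_closure
  have hu2 : IntegrableOn (fun x => u x ^ 2) Ω :=
    ((hu.pow 2).integrableOn_compact hcomp).mono_set subset_closure
  have hinv : ∀ v' ∈ densitySpace 𝒯 k, ∀ u' : Space d → ℝ, ContinuousOn u' (closure Ω) →
      (∀ r ∈ densitySpace 𝒯 k, ∫ x in Ω, (v' x - u' x) * r x = 0) →
      ∫ x in Ω, ‖gradient v' x‖ ^ p ≤ C₃ * C₂ * (h ^ p)⁻¹ * ∫ x in Ω, |u' x| ^ p := by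
    intro v' hv' u' hu' horth'
    rw [M.tri.setIntegral_eq_sum hΩ (M.tri.integrableOn_gradient_rpow hΩ hv' hp0)]
    calc _ ≤ ∑ s ∈ elts 𝒯, C₃ * (h ^ p)⁻¹ * (h ^ d * emean h s v' ^ p) :=
          Finset.sum_le_sum fun s hs => H₃ M v' hv' s hs
      _ ≤ C₃ * (h ^ p)⁻¹ * (C₂ * ∫ x in Ω, |u' x| ^ p) := by
          rw [← Finset.mul_sum]
          gcongr
          exact H₂ M v' hv' u' hu' horth'
      _ = _ := by ring
  have hg0 : 0 ≤ ∫ x in Ω, ‖gradient u x‖ ^ p := integral_nonneg fun x => by positivity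
  have hu20 : 0 ≤ ∫ x in Ω, u x ^ 2 := integral_nonneg fun x => sq_nonneg _
  have hhp : 0 < h ^ p := Real.rpow_pos_of_pos hh p
  have hK₁0 : 0 ≤ K₁ := by positivity
  have hK₂0 : 0 ≤ K₂ := by positivity
  -- On a fine mesh `v - w` is the projection of `u - w` and the interpolation error cancels
  -- `h^(-p)`. On a coarse mesh `h^(-p) ≤ h₀^(-p)` is harmless, and `|u|^p ≤ u² + 1` suffices.
  rcases le_total h h₀ with hle | hle
  · obtain ⟨w, hw, hw1, hw2⟩ := H₁ M hle u hu hu1 hg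
    have hwk : w ∈ densitySpace 𝒯 k := fun S hS => (hw S hS).mono_deg hk
    have hwc := M.tri.continuousOn hΩ.isOpen hwk
    have hvw := densitySpace_sub hv hwk
    have e1 := hinv _ hvw (fun x => u x - w x) (hu.sub hwc) fun r hr => by
      rw [← horth r hr]
      congr 1 with x
      ring
    have e2 : ∫ x in Ω, ‖gradient v x‖ ^ p ≤ ∫ x in Ω,
        2 ^ p * (‖gradient (fun x => v x - w x) x‖ ^ p + ‖gradient w x‖ ^ p) := by
      refine integral_mono_ae (M.tri.integrableOn_gradient_rpow hΩ hv hp0)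
        (((M.tri.integrableOn_gradient_rpow hΩ hvw hp0).add
          (M.tri.integrableOn_gradient_rpow hΩ hwk hp0)).const_mul _) ?_
      filter_upwards [M.tri.ae_differentiableAt hΩ] with x hx
      refine le_trans (Real.rpow_le_rpow (norm_nonneg _) ?_ hp0)
        (add_rpow_le_two_rpow (norm_nonneg _) (norm_nonneg _) hp0)
      simp_rw [norm_gradient_eq]
      rw [fderiv_fun_sub (hx k v hv) (hx k w hwk)]
      calc _ = ‖(fderiv ℝ v x - fderiv ℝ w x) + fderiv ℝ w x‖ := by rw [sub_add_cancel]
        _ ≤ _ := norm_add_le _ _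
    rw [integral_const_mul, integral_add (M.tri.integrableOn_gradient_rpow hΩ hvw hp0)
      (M.tri.integrableOn_gradient_rpow hΩ hwk hp0)] at e2
    have e3 : C₃ * C₂ * (h ^ p)⁻¹ * ∫ x in Ω, |u x - w x| ^ p ≤
        C₃ * C₂ * C₁ * ∫ x in Ω, ‖gradient u x‖ ^ p := by
      calc _ ≤ C₃ * C₂ * (h ^ p)⁻¹ * (C₁ * h ^ p * ∫ x in Ω, ‖gradient u x‖ ^ p) := by gcongr
        _ = _ := by field_simp
    calc _ ≤ _ := e2
      _ ≤ 2 ^ p * (C₃ * C₂ * C₁ * (∫ x in Ω, ‖gradient u x‖ ^ p) +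
          C₁ * ∫ x in Ω, ‖gradient u x‖ ^ p) := by
          gcongr
          exact e1.trans e3
      _ = K₁ * ∫ x in Ω, ‖gradient u x‖ ^ p := by rw [hK₁]; ring
      _ ≤ (K₁ + K₂) * ((∫ x in Ω, ‖gradient u x‖ ^ p) + (∫ x in Ω, u x ^ 2) + 1) :=
          mul_le_mul (by linarith) (by linarith) hg0 (by linarith)
  · have e1 := hinv v hv u hu horth
    have e2 : ∫ x in Ω, |u x| ^ p ≤ (1 + A) * ((∫ x in Ω, u x ^ 2) + 1) := by
      calc _ ≤ ∫ x in Ω, (u x ^ 2 + 1) := by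
            refine integral_mono ?_ (hu2.add (integrable_const _)) fun x => ?_
            · exact ((ContinuousOn.rpow_const hu.abs fun x _ =>
                Or.inr hp0).integrableOn_compact hcomp).mono_set subset_closure
            · rcases le_total |u x| 1 with h1 | h1
              · linarith [Real.rpow_le_one (abs_nonneg (u x)) h1 hp0, sq_nonneg (u x)]
              · have := Real.rpow_le_rpow_of_exponent_le h1 hp2
                rw [Real.rpow_two, sq_abs] at this
                linarith
        _ = (∫ x in Ω, u x ^ 2) + A := by
            rw [integral_add hu2 (integrable_const _)]
            simp [hA]
        _ ≤ _ := by nlinarith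
    have e3 : (h ^ p)⁻¹ ≤ (h₀ ^ p)⁻¹ :=
      inv_anti₀ (Real.rpow_pos_of_pos hh₀ p) (Real.rpow_le_rpow hh₀.le hle hp0)
    calc _ ≤ _ := e1
      _ ≤ C₃ * C₂ * (h₀ ^ p)⁻¹ * ((1 + A) * ((∫ x in Ω, u x ^ 2) + 1)) := by
          have : 0 ≤ ∫ x in Ω, |u x| ^ p := integral_nonneg fun x => by positivity
          gcongr
      _ = K₂ * ((∫ x in Ω, u x ^ 2) + 1) := by rw [hK₂]; ring
      _ ≤ _ := mul_le_mul (by linarith) (by linarith) (by linarith) (by linarith)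

end Stability

variable {d k : ℕ} {Ω : Set (Space d)} {𝒯 : Geometry.SimplicialComplex ℝ (Space d)}

/-! ### A trace inequality -/

/-- A continuous function with right slopes bounded by `L` is compared with a line; the comparison
principle demands a strict inequality of slopes, whence `L + 1`. -/
lemma abs_sub_le_of_eventually_right {f : ℝ → ℝ} {a b L : ℝ} (hf : ContinuousOn f (Icc a b))
    (h : ∀ x ∈ Ico a b, ∀ᶠ z in nhdsWithin x (Ioi x), |f z - f x| ≤ L * (z - x)) :
    ∀ x ∈ Icc a b, |f x - f a| ≤ (L + 1) * (x - a) := by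
  have key := image_norm_le_of_liminf_right_slope_norm_lt_deriv_boundary
    (f := fun x => f x - f a) (f' := fun _ => L) (a := a) (b := b)
    (hf.sub continuousOn_const) ?_ (B := fun x => (L + 1) * (x - a)) (B' := fun _ => L + 1)
    (by simp) (by fun_prop) ?_ ?_
  · exact fun x hx => key hx
  · intro x hx r hr
    refine Filter.Eventually.frequently ?_
    filter_upwards [h x hx, self_mem_nhdsWithin] with z hz hzx
    have hzx' : 0 < z - x := sub_pos.2 hzx
    have h1 : |f z - f a| - |f x - f a| ≤ L * (z - x) := by
      have := abs_sub_abs_le_abs_sub (f z - f a) (f x - f a)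
      rw [sub_sub_sub_cancel_right] at this
      linarith
    simp only [slope_def_field, Function.comp, Real.norm_eq_abs]
    rw [div_lt_iff₀ hzx']
    nlinarith
  · intro x _
    simpa using (((hasDerivAt_id x).sub_const a).const_mul (L + 1)).hasDerivWithinAt
  · intro x _ _
    linarith

lemma IsPolyOn.exists_lipschitz {S : Set (Space d)} (hS : IsCompact S) (hc : Convex ℝ S)
    {u : Space d → ℝ} (hu : IsPolyOn k S u) :
    ∃ B : ℝ, 0 ≤ B ∧ ∀ x ∈ S, ∀ y ∈ S, |u y - u x| ≤ B * ‖y - x‖ := by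
  obtain ⟨p, -, hp⟩ := hu
  obtain ⟨B, hB⟩ := hS.exists_bound_of_continuousOn
    ((contDiff_polyFun p (n := 1)).continuous_fderiv one_ne_zero).continuousOn
  refine ⟨max B 0, le_max_right _ _, fun x hx y hy => ?_⟩
  have h1 := hc.norm_image_sub_le_of_norm_fderiv_le (𝕜 := ℝ) (f := polyFun p) (C := max B 0)
    (fun z _ => ((contDiff_polyFun p (n := 1)).differentiable one_ne_zero) z)
    (fun z hz => (hB z hz).trans (le_max_left _ _)) hx hy
  rw [hp x hx, hp y hy]
  exact h1

/-- Elements are closed and finite in number, so every point close to a given one shares an element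
with it, on which the function is a polynomial. This gives local slopes along the segment even if it
runs inside faces, with a bound independent of the segment. -/
lemma IsTriangulation.exists_lipschitz_segment (hT : IsTriangulation Ω 𝒯) (hΩ : IsOpen Ω)
    {r : Space d → ℝ} (hr : r ∈ densitySpace 𝒯 k) :
    ∃ B : ℝ≥0, ∀ (y e : Space d), ‖e‖ = 1 → ∀ b : ℝ, (∀ s ∈ Icc 0 b, y + s • e ∈ closure Ω) →
      LipschitzOnWith B (fun s : ℝ => r (y + s • e)) (Icc 0 b) := by
  choose! B hB0 hB using fun s (hs : s ∈ elts 𝒯) =>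
    (hT.mem_densitySpace_iff.1 hr s hs).exists_lipschitz (isCompact_simplex s)
      (convex_convexHull ℝ _)
  have hA0 : 0 ≤ ∑ s ∈ elts 𝒯, B s := Finset.sum_nonneg hB0
  refine ⟨(∑ s ∈ elts 𝒯, B s + 1).toNNReal, fun y e he b hy => ?_⟩
  have hline : Continuous fun s : ℝ => y + s • e := by fun_prop
  have hcont : ContinuousOn (fun s : ℝ => r (y + s • e)) (Icc 0 b) :=
    (hT.continuousOn hΩ hr).comp hline.continuousOn hy
  have hloc : ∀ x ∈ Ico 0 b, ∀ᶠ z in nhdsWithin x (Ioi x),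
      |r (y + z • e) - r (y + x • e)| ≤ (∑ s ∈ elts 𝒯, B s) * (z - x) := by
    intro x hx
    have h1 : ∀ᶠ z in nhds x, ∀ s ∈ elts 𝒯, y + z • e ∈ convexHull ℝ (s : Set (Space d)) →
        y + x • e ∈ convexHull ℝ (s : Set (Space d)) := by
      rw [Filter.eventually_all_finset]
      intro s _
      by_cases hm : y + x • e ∈ convexHull ℝ (s : Set (Space d))
      · exact Filter.Eventually.of_forall fun _ _ => hm
      · have := (hline.continuousAt (x := x)).eventually
          ((isCompact_simplex s).isClosed.isOpen_compl.mem_nhds hm)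
        filter_upwards [this] with z hz hz'
        exact absurd hz' hz
    have h2 : ∀ᶠ z in nhdsWithin x (Ioi x), z < b :=
      nhdsWithin_le_nhds (eventually_lt_nhds hx.2)
    filter_upwards [nhdsWithin_le_nhds h1, self_mem_nhdsWithin, h2] with z hz hzx hzb
    have hzx' : x < z := hzx
    have hmem := hy z ⟨hx.1.trans hzx'.le, hzb.le⟩
    rw [← hT.iUnion_simplex hΩ] at hmem
    simp only [mem_iUnion] at hmem
    obtain ⟨s, hs, hzs⟩ := hmem
    have h3 := hB s hs _ (hz s hs hzs) _ hzs
    have h4 : ‖(y + z • e) - (y + x • e)‖ = z - x := by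
      rw [add_sub_add_left_eq_sub, ← sub_smul, norm_smul, he, mul_one, Real.norm_eq_abs,
        abs_of_pos (sub_pos.2 hzx')]
    rw [h4] at h3
    exact h3.trans (mul_le_mul_of_nonneg_right (Finset.single_le_sum hB0 hs)
      (sub_pos.2 hzx').le)
  refine LipschitzOnWith.of_le_add_mul _ ?_
  have main : ∀ u ∈ Icc 0 b, ∀ v ∈ Icc 0 b, u ≤ v →
      |r (y + v • e) - r (y + u • e)| ≤ (∑ s ∈ elts 𝒯, B s + 1) * (v - u) := by
    intro u hu v hv huv
    exact abs_sub_le_of_eventually_right (f := fun s : ℝ => r (y + s • e)) (a := u) (b := v)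
      (hcont.mono (Icc_subset_Icc hu.1 hv.2))
      (fun x hx => hloc x ⟨hu.1.trans hx.1, hx.2.trans_le hv.2⟩) v ⟨huv, le_rfl⟩
  intro u hu v hv
  rw [Real.dist_eq]
  rw [Real.coe_toNNReal _ (by linarith)]
  rcases le_total u v with h | h
  · have := main u hu v hv h
    rw [abs_sub_comm u v, abs_of_nonneg (sub_nonneg.2 h)]
    have := neg_abs_le (r (y + v • e) - r (y + u • e))
    linarith
  · have := main v hv u hu h
    rw [abs_of_nonneg (sub_nonneg.2 h)]
    have := le_abs_self (r (y + u • e) - r (y + v • e))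
    linarith

/-- The one-dimensional trace inequality: `|f 0| ≤ |f s| + ∫ |f'|`, integrated over `s`. -/
lemma mul_enorm_le_lintegral {f : ℝ → ℝ} {b : ℝ} {L : ℝ≥0}
    (hf : LipschitzOnWith L f (Icc 0 b)) :
    ENNReal.ofReal b * ‖f 0‖ₑ ≤
      ∫⁻ s in Ioo 0 b, (‖f s‖ₑ + ENNReal.ofReal b * ‖deriv f s‖ₑ) := by
  have hvol : volume (Ioo 0 b) = ENNReal.ofReal b := by simp
  have h1 : ∀ s ∈ Ioo 0 b, ‖f 0‖ₑ ≤ ‖f s‖ₑ + ∫⁻ τ in Ioo 0 b, ‖deriv f τ‖ₑ := by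
    intro s hs
    have hac : AbsolutelyContinuousOnInterval f 0 s :=
      LipschitzOnWith.absolutelyContinuousOnInterval (K := L) (by
        rw [uIcc_of_le hs.1.le]
        exact hf.mono (Icc_subset_Icc le_rfl hs.2.le))
    have h2 := hac.integral_deriv_eq_sub
    rw [intervalIntegral.integral_of_le hs.1.le] at h2
    have h3 : f 0 = f s - ∫ τ in Ioc 0 s, deriv f τ := by rw [h2]; ring
    calc ‖f 0‖ₑ = ‖f s - ∫ τ in Ioc 0 s, deriv f τ‖ₑ := by rw [← h3]
      _ ≤ ‖f s‖ₑ + ‖∫ τ in Ioc 0 s, deriv f τ‖ₑ := enorm_sub_le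
      _ ≤ ‖f s‖ₑ + ∫⁻ τ in Ioc 0 s, ‖deriv f τ‖ₑ := by
          gcongr
          exact enorm_integral_le_lintegral_enorm _
      _ ≤ _ := by
          refine add_le_add le_rfl (lintegral_mono_set ?_)
          exact fun x hx => ⟨hx.1, hx.2.trans_lt hs.2⟩
  have hc : ContinuousOn f (Icc 0 b) := hf.continuousOn
  calc ENNReal.ofReal b * ‖f 0‖ₑ = ∫⁻ _ in Ioo 0 b, ‖f 0‖ₑ := by
        rw [setLIntegral_const, hvol, mul_comm]
    _ ≤ ∫⁻ s in Ioo 0 b, (‖f s‖ₑ + ∫⁻ τ in Ioo 0 b, ‖deriv f τ‖ₑ) :=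
        setLIntegral_mono' measurableSet_Ioo h1
    _ = (∫⁻ s in Ioo 0 b, ‖f s‖ₑ) + ENNReal.ofReal b * ∫⁻ τ in Ioo 0 b, ‖deriv f τ‖ₑ := by
        rw [lintegral_add_right _ measurable_const, setLIntegral_const, hvol, mul_comm]
    _ = _ := by
        rw [← lintegral_const_mul _ (measurable_deriv f).enorm,
          ← lintegral_add_right _ ((measurable_deriv f).enorm.const_mul _)]

/-- The shear `(p, s) ↦ p + s e` of `e^⊥ × ℝ` onto the whole space. -/
noncomputable def shear (e : Space d) (he : ‖e‖ = 1) :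
    (((ℝ ∙ e)ᗮ : Submodule ℝ (Space d)) × ℝ) ≃L[ℝ] Space d :=
  LinearEquiv.toContinuousLinearEquiv
    { toFun := fun q => (q.1 : Space d) + q.2 • e
      map_add' := fun q q' => by
        simp only [Prod.fst_add, Prod.snd_add, Submodule.coe_add, add_smul]; abel
      map_smul' := fun c q => by simp [mul_smul]
      invFun := fun y => (⟨y - inner ℝ e y • e, by
        rw [Submodule.mem_orthogonal_singleton_iff_inner_right, inner_sub_right, inner_smul_right,
          real_inner_self_eq_norm_sq, he]; simp⟩, inner ℝ e y)
      left_inv := fun q => by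
        have h := Submodule.mem_orthogonal_singleton_iff_inner_right.1 q.1.2
        have h2 : inner ℝ e ((q.1 : Space d) + q.2 • e) = q.2 := by
          rw [inner_add_right, h, inner_smul_right, real_inner_self_eq_norm_sq, he]; simp
        refine Prod.ext (Subtype.ext ?_) h2
        simp [h2]
      right_inv := fun y => by simp }

lemma finrank_orthogonal_unit (hd : 1 ≤ d) (e : Space d) (he : ‖e‖ = 1) :
    Module.finrank ℝ ((ℝ ∙ e)ᗮ : Submodule ℝ (Space d)) = d - 1 := by
  have : Fact (Module.finrank ℝ (Space d) = (d - 1) + 1) := ⟨by simp; omega⟩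
  exact Submodule.finrank_orthogonal_span_singleton (by rintro rfl; simp at he)

/-- The shear is a linear isomorphism, so it carries the product of Haar measures to a multiple of
Lebesgue measure, and the value of the multiple is immaterial. The first clause yields
differentiability at almost every point of almost every line. -/
lemma exists_lintegral_shear (hd : 1 ≤ d) (e : Space d) (he : ‖e‖ = 1) :
    ∃ c : ℝ≥0,
      (∀ q : Space d → Prop, (∀ᵐ y, q y) →
        ∀ᵐ p : ((ℝ ∙ e)ᗮ : Submodule ℝ (Space d)) ∂μHE[d - 1],
          ∀ᵐ s : ℝ, q ((p : Space d) + s • e)) ∧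
      ∀ F : Space d → ℝ≥0∞, Measurable F →
        ∫⁻ p : ((ℝ ∙ e)ᗮ : Submodule ℝ (Space d)), (∫⁻ s : ℝ, F ((p : Space d) + s • e)) ∂μHE[d - 1]
          = c * ∫⁻ y, F y := by
  have hfin := finrank_orthogonal_unit hd e he
  have hν : (μHE[d - 1] : Measure ((ℝ ∙ e)ᗮ : Submodule ℝ (Space d))).IsAddHaarMeasure := by
    rw [← hfin]; infer_instance
  set ν : Measure ((ℝ ∙ e)ᗮ : Submodule ℝ (Space d)) := μHE[d - 1]
  have hmap := (shear e he).isAddHaarMeasure_map (ν.prod volume)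
  have hm : Measurable (shear e he) := (shear e he).continuous.measurable
  have heq := Measure.isAddLeftInvariant_eq_smul ((ν.prod volume).map (shear e he))
    (volume : Measure (Space d))
  refine ⟨((ν.prod volume).map (shear e he)).addHaarScalarFactor volume, fun q hq => ?_,
    fun F hF => ?_⟩
  · have h1 : ∀ᵐ y ∂((ν.prod volume).map (shear e he)), q y := by
      rw [heq]
      exact Measure.ae_smul_measure hq _
    exact Measure.ae_ae_of_ae_prod (ae_of_ae_map hm.aemeasurable h1)
  · have h1 : ∫⁻ y, F y ∂((ν.prod volume).map (shear e he)) =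
        ∫⁻ p, (∫⁻ s : ℝ, F ((p : Space d) + s • e)) ∂ν := by
      rw [lintegral_map hF hm]
      exact lintegral_prod (fun q => F (shear e he q)) (hF.comp hm).aemeasurable
    rw [← h1]
    conv_lhs => rw [heq]
    rw [lintegral_smul_measure]
    rfl

/-- The trace inequality near a boundary point. -/
lemma IsBoundedLipschitz.exists_local_trace (hd : 1 ≤ d) (hΩ : IsBoundedLipschitz Ω)
    {x₀ : Space d} (hx₀ : x₀ ∈ frontier Ω) :
    ∃ δ > 0, ∃ C : ℝ≥0∞, C ≠ ∞ ∧ μHE[d - 1] (frontier Ω ∩ Metric.ball x₀ δ) ≤ C ∧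
      ∀ (𝒯 : Geometry.SimplicialComplex ℝ (Space d)) (k : ℕ), IsTriangulation Ω 𝒯 →
        ∀ r ∈ densitySpace 𝒯 k,
          ∫⁻ x in frontier Ω ∩ Metric.ball x₀ δ, ‖r x‖ₑ ∂μHE[d - 1] ≤
            C * ∫⁻ x in Ω, (‖r x‖ₑ + ‖gradient r x‖ₑ) := by
  obtain ⟨e, he, r₀, hr₀, L, γ, hγ, hgr⟩ := hΩ.locally_graph x₀ hx₀
  have hΩm := hΩ.isOpen.measurableSet
  set P : Submodule ℝ (Space d) := (ℝ ∙ e)ᗮ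
  set ν : Measure P := μHE[d - 1] with hνdef
  have hfin := finrank_orthogonal_unit hd e he
  have hν : ν.IsAddHaarMeasure := by
    rw [hνdef, ← hfin]; infer_instance
  set δ := r₀ / 2 with hδdef
  have hδ : 0 < δ := half_pos hr₀
  set S := frontier Ω ∩ Metric.ball x₀ δ with hSdef
  have hSm : MeasurableSet S := isClosed_frontier.measurableSet.inter measurableSet_ball
  have hperp : ∀ p : P, inner ℝ e (p : Space d) = 0 :=
    fun p => Submodule.mem_orthogonal_singleton_iff_inner_right.1 p.2
  have hee : inner ℝ e e = (1 : ℝ) := by rw [real_inner_self_eq_norm_sq, he]; simp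
  set Ψ : P → Space d := fun p => (p : Space d) + γ p • e with hΨ
  have hΨL : LipschitzWith (1 + L) Ψ := by
    refine LipschitzWith.add (LipschitzWith.subtype_val _) ?_
    refine LipschitzWith.of_dist_le_mul fun p q => ?_
    rw [dist_eq_norm, ← sub_smul, norm_smul, he, mul_one, ← dist_eq_norm]
    exact hγ.dist_le_mul _ _
  have hΨa : ∀ p, Ψ p = (p : Space d) + γ p • e := fun _ => rfl
  have hΨm : Measurable Ψ := hΨL.continuous.measurable
  -- boundary points lie on the graph
  have hgraph : ∀ y ∈ S, ∃ p : P, Ψ p = y := by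
    rintro y ⟨hyf, hyb⟩
    have hyb' : y ∈ Metric.ball x₀ r₀ := Metric.ball_subset_ball (by linarith) hyb
    have hyΩ : y ∉ Ω := fun h => by
      rw [hΩ.isOpen.frontier_eq] at hyf; exact hyf.2 h
    have h1 : inner ℝ e y ≤ γ (y - inner ℝ e y • e) := by
      by_contra! hlt
      have : y ∈ Ω ∩ Metric.ball x₀ r₀ := by rw [hgr]; exact ⟨hlt, hyb'⟩
      exact hyΩ this.1
    have h2 : γ (y - inner ℝ e y • e) ≤ inner ℝ e y := by
      have hcl : y ∈ closure (Ω ∩ Metric.ball x₀ r₀) :=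
        Metric.isOpen_ball.closure_inter ⟨frontier_subset_closure hyf, hyb'⟩
      rw [hgr] at hcl
      have hsub : {y | γ (y - inner ℝ e y • e) < inner ℝ e y} ∩ Metric.ball x₀ r₀ ⊆
          {y | γ (y - inner ℝ e y • e) ≤ inner ℝ e y} := fun z hz => by
        have h : γ (z - inner ℝ e z • e) < inner ℝ e z := hz.1
        exact h.le
      have hclosed : IsClosed {y : Space d | γ (y - inner ℝ e y • e) ≤ inner ℝ e y} :=
        isClosed_le (hγ.continuous.comp (by fun_prop)) (by fun_prop)
      exact closure_minimal hsub hclosed hcl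
    refine ⟨⟨y - inner ℝ e y • e, ?_⟩, ?_⟩
    · rw [Submodule.mem_orthogonal_singleton_iff_inner_right, inner_sub_right, inner_smul_right,
        hee]; simp
    · simp [hΨ, le_antisymm h2 h1]
  -- points above the graph lie in the domain
  have habove : ∀ p : P, Ψ p ∈ S → ∀ s ∈ Ioc 0 δ, Ψ p + s • e ∈ Ω := by
    intro p hp s hs
    have hb : Ψ p + s • e ∈ Metric.ball x₀ r₀ := by
      rw [Metric.mem_ball, dist_eq_norm]
      have h1 : ‖Ψ p - x₀‖ < δ := by rw [← dist_eq_norm]; exact hp.2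
      calc ‖Ψ p + s • e - x₀‖ = ‖(Ψ p - x₀) + s • e‖ := by congr 1; abel
        _ ≤ ‖Ψ p - x₀‖ + ‖s • e‖ := norm_add_le _ _
        _ = ‖Ψ p - x₀‖ + s := by
            rw [norm_smul, he, mul_one, Real.norm_of_nonneg hs.1.le]
        _ < r₀ := by linarith [hs.2]
    have h2 : inner ℝ e (Ψ p + s • e) = γ p + s := by
      rw [hΨa, inner_add_right, inner_add_right, inner_smul_right, inner_smul_right, hperp, hee]
      ring
    have h3 : Ψ p + s • e - inner ℝ e (Ψ p + s • e) • e = p := by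
      rw [h2, add_smul, hΨa]; abel
    have : Ψ p + s • e ∈ {y | γ (y - inner ℝ e y • e) < inner ℝ e y} ∩ Metric.ball x₀ r₀ := by
      refine ⟨?_, hb⟩
      change γ (Ψ p + s • e - inner ℝ e (Ψ p + s • e) • e) < inner ℝ e (Ψ p + s • e)
      rw [h3, h2]
      linarith [hs.1]
    rw [← hgr] at this
    exact this.1
  -- The graph map `Ψ` is `(1 + L)`-Lipschitz, so it enlarges `(d - 1)`-dimensional Hausdorff
  -- measure by at most `κ`. Only this upper bound on the surface measure is needed, not an area
  -- formula.
  set κ : ℝ≥0∞ := ((1 + L : ℝ≥0) : ℝ≥0∞) ^ ((d - 1 : ℕ) : ℝ) with hκ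
  have hκfin : κ ≠ ∞ := ENNReal.rpow_ne_top_of_nonneg (Nat.cast_nonneg _) ENNReal.coe_ne_top
  have himage : ∀ A : Set P, μHE[d - 1] (Ψ '' A) ≤ κ * ν A := by
    intro A
    rw [hνdef, Measure.euclideanHausdorffMeasure_def, Measure.euclideanHausdorffMeasure_def,
      Measure.smul_apply, Measure.smul_apply, ENNReal.smul_def, ENNReal.smul_def, smul_eq_mul,
      smul_eq_mul, mul_left_comm]
    gcongr
    exact hΨL.hausdorffMeasure_image_le (Nat.cast_nonneg _) A
  have hle : (μHE[d - 1]).restrict S ≤ κ • (ν.restrict (Ψ ⁻¹' S)).map Ψ := by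
    refine Measure.le_iff.2 fun A hA => ?_
    rw [Measure.restrict_apply hA, Measure.smul_apply, Measure.map_apply hΨm hA,
      Measure.restrict_apply (hΨm hA), ← preimage_inter, smul_eq_mul]
    refine le_trans (measure_mono ?_) (himage _)
    intro y hy
    obtain ⟨p, hp⟩ := hgraph y hy.2
    exact ⟨p, by rw [mem_preimage, hp]; exact hy, hp⟩
  have hbdd : Bornology.IsBounded (Ψ ⁻¹' S) := by
    obtain ⟨R, hR⟩ := (Metric.isBounded_ball (x := x₀) (r := δ)).exists_norm_le
    refine (Metric.isBounded_closedBall (x := (0 : P)) (r := R)).subset fun p hp => ?_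
    rw [mem_closedBall_zero_iff]
    have h1 := hR _ hp.2
    refine le_trans ?_ h1
    have h2 : ‖Ψ p‖ ^ 2 = ‖(p : Space d)‖ ^ 2 + (γ p) ^ 2 := by
      have h0 : inner ℝ (p : Space d) (γ p • e) = 0 := by
        rw [inner_smul_right, real_inner_comm, hperp, mul_zero]
      rw [hΨa, norm_add_sq_real, h0, norm_smul, he]
      simp
    exact (pow_le_pow_iff_left₀ (norm_nonneg _) (norm_nonneg _) two_ne_zero).1 (by
      rw [h2, Submodule.coe_norm]; linarith [sq_nonneg (γ (p : Space d))])
  have hνS : ν (Ψ ⁻¹' S) < ∞ := hbdd.measure_lt_top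
  obtain ⟨c, hcae, hc⟩ := exists_lintegral_shear hd e he
  set δ' := ENNReal.ofReal δ with hδ'
  have hδ'0 : δ' ≠ 0 := by simpa [hδ'] using hδ
  have hδ't : δ' ≠ ∞ := ENNReal.ofReal_ne_top
  -- The first summand bounds the area of the boundary patch, the second is the trace constant.
  refine ⟨δ, hδ, κ * ν (Ψ ⁻¹' S) + κ * (δ'⁻¹ * (c * (1 + δ'))), ?_, ?_, ?_⟩
  · refine ENNReal.add_ne_top.2 ⟨ENNReal.mul_ne_top hκfin hνS.ne,
      ENNReal.mul_ne_top hκfin (ENNReal.mul_ne_top (ENNReal.inv_ne_top.2 hδ'0)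
        (ENNReal.mul_ne_top ENNReal.coe_ne_top (by simp [hδ't])))⟩
  · refine le_trans ?_ le_self_add
    have h1 := hle univ
    simpa [Measure.map_apply hΨm MeasurableSet.univ] using h1
  intro 𝒯 k hT r hr
  obtain ⟨B, hB⟩ := hT.exists_lipschitz_segment hΩ.isOpen hr
  set F : Space d → ℝ≥0∞ := Ω.indicator fun x => ‖r x‖ₑ + δ' * ‖gradient r x‖ₑ with hF
  have hrm : Measurable (Ω.indicator fun x => ‖r x‖ₑ) := by
    have h1 : Measurable (Ω.indicator r) := by
      classical
      rw [← piecewise_eq_indicator]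
      exact ((hT.continuousOn hΩ.isOpen hr).mono subset_closure).measurable_piecewise
        continuousOn_const hΩm
    have h2 : (Ω.indicator fun x => ‖r x‖ₑ) = fun x => ‖Ω.indicator r x‖ₑ := by
      funext x
      by_cases hx : x ∈ Ω <;> simp [hx]
    rw [h2]
    exact h1.enorm
  have hFm : Measurable F := by
    rw [hF]
    have : (Ω.indicator fun x => ‖r x‖ₑ + δ' * ‖gradient r x‖ₑ) =
        fun x => Ω.indicator (fun x => ‖r x‖ₑ) x +
          Ω.indicator (fun x => δ' * ‖gradient r x‖ₑ) x := by
      rw [← indicator_add]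
    rw [this]
    exact hrm.add (((measurable_gradient r).enorm.const_mul _).indicator hΩm)
  have hdiff : ∀ᵐ y, y ∈ Ω → DifferentiableAt ℝ r y := by
    have := hT.ae_differentiableAt hΩ
    rw [ae_restrict_iff' hΩm] at this
    filter_upwards [this] with y hy hyΩ
    exact hy hyΩ k r hr
  have hpt : ∀ᵐ p ∂ν, p ∈ Ψ ⁻¹' S →
      ‖r (Ψ p)‖ₑ ≤ δ'⁻¹ * ∫⁻ s : ℝ, F ((p : Space d) + s • e) := by
    filter_upwards [hcae _ hdiff] with p hp hpS
    have hshift : ∀ s : ℝ, Ψ p + s • e = (p : Space d) + (γ p + s) • e := by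
      intro s; rw [hΨa, add_smul, add_assoc]
    have hp' : ∀ᵐ s : ℝ, Ψ p + s • e ∈ Ω → DifferentiableAt ℝ r (Ψ p + s • e) := by
      have := (measurePreserving_add_left (volume : Measure ℝ)
        (γ p)).quasiMeasurePreserving.ae hp
      filter_upwards [this] with s hs
      rw [hshift]
      exact hs
    have hcl : ∀ s ∈ Icc 0 δ, Ψ p + s • e ∈ closure Ω := by
      intro s hs
      rcases hs.1.eq_or_lt with h | h
      · rw [← h, zero_smul, add_zero]
        exact frontier_subset_closure hpS.1
      · exact subset_closure (habove p hpS s ⟨h, hs.2⟩)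
    have h1 := mul_enorm_le_lintegral (hB (Ψ p) e he δ hcl)
    simp only [zero_smul, add_zero] at h1
    have h2 : ∫⁻ s in Ioo 0 δ, (‖r (Ψ p + s • e)‖ₑ +
        ENNReal.ofReal δ * ‖deriv (fun s : ℝ => r (Ψ p + s • e)) s‖ₑ) ≤
        ∫⁻ s in Ioo 0 δ, F (Ψ p + s • e) := by
      refine lintegral_mono_ae ?_
      refine (ae_restrict_iff' measurableSet_Ioo).2 ?_
      filter_upwards [hp'] with s hs hsI
      have hsΩ := habove p hpS s ⟨hsI.1, hsI.2.le⟩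
      have hd := hs hsΩ
      rw [hF, indicator_of_mem hsΩ]
      gcongr
      have hder : HasDerivAt (fun s : ℝ => r (Ψ p + s • e))
          (fderiv ℝ r (Ψ p + s • e) e) s := by
        have hl : HasDerivAt (fun s : ℝ => Ψ p + s • e) e s := by
          simpa using ((hasDerivAt_id s).smul_const e).const_add (Ψ p)
        exact hd.hasFDerivAt.comp_hasDerivAt s hl
      rw [hder.deriv, enorm_le_iff_norm_le, norm_gradient_eq]
      simpa [he] using (fderiv ℝ r (Ψ p + s • e)).le_opNorm e
    have h3 : ∫⁻ s in Ioo 0 δ, F (Ψ p + s • e) ≤ ∫⁻ s : ℝ, F ((p : Space d) + s • e) := by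
      refine (setLIntegral_le_lintegral _ _).trans ?_
      simp_rw [hshift]
      exact (lintegral_add_left_eq_self
        (fun s : ℝ => F ((p : Space d) + s • e)) (γ p)).le
    calc ‖r (Ψ p)‖ₑ = δ'⁻¹ * (δ' * ‖r (Ψ p)‖ₑ) := by
          rw [← mul_assoc, ENNReal.inv_mul_cancel hδ'0 hδ't, one_mul]
      _ ≤ _ := by gcongr; exact h1.trans (h2.trans h3)
  calc ∫⁻ x in S, ‖r x‖ₑ ∂μHE[d - 1]
      ≤ ∫⁻ x, ‖r x‖ₑ ∂(κ • (ν.restrict (Ψ ⁻¹' S)).map Ψ) := lintegral_mono' hle le_rfl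
    _ = κ * ∫⁻ x, ‖r x‖ₑ ∂((ν.restrict (Ψ ⁻¹' S)).map Ψ) := by
        rw [lintegral_smul_measure, smul_eq_mul]
    _ ≤ κ * ∫⁻ p in Ψ ⁻¹' S, ‖r (Ψ p)‖ₑ ∂ν := by gcongr; exact lintegral_map_le _ _
    _ ≤ κ * ∫⁻ p in Ψ ⁻¹' S, (δ'⁻¹ * ∫⁻ s : ℝ, F ((p : Space d) + s • e)) ∂ν := by
        refine mul_le_mul_right ?_ _
        refine lintegral_mono_ae ?_
        exact (ae_restrict_iff' (hΨm hSm)).2 hpt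
    _ ≤ κ * ∫⁻ p, (δ'⁻¹ * ∫⁻ s : ℝ, F ((p : Space d) + s • e)) ∂ν := by
        gcongr; exact Measure.restrict_le_self
    _ = κ * (δ'⁻¹ * (c * ∫⁻ y, F y)) := by
        rw [lintegral_const_mul' _ _ (ENNReal.inv_ne_top.2 hδ'0), hc F hFm]
    _ ≤ κ * (δ'⁻¹ * (c * ((1 + δ') * ∫⁻ x in Ω, (‖r x‖ₑ + ‖gradient r x‖ₑ)))) := by
        gcongr
        rw [hF, lintegral_indicator hΩm, ← lintegral_const_mul' _ _ (by simp [hδ't])]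
        refine lintegral_mono fun x => ?_
        calc ‖r x‖ₑ + δ' * ‖gradient r x‖ₑ ≤ (1 + δ') * ‖r x‖ₑ + (1 + δ') * ‖gradient r x‖ₑ := by
              gcongr
              · exact le_mul_of_one_le_left' le_self_add
              · exact le_add_self
          _ = _ := by rw [mul_add]
    _ = (κ * (δ'⁻¹ * (c * (1 + δ')))) * ∫⁻ x in Ω, (‖r x‖ₑ + ‖gradient r x‖ₑ) := by ring
    _ ≤ _ := by gcongr; exact le_add_self

lemma IsBoundedLipschitz.isCompact_frontier (hΩ : IsBoundedLipschitz Ω) :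
    IsCompact (frontier Ω) :=
  hΩ.isBounded.isCompact_closure.of_isClosed_subset isClosed_frontier frontier_subset_closure

/-- The boundary has finite surface measure, and the trace is bounded from `W^{1,1}` to `L¹`. -/
lemma IsBoundedLipschitz.exists_trace_bound (hd : 1 ≤ d) (hΩ : IsBoundedLipschitz Ω) :
    ∃ C : ℝ≥0∞, C ≠ ∞ ∧ surface Ω univ ≤ C ∧
      ∀ (𝒯 : Geometry.SimplicialComplex ℝ (Space d)) (k : ℕ), IsTriangulation Ω 𝒯 →
        ∀ r ∈ densitySpace 𝒯 k,
          ∫⁻ x, ‖r x‖ₑ ∂surface Ω ≤ C * ∫⁻ x in Ω, (‖r x‖ₑ + ‖gradient r x‖ₑ) := by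
  have key := hΩ.isCompact_frontier.induction_on
    (p := fun S => ∃ C : ℝ≥0∞, C ≠ ∞ ∧ μHE[d - 1] S ≤ C ∧
      ∀ (𝒯 : Geometry.SimplicialComplex ℝ (Space d)) (k : ℕ), IsTriangulation Ω 𝒯 →
        ∀ r ∈ densitySpace 𝒯 k, ∫⁻ x in S, ‖r x‖ₑ ∂μHE[d - 1] ≤
          C * ∫⁻ x in Ω, (‖r x‖ₑ + ‖gradient r x‖ₑ))
    ⟨0, by simp, by simp, by simp⟩ ?_ ?_ ?_
  · simpa [surface] using key
  · rintro S S' hSS ⟨C, hC, h1, h2⟩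
    exact ⟨C, hC, (measure_mono hSS).trans h1, fun 𝒯 k hT r hr =>
      (lintegral_mono_set hSS).trans (h2 𝒯 k hT r hr)⟩
  · rintro S S' ⟨C, hC, h1, h2⟩ ⟨C', hC', h1', h2'⟩
    refine ⟨C + C', by simp [hC, hC'], (measure_union_le _ _).trans (add_le_add h1 h1'),
      fun 𝒯 k hT r hr => (lintegral_union_le _ _ _).trans ?_⟩
    rw [add_mul]
    exact add_le_add (h2 𝒯 k hT r hr) (h2' 𝒯 k hT r hr)
  · intro x hx
    obtain ⟨δ, hδ, C, hC, h1, h2⟩ := hΩ.exists_local_trace hd hx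
    exact ⟨_, inter_mem_nhdsWithin _ (Metric.ball_mem_nhds x hδ), C, hC, h1, h2⟩

namespace ForchheimerPoly
variable (g : ForchheimerPoly)

/-! ### The conductivity and its potential -/

lemma root_nonneg (ξ : ℝ) : 0 ≤ g.root ξ := (g.existsUnique_root (abs_nonneg ξ)).choose_spec.1.1

lemma root_mul_eval (ξ : ℝ) : g.root ξ * g.eval (g.root ξ) = |ξ| :=
  (g.existsUnique_root (abs_nonneg ξ)).choose_spec.1.2

lemma eval_pos {s : ℝ} (hs : 0 ≤ s) : 0 < g.eval s := g.a_zero_pos.trans_le (g.a_zero_le_eval hs)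

lemma K_mul {ξ : ℝ} (hξ : 0 ≤ ξ) : g.K ξ * ξ = g.root ξ := by
  have h := g.root_mul_eval ξ
  rw [abs_of_nonneg hξ] at h
  have hp := g.eval_pos (g.root_nonneg ξ)
  rw [K]
  nth_rw 2 [← h]
  field_simp

lemma K_nonneg (ξ : ℝ) : 0 ≤ g.K ξ := (one_div_pos.2 (g.eval_pos (g.root_nonneg ξ))).le

lemma K_le (ξ : ℝ) : g.K ξ ≤ 1 / g.a 0 :=
  one_div_le_one_div_of_le g.a_zero_pos (g.a_zero_le_eval (g.root_nonneg ξ))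

lemma root_le_root {x y : ℝ} (hx : 0 ≤ x) (hxy : x ≤ y) : g.root x ≤ g.root y := by
  by_contra! h
  have h1 := g.root_mul_eval x
  have h2 := g.root_mul_eval y
  rw [abs_of_nonneg hx] at h1
  rw [abs_of_nonneg (hx.trans hxy)] at h2
  have h3 := g.eval_mono (g.root_nonneg y) h.le
  have h4 := g.eval_pos (g.root_nonneg x)
  have h5 := g.root_nonneg y
  nlinarith

/-- With `s = root x` and `t = root y`, `y - x = (t - s) g(t) + s (g(t) - g(s)) ≥ a₀ (t - s)`. -/
lemma root_sub_le {x y : ℝ} (hx : 0 ≤ x) (hxy : x ≤ y) :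
    g.root y - g.root x ≤ (y - x) / g.a 0 := by
  have h1 := g.root_mul_eval x
  have h2 := g.root_mul_eval y
  rw [abs_of_nonneg hx] at h1
  rw [abs_of_nonneg (hx.trans hxy)] at h2
  have h0 := g.root_le_root hx hxy
  have h3 := g.eval_mono (g.root_nonneg x) h0
  have h4 := g.a_zero_le_eval (g.root_nonneg y)
  have h5 := g.root_nonneg x
  rw [le_div_iff₀ g.a_zero_pos]
  nlinarith [mul_le_mul_of_nonneg_left h4 (sub_nonneg.2 h0), mul_le_mul_of_nonneg_left h3 h5]

lemma root_abs (x : ℝ) : g.root |x| = g.root x := by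
  refine (g.existsUnique_root (abs_nonneg x)).unique ⟨g.root_nonneg _, ?_⟩
    ⟨g.root_nonneg _, g.root_mul_eval x⟩
  rw [g.root_mul_eval, abs_abs]

lemma continuous_root : Continuous g.root := by
  have h : LipschitzWith (Real.toNNReal (1 / g.a 0)) g.root := by
    refine LipschitzWith.of_le_add_mul _ fun x y => ?_
    have ha := g.a_zero_pos
    rw [Real.coe_toNNReal _ (by positivity), Real.dist_eq, ← g.root_abs x, ← g.root_abs y]
    rcases le_total |x| |y| with h | h
    · have := g.root_le_root (abs_nonneg x) h
      have : 0 ≤ 1 / g.a 0 * |x - y| := by positivity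
      linarith
    · have h1 := g.root_sub_le (abs_nonneg y) h
      have h2 : (|x| - |y|) / g.a 0 ≤ 1 / g.a 0 * |x - y| := by
        rw [div_mul_eq_mul_div, one_mul]
        exact div_le_div_of_nonneg_right (abs_sub_abs_le_abs_sub x y) ha.le
      linarith
  exact h.continuous

lemma root_zero : g.root 0 = 0 := by
  have h := g.root_mul_eval 0
  rw [abs_zero] at h
  exact (mul_eq_zero.1 h).resolve_right (g.eval_pos (g.root_nonneg 0)).ne'

lemma continuous_K : Continuous g.K :=
  continuous_const.div (g.continuous_eval.comp g.continuous_root)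
    fun x => (g.eval_pos (g.root_nonneg x)).ne'

lemma deg_pos : 0 < g.deg := by
  have h : g.α 0 < g.α (Fin.last g.N) := g.α_strictMono (Fin.lt_def.2 (Nat.lt_of_lt_of_le zero_lt_one g.one_le_N))
  rwa [g.α_zero] at h

lemma β_sub_one : g.β - 1 = 1 / (g.deg + 1) := by
  have := g.deg_pos
  rw [β, degeneracy]
  field_simp
  ring

lemma one_lt_β : 1 < g.β := by
  have h := g.deg_pos
  have h1 := g.β_sub_one
  have : 0 < 1 / (g.deg + 1) := by positivity
  linarith

lemma β_lt_two : g.β < 2 := by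
  have h := g.deg_pos
  have : 0 < g.deg / (g.deg + 1) := by positivity
  rw [β, degeneracy]
  linarith

lemma β_pos : 0 < g.β := by linarith [g.one_lt_β]

lemma holderConjugate : g.β.HolderConjugate g.conjExp :=
  Real.HolderConjugate.conjExponent g.one_lt_β

lemma two_le_conjExp : 2 ≤ g.conjExp := by
  rw [conjExp, le_div_iff₀ (by linarith [g.one_lt_β])]
  linarith [g.β_lt_two]

lemma root_rpow_le {ξ : ℝ} (hξ : 0 ≤ ξ) : g.a (Fin.last g.N) * g.root ξ ^ (g.deg + 1) ≤ ξ := by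
  have h := g.root_mul_eval ξ
  rw [abs_of_nonneg hξ] at h
  have h0 := g.root_nonneg ξ
  have h1 : g.a (Fin.last g.N) * g.root ξ ^ g.deg ≤ g.eval (g.root ξ) :=
    Finset.single_le_sum (f := fun i => g.a i * g.root ξ ^ g.α i)
      (fun i _ => mul_nonneg (g.a_nonneg i) (Real.rpow_nonneg h0 _)) (Finset.mem_univ _)
  calc g.a (Fin.last g.N) * g.root ξ ^ (g.deg + 1)
      = g.root ξ * (g.a (Fin.last g.N) * g.root ξ ^ g.deg) := by
        rw [Real.rpow_add_one' h0 (by linarith [g.deg_pos])]; ring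
    _ ≤ g.root ξ * g.eval (g.root ξ) := mul_le_mul_of_nonneg_left h1 h0
    _ = ξ := h

/-- Keeping only the leading term gives `a_N s^(deg + 1) ≤ ξ`, and `β - 1 = 1 / (deg + 1)`. -/
lemma exists_root_le : ∃ C > 0, ∀ ξ, 0 ≤ ξ → g.root ξ ≤ C * ξ ^ (g.β - 1) := by
  have ha := g.a_last_pos
  have hd := g.deg_pos
  refine ⟨(1 / g.a (Fin.last g.N)) ^ (g.β - 1), by positivity, fun ξ hξ => ?_⟩
  rw [← Real.mul_rpow (by positivity) hξ, g.β_sub_one, one_div_mul_eq_div]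
  have h0 := g.root_nonneg ξ
  have h1 : g.root ξ ^ (g.deg + 1) ≤ ξ / g.a (Fin.last g.N) := by
    rw [le_div_iff₀ ha]
    linarith [g.root_rpow_le hξ]
  calc g.root ξ = (g.root ξ ^ (g.deg + 1)) ^ (1 / (g.deg + 1)) := by
        rw [← Real.rpow_mul h0, mul_one_div_cancel (by linarith), Real.rpow_one]
    _ ≤ _ := Real.rpow_le_rpow (Real.rpow_nonneg h0 _) h1 (by positivity)

/-- All powers of `s` are dominated by the `deg`-th power of `max 1 s`, so `ξ ≤ A (max 1 s)^(deg +
1)` with `A` the sum of the coefficients. Passing from `max 1 s` to `s` costs the `- 1`. -/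
lemma exists_le_root : ∃ c > 0, ∀ ξ, 0 ≤ ξ → c * ξ ^ (g.β - 1) - 1 ≤ g.root ξ := by
  have ha := g.a_zero_pos
  have hd := g.deg_pos
  set A := ∑ i, g.a i with hA
  have hApos : 0 < A := ha.trans_le
    (Finset.single_le_sum (f := g.a) (fun i _ => g.a_nonneg i) (Finset.mem_univ 0))
  refine ⟨(1 / A) ^ (g.β - 1), by positivity, fun ξ hξ => ?_⟩
  rw [← Real.mul_rpow (by positivity) hξ, g.β_sub_one, one_div_mul_eq_div]
  have h := g.root_mul_eval ξ
  rw [abs_of_nonneg hξ] at h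
  have h0 := g.root_nonneg ξ
  have hev : g.eval (g.root ξ) ≤ A * (max 1 (g.root ξ)) ^ g.deg := by
    rw [eval, hA, Finset.sum_mul]
    refine Finset.sum_le_sum fun i _ => mul_le_mul_of_nonneg_left ?_ (g.a_nonneg i)
    calc g.root ξ ^ g.α i ≤ (max 1 (g.root ξ)) ^ g.α i :=
          Real.rpow_le_rpow h0 (le_max_right _ _) (g.α_nonneg i)
      _ ≤ _ := Real.rpow_le_rpow_of_exponent_le (le_max_left _ _)
          (g.α_strictMono.monotone (Fin.le_last i))
  have hm0 : (0 : ℝ) ≤ max 1 (g.root ξ) := le_trans zero_le_one (le_max_left _ _)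
  have h1 : ξ / A ≤ (max 1 (g.root ξ)) ^ (g.deg + 1) := by
    rw [div_le_iff₀ hApos, Real.rpow_add_one' hm0 (by linarith)]
    calc ξ = g.root ξ * g.eval (g.root ξ) := h.symm
      _ ≤ max 1 (g.root ξ) * (A * (max 1 (g.root ξ)) ^ g.deg) :=
          mul_le_mul (le_max_right _ _) hev (g.eval_pos h0).le hm0
      _ = _ := by ring
  have h2 : (ξ / A) ^ (1 / (g.deg + 1)) ≤ max 1 (g.root ξ) := by
    calc (ξ / A) ^ (1 / (g.deg + 1)) ≤ ((max 1 (g.root ξ)) ^ (g.deg + 1)) ^ (1 / (g.deg + 1)) :=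
          Real.rpow_le_rpow (by positivity) h1 (by positivity)
      _ = _ := by rw [← Real.rpow_mul hm0, mul_one_div_cancel (by linarith), Real.rpow_one]
  have h3 : max 1 (g.root ξ) ≤ 1 + g.root ξ := max_le (by linarith) (by linarith)
  linarith

/-- The primitive of `root`; its composition with the norm is a potential of `v ↦ K(|v|) v`. -/
noncomputable def potential (ξ : ℝ) : ℝ := ∫ s in (0 : ℝ)..ξ, g.root s

/-- Convexity of the primitive of a monotone function: `root y` is a subgradient at `y`. -/
lemma root_mul_sub_le {x y : ℝ} (hx : 0 ≤ x) (hy : 0 ≤ y) :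
    g.root y * (x - y) ≤ g.potential x - g.potential y := by
  have hi : ∀ a b, IntervalIntegrable g.root volume a b :=
    fun a b => g.continuous_root.intervalIntegrable a b
  rw [potential, potential, intervalIntegral.integral_interval_sub_left (hi _ _) (hi _ _)]
  rcases le_total y x with h | h
  · have := intervalIntegral.integral_mono_on (f := fun _ => g.root y) (g := g.root) h
      (by simp) (hi _ _) (fun s hs => g.root_le_root hy hs.1)
    simp only [intervalIntegral.integral_const, smul_eq_mul] at this
    linarith
  · have := intervalIntegral.integral_mono_on (f := g.root) (g := fun _ => g.root y) h
      (hi _ _) (by simp) (fun s hs => g.root_le_root (hx.trans hs.1) hs.2)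
    simp only [intervalIntegral.integral_const, smul_eq_mul] at this
    rw [intervalIntegral.integral_symm]
    linarith

lemma potential_zero : g.potential 0 = 0 := by simp [potential]

lemma potential_le {x : ℝ} (hx : 0 ≤ x) : g.potential x ≤ g.root x * x := by
  have := g.root_mul_sub_le le_rfl hx
  rw [potential_zero] at this
  linarith

lemma potential_nonneg {x : ℝ} (hx : 0 ≤ x) : 0 ≤ g.potential x := by
  have := g.root_mul_sub_le hx le_rfl
  rw [potential_zero, root_zero] at this
  linarith

lemma continuous_potential : Continuous g.potential :=
  intervalIntegral.continuous_primitive (fun a b => g.continuous_root.intervalIntegrable a b) 0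

lemma exists_potential_le : ∃ C > 0, ∀ ξ, 0 ≤ ξ → g.potential ξ ≤ C * ξ ^ g.β := by
  obtain ⟨C, hC, h⟩ := g.exists_root_le
  refine ⟨C, hC, fun ξ hξ => (g.potential_le hξ).trans ?_⟩
  have h1 := mul_le_mul_of_nonneg_right (h ξ hξ) hξ
  have h2 : ξ ^ g.β = ξ ^ (g.β - 1) * ξ := by
    rw [← Real.rpow_add_one' hξ (by linarith [g.one_lt_β]), sub_add_cancel]
  rw [h2]
  linarith

/-- Young's inequality in the form `M s ≤ ε s^β + C M^λ`. -/
lemma exists_young {ε : ℝ} (hε : 0 < ε) :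
    ∃ C > 0, ∀ M s : ℝ, 0 ≤ M → 0 ≤ s → M * s ≤ ε * s ^ g.β + C * M ^ g.conjExp := by
  have hβ := g.β_pos
  have hβ1 := g.one_lt_β
  have hq : 0 < g.conjExp := by linarith [g.two_le_conjExp]
  set η := ε ^ (1 / g.β) with hη
  have hηpos : 0 < η := Real.rpow_pos_of_pos hε _
  refine ⟨(1 / η) ^ g.conjExp, by positivity, fun M s hM hs => ?_⟩
  have h1 := Real.young_inequality_of_nonneg (mul_nonneg hηpos.le hs)
    (mul_nonneg (one_div_pos.2 hηpos).le hM) g.holderConjugate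
  have h2 : η * s * (1 / η * M) = M * s := by field_simp
  have h3 : η ^ g.β = ε := by
    rw [hη, ← Real.rpow_mul hε.le, one_div_mul_cancel hβ.ne', Real.rpow_one]
  rw [h2, Real.mul_rpow hηpos.le hs, Real.mul_rpow (by positivity) hM, h3] at h1
  refine h1.trans (add_le_add ?_ ?_)
  · exact div_le_self (by positivity) hβ1.le
  · exact div_le_self (by positivity) (by linarith [g.two_le_conjExp])

/-- The subgradient inequality at `ξ / 2` gives `P(ξ) ≥ s(ξ/2) ξ/2`; the lower growth bound for `s`
then leaves a linear loss, which Young's inequality absorbs. -/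
lemma exists_le_potential : ∃ c > 0, ∃ C > 0, ∀ ξ, 0 ≤ ξ → c * ξ ^ g.β - C ≤ g.potential ξ := by
  obtain ⟨c, hc, h⟩ := g.exists_le_root
  have hβ := g.β_pos
  have h2β : (0 : ℝ) < 2 ^ g.β := by positivity
  obtain ⟨C, hC, hy⟩ := g.exists_young (ε := c / 2) (by positivity)
  refine ⟨c / 2 / 2 ^ g.β, by positivity, C, hC, fun ξ hξ => ?_⟩
  have hξ2 : 0 ≤ ξ / 2 := by positivity
  have h1 := g.root_mul_sub_le hξ hξ2
  have h2 := g.potential_nonneg hξ2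
  have h3 := mul_le_mul_of_nonneg_right (h _ hξ2) hξ2
  have h4 : (ξ / 2) ^ g.β = (ξ / 2) ^ (g.β - 1) * (ξ / 2) := by
    rw [← Real.rpow_add_one' hξ2 (by linarith [g.one_lt_β]), sub_add_cancel]
  have h5 := hy 1 (ξ / 2) zero_le_one hξ2
  have h6 : c / 2 / 2 ^ g.β * ξ ^ g.β = c / 2 * (ξ / 2) ^ g.β := by
    rw [Real.div_rpow hξ (by norm_num)]; ring
  rw [Real.one_rpow] at h5
  rw [h6]
  nlinarith

/-- `β ≤ 2` means `2 (β - 1) ≤ β`. This is why the momentum lies in `L²` although the gradient is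
only controlled in `L^β`. -/
lemma exists_root_sq_le : ∃ C > 0, ∀ ξ, 0 ≤ ξ → g.root ξ ^ 2 ≤ C * (1 + ξ ^ g.β) := by
  obtain ⟨C, hC, h⟩ := g.exists_root_le
  refine ⟨C ^ 2, by positivity, fun ξ hξ => ?_⟩
  have h1 : g.root ξ ^ 2 ≤ (C * ξ ^ (g.β - 1)) ^ 2 :=
    pow_le_pow_left₀ (g.root_nonneg ξ) (h ξ hξ) 2
  have h2 : (ξ ^ (g.β - 1)) ^ 2 ≤ 1 + ξ ^ g.β := by
    rw [← Real.rpow_natCast, ← Real.rpow_mul hξ]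
    have hb := g.β_lt_two
    have hb1 := g.one_lt_β
    push_cast
    rcases le_total ξ 1 with h | h
    · have := Real.rpow_le_one hξ h (z := (g.β - 1) * 2) (by linarith)
      have := Real.rpow_nonneg hξ g.β
      linarith
    · have := Real.rpow_le_rpow_of_exponent_le h (x := ξ) (y := (g.β - 1) * 2) (z := g.β)
        (by linarith)
      linarith
  rw [mul_pow] at h1
  exact h1.trans (mul_le_mul_of_nonneg_left h2 (by positivity))

section Vector
variable {E : Type*} [NormedAddCommGroup E] [InnerProductSpace ℝ E]

/-- The flux `K(|v|) v`. -/
noncomputable def flux (v : E) : E := g.K ‖v‖ • v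

lemma continuous_flux : Continuous (g.flux : E → E) :=
  (g.continuous_K.comp continuous_norm).smul continuous_id

lemma norm_flux (v : E) : ‖g.flux v‖ = g.root ‖v‖ := by
  rw [flux, norm_smul, Real.norm_of_nonneg (g.K_nonneg _), g.K_mul (norm_nonneg v)]

lemma norm_flux_le (v : E) : ‖g.flux v‖ ≤ ‖v‖ / g.a 0 := by
  rw [flux, norm_smul, Real.norm_of_nonneg (g.K_nonneg _)]
  have := mul_le_mul_of_nonneg_right (g.K_le ‖v‖) (norm_nonneg v)
  linarith [one_div_mul_eq_div (g.a 0) ‖v‖]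

lemma inner_flux_self (v : E) : inner ℝ (g.flux v) v = g.root ‖v‖ * ‖v‖ := by
  rw [flux, real_inner_smul_left, real_inner_self_eq_norm_sq, ← g.K_mul (norm_nonneg v)]
  ring

/-- Convexity of `v ↦ P(|v|)` with gradient `flux`; Cauchy–Schwarz reduces it to the scalar
subgradient inequality. -/
lemma inner_flux_sub_le (v w : E) :
    inner ℝ (g.flux w) (v - w) ≤ g.potential ‖v‖ - g.potential ‖w‖ := by
  have h1 := g.root_mul_sub_le (norm_nonneg v) (norm_nonneg w)
  have h2 : inner ℝ (g.flux w) v ≤ g.root ‖w‖ * ‖v‖ := by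
    rw [← g.norm_flux w]
    exact real_inner_le_norm _ _
  rw [inner_sub_right, g.inner_flux_self]
  linarith

end Vector
end ForchheimerPoly

/-! ### Convex functions along absolutely continuous curves -/

lemma absolutelyContinuousOnInterval_of_dist_le {ι : Type*} [Fintype ι] {c : ι → ℝ → ℝ}
    {f : ℝ → ℝ} {a b M : ℝ} (hc : ∀ i, AbsolutelyContinuousOnInterval (c i) a b)
    (hf : ∀ x ∈ uIcc a b, ∀ y ∈ uIcc a b, dist (f x) (f y) ≤ M * ∑ i, dist (c i x) (c i y)) :
    AbsolutelyContinuousOnInterval f a b := by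
  have h1 := (tendsto_finsetSum Finset.univ fun i _ => hc i).const_mul M
  simp only [Finset.sum_const_zero, mul_zero] at h1
  refine squeeze_zero' (Filter.Eventually.of_forall fun E =>
    Finset.sum_nonneg fun i _ => dist_nonneg) ?_ h1
  rw [Filter.eventually_inf_principal]
  refine Filter.Eventually.of_forall fun E hE => ?_
  rw [Finset.sum_comm, Finset.mul_sum]
  exact Finset.sum_le_sum fun i hi => hf _ (hE.1 i hi).1 _ (hE.1 i hi).2

section Subgradient
variable {ι : Type*} [Fintype ι] {F : (ι → ℝ) → ℝ} {A : (ι → ℝ) → ι → ℝ}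

/-- The remainder is nonnegative by the inequality at `w`, and the inequality at `v` bounds it by
`(A v - A w) · (v - w)`. Continuity of `A` therefore makes `A` the gradient of `F`. -/
lemma abs_sub_sub_le_of_subgradient
    (h : ∀ v w, ∑ j, A w j * (v j - w j) ≤ F v - F w) (v w : ι → ℝ) :
    |F v - F w - ∑ j, A w j * (v j - w j)| ≤ (∑ j, |A v j - A w j|) * ‖v - w‖ := by
  have h1 := h v w
  have h2 := h w v
  have h3 : F v - F w - ∑ j, A w j * (v j - w j) ≤ ∑ j, (A v j - A w j) * (v j - w j) := by
    have : ∑ j, (A v j - A w j) * (v j - w j) =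
        - (∑ j, A v j * (w j - v j)) - ∑ j, A w j * (v j - w j) := by
      rw [← Finset.sum_neg_distrib, ← Finset.sum_sub_distrib]
      exact Finset.sum_congr rfl fun j _ => by ring
    linarith
  rw [abs_of_nonneg (by linarith), Finset.sum_mul]
  refine h3.trans (Finset.sum_le_sum fun j _ => ?_)
  calc (A v j - A w j) * (v j - w j) ≤ |A v j - A w j| * |v j - w j| := by
        rw [← abs_mul]; exact le_abs_self _
    _ ≤ _ := by gcongr; exact norm_le_pi_norm (v - w) j

lemma hasFDerivAt_of_subgradient (h : ∀ v w, ∑ j, A w j * (v j - w j) ≤ F v - F w)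
    (hA : Continuous A) (w : ι → ℝ) :
    HasFDerivAt F (∑ j, A w j • ContinuousLinearMap.proj (R := ℝ) (φ := fun _ : ι => ℝ) j) w := by
  rw [hasFDerivAt_iff_isLittleO, Asymptotics.isLittleO_iff]
  intro ε hε
  have h1 : Filter.Tendsto (fun v => ∑ j, |A v j - A w j|) (nhds w) (nhds 0) := by
    have hc : Continuous fun v => ∑ j, |A v j - A w j| :=
      continuous_finsetSum _ fun j _ =>
        (((continuous_apply j).comp hA).sub continuous_const).abs
    simpa using hc.tendsto w
  filter_upwards [h1.eventually (eventually_le_nhds hε)] with v hv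
  have h2 := abs_sub_sub_le_of_subgradient h v w
  have h3 : (∑ j, A w j • ContinuousLinearMap.proj (R := ℝ) (φ := fun _ : ι => ℝ) j) (v - w) =
      ∑ j, A w j * (v j - w j) := by
    simp
  rw [h3, Real.norm_eq_abs]
  exact h2.trans (mul_le_mul_of_nonneg_right hv (norm_nonneg _))

/-- The subgradient is bounded on the compact image of the curve, so increments of `F` along it are
bounded by those of the coordinates. -/
lemma absolutelyContinuous_comp_of_subgradient {c : ι → ℝ → ℝ} {a b : ℝ}
    (h : ∀ v w, ∑ j, A w j * (v j - w j) ≤ F v - F w) (hA : Continuous A)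
    (hc : ∀ i, AbsolutelyContinuousOnInterval (c i) a b) :
    AbsolutelyContinuousOnInterval (fun t => F fun i => c i t) a b := by
  have hcont : ContinuousOn (fun t i => c i t) (uIcc a b) :=
    continuousOn_pi.2 fun i => (hc i).continuousOn
  obtain ⟨M, hM⟩ := isCompact_uIcc.exists_bound_of_continuousOn (hA.comp_continuousOn hcont)
  have key : ∀ x ∈ uIcc a b, ∀ y ∈ uIcc a b,
      |∑ j, A (fun i => c i x) j * (c j x - c j y)| ≤ M * ∑ j, dist (c j x) (c j y) := by
    intro x hx y hy
    rw [Finset.mul_sum]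
    refine (Finset.abs_sum_le_sum_abs _ _).trans (Finset.sum_le_sum fun j _ => ?_)
    rw [abs_mul, Real.dist_eq]
    exact mul_le_mul_of_nonneg_right ((norm_le_pi_norm (A fun i => c i x) j).trans (hM x hx))
      (abs_nonneg _)
  refine absolutelyContinuousOnInterval_of_dist_le (M := M) hc fun x hx y hy => ?_
  have h1 := h (fun i => c i x) (fun i => c i y)
  have h2 := h (fun i => c i y) (fun i => c i x)
  have h3 := abs_le.1 (key x hx y hy)
  have h4 := abs_le.1 (key y hy x hx)
  have h5 : ∑ j, dist (c j y) (c j x) = ∑ j, dist (c j x) (c j y) :=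
    Finset.sum_congr rfl fun j _ => dist_comm _ _
  have h6 : ∑ j, A (fun i => c i x) j * (c j y - c j x) =
      -∑ j, A (fun i => c i x) j * (c j x - c j y) := by
    rw [← Finset.sum_neg_distrib]
    exact Finset.sum_congr rfl fun j _ => by ring
  have h7 : ∑ j, A (fun i => c i y) j * (c j x - c j y) =
      -∑ j, A (fun i => c i y) j * (c j y - c j x) := by
    rw [← Finset.sum_neg_distrib]
    exact Finset.sum_congr rfl fun j _ => by ring
  rw [h7] at h1
  rw [h5] at h4
  rw [h6] at h2
  rw [Real.dist_eq, abs_le]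
  constructor <;> linarith [h3.1, h3.2, h4.1, h4.2]

lemma hasDerivAt_comp_of_subgradient {c : ι → ℝ → ℝ} {c' : ι → ℝ} {t : ℝ}
    (h : ∀ v w, ∑ j, A w j * (v j - w j) ≤ F v - F w) (hA : Continuous A)
    (hc : ∀ i, HasDerivAt (c i) (c' i) t) :
    HasDerivAt (fun t => F fun i => c i t) (∑ j, A (fun i => c i t) j * c' j) t := by
  have h1 : HasDerivAt (fun t i => c i t) c' t := hasDerivAt_pi.2 hc
  have := (hasFDerivAt_of_subgradient h hA (fun i => c i t)).comp_hasDerivAt t h1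
  have h2 : (∑ j, A (fun i => c i t) j •
      ContinuousLinearMap.proj (R := ℝ) (φ := fun _ : ι => ℝ) j) c' =
        ∑ j, A (fun i => c i t) j * c' j := by
    simp
  rw [← h2]
  exact this

end Subgradient

/-! ### Coordinates in the density space -/

/-- A linearly independent subset spanning all the evaluation functionals is finite, and what it
annihilates is annihilated by every evaluation. -/
lemma exists_finset_unisolvent {P X : Type*} [AddCommGroup P] [Module ℝ P]
    [FiniteDimensional ℝ P] (ev : X → P →ₗ[ℝ] ℝ) (S : Set X) :
    ∃ X₀ : Finset X, (X₀ : Set X) ⊆ S ∧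
      ∀ p : P, (∀ x ∈ X₀, ev x p = 0) → ∀ x ∈ S, ev x p = 0 := by
  obtain ⟨b, hbS, hspan, hli⟩ := exists_linearIndependent ℝ (ev '' S)
  have hbfin : b.Finite := hli.setFinite
  classical
  obtain ⟨Y, hYS, hY⟩ := (Finset.subset_set_image_iff (f := ev) (t := hbfin.toFinset)).1
    (by simpa using hbS)
  refine ⟨Y, hYS, fun p hp x hx => ?_⟩
  have hle : Submodule.span ℝ (ev '' S) ≤
      LinearMap.ker (LinearMap.applyₗ (R := ℝ) (M₂ := ℝ) p) := by
    rw [← hspan, Submodule.span_le]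
    intro φ hφ
    have : φ ∈ Y.image ev := by rw [hY]; simpa using hφ
    obtain ⟨y, hy, rfl⟩ := Finset.mem_image.1 this
    exact hp y hy
  exact hle (Submodule.subset_span (mem_image_of_mem ev hx))

variable {d k : ℕ} {Ω : Set (Space d)} {𝒯 : Geometry.SimplicialComplex ℝ (Space d)}

lemma exists_unisolvent_on (S : Set (Space d)) (k : ℕ) :
    ∃ X₀ : Finset (Space d), (X₀ : Set (Space d)) ⊆ S ∧
      ∀ u : Space d → ℝ, IsPolyOn k S u → (∀ x ∈ X₀, u x = 0) → ∀ x ∈ S, u x = 0 := by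
  obtain ⟨X₀, hX, h⟩ := exists_finset_unisolvent
    (P := MvPolynomial.restrictTotalDegree (Fin d) ℝ k)
    (fun x : Space d => (MvPolynomial.aeval (fun i => x i)).toLinearMap.comp
      (Submodule.subtype _)) S
  refine ⟨X₀, hX, ?_⟩
  rintro u ⟨p, hp, hup⟩ h0 x hx
  have := h ⟨p, (MvPolynomial.mem_restrictTotalDegree _ _ _).2 hp⟩ (fun y hy => by
    have := h0 y hy
    rw [hup y (hX hy)] at this
    simpa [MvPolynomial.aeval_def, MvPolynomial.eval₂_eq_eval_map] using this) x hx
  rw [hup x hx]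
  simpa using this

/-- The density space as a vector space of functions. -/
def densitySubmodule (𝒯 : Geometry.SimplicialComplex ℝ (Space d)) (k : ℕ) :
    Submodule ℝ (Space d → ℝ) where
  carrier := densitySpace 𝒯 k
  add_mem' hu hv := fun S hS => (hu S hS).add (hv S hS)
  zero_mem' := fun _ _ => ⟨0, by simp, fun _ _ => by simp⟩
  smul_mem' c _ hu := fun S hS => (hu S hS).const_mul c

/-- Every discrete density is determined by its values at finitely many points. -/
lemma IsTriangulation.exists_nodal_basis (hT : IsTriangulation Ω 𝒯) (hΩ : IsOpen Ω) (k : ℕ) :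
    ∃ X₀ : Finset (Space d), (∀ j : X₀, (j : Space d) ∈ closure Ω) ∧
      ∃ r : X₀ → Space d → ℝ, (∀ j, r j ∈ densitySpace 𝒯 k) ∧
        ∀ u ∈ densitySpace 𝒯 k, ∀ x ∈ closure Ω, u x = ∑ j : X₀, u j * r j x := by
  classical
  choose X hXS hX using fun s : Finset (Space d) =>
    exists_unisolvent_on (convexHull ℝ (s : Set (Space d))) k
  set X₀ := (elts 𝒯).biUnion X with hX₀
  have hzero : ∀ u ∈ densitySpace 𝒯 k, (∀ x ∈ X₀, u x = 0) → ∀ x ∈ closure Ω, u x = 0 := by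
    intro u hu h0 x hx
    rw [← hT.iUnion_simplex hΩ] at hx
    simp only [mem_iUnion] at hx
    obtain ⟨s, hs, hxs⟩ := hx
    exact hX s u (hT.mem_densitySpace_iff.1 hu s hs)
      (fun y hy => h0 y (Finset.mem_biUnion.2 ⟨s, hs, hy⟩)) x hxs
  let E : densitySubmodule 𝒯 k →ₗ[ℝ] (X₀ → ℝ) :=
    { toFun := fun u j => u.1 j
      map_add' := fun _ _ => rfl
      map_smul' := fun _ _ => rfl }
  -- The nodes may be redundant, and functions are arbitrary off the mesh, so nodal evaluation `E`
  -- need be neither surjective nor injective. `σ` is a section over its range and `π` a projection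
  -- onto that range.
  obtain ⟨σ, hσ⟩ := E.rangeRestrict.exists_rightInverse_of_surjective E.range_rangeRestrict
  obtain ⟨π, hπ⟩ := (LinearMap.range E).subtype.exists_leftInverse_of_injective
    (Submodule.ker_subtype _)
  have hEσ : ∀ u, E (σ (π (E u))) = E u := by
    intro u
    have h1 : π (E u) = E.rangeRestrict u := LinearMap.congr_fun hπ (E.rangeRestrict u)
    rw [h1]
    exact congrArg Subtype.val (LinearMap.congr_fun hσ (E.rangeRestrict u))
  refine ⟨X₀, ?_, fun j => (σ (π (Pi.single j 1))).1, fun j => (σ (π (Pi.single j 1))).2, ?_⟩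
  · rintro ⟨j, hj⟩
    obtain ⟨s, hs, hjs⟩ := Finset.mem_biUnion.1 hj
    exact hT.simplex_subset_closure hs (hXS s hjs)
  · intro u hu x hx
    set U : densitySubmodule 𝒯 k := ⟨u, hu⟩ with hU
    have h1 := hzero (U - σ (π (E U)) : densitySubmodule 𝒯 k).1 (U - σ (π (E U))).2 (by
      intro y hy
      have := congrFun (hEσ U) ⟨y, hy⟩
      change u y - (σ (π (E U))).1 y = 0
      have h2 : (σ (π (E U))).1 y = u y := this
      rw [h2, sub_self]) x hx
    have h3 : E U = ∑ j : X₀, u j • Pi.single j (1 : ℝ) := by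
      rw [pi_eq_sum_univ' (E U)]
      exact Finset.sum_congr rfl fun j _ => by
        ext i; simp [Pi.single_apply, E, hU, eq_comm]
    have h4 : (σ (π (E U))).1 x = ∑ j : X₀, u j * (σ (π (Pi.single j 1))).1 x := by
      rw [h3]
      simp only [map_sum, map_smul, Submodule.coe_sum, Submodule.coe_smul, Finset.sum_apply,
        Pi.smul_apply, smul_eq_mul]
    have h5 : u x - (σ (π (E U))).1 x = 0 := h1
    rw [← h4]
    linarith

/-! ### Convex integral functionals along absolutely continuous curves -/

section Functional
variable {X E : Type*} [MeasurableSpace X] {μ : Measure X} [IsFiniteMeasure μ]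
  [NormedAddCommGroup E] [ProperSpace E] {G : X → E} {B : ℝ}

lemma integrable_comp_of_bounded (hG : AEStronglyMeasurable G μ) (hB : ∀ᵐ x ∂μ, ‖G x‖ ≤ B)
    {h : E → ℝ} (hh : Continuous h) : Integrable (fun x => h (G x)) μ := by
  obtain ⟨C, hC⟩ := (isCompact_closedBall (0 : E) B).exists_bound_of_continuousOn hh.continuousOn
  refine Integrable.of_bound (hh.comp_aestronglyMeasurable hG) C ?_
  filter_upwards [hB] with x hx
  exact hC _ (mem_closedBall_zero_iff.2 hx)

lemma continuous_integral_comp_of_bounded {P : Type*} [NormedAddCommGroup P] [ProperSpace P]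
    (hG : AEStronglyMeasurable G μ) (hB : ∀ᵐ x ∂μ, ‖G x‖ ≤ B)
    {h : P → E → ℝ} (hh : Continuous fun q : P × E => h q.1 q.2) :
    Continuous fun c => ∫ x, h c (G x) ∂μ := by
  refine continuous_iff_continuousAt.2 fun c₀ => ?_
  obtain ⟨C, hC⟩ := ((isCompact_closedBall c₀ 1).prod
    (isCompact_closedBall (0 : E) B)).exists_bound_of_continuousOn hh.continuousOn
  refine continuousAt_of_dominated (bound := fun _ => C) ?_ ?_ (integrable_const _) ?_
  · refine Filter.Eventually.of_forall fun c => ?_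
    have : Continuous (h c) := hh.comp (Continuous.prodMk_right c)
    exact this.comp_aestronglyMeasurable hG
  · filter_upwards [Metric.closedBall_mem_nhds c₀ one_pos] with c hc
    filter_upwards [hB] with x hx
    exact hC (c, G x) ⟨hc, mem_closedBall_zero_iff.2 hx⟩
  · refine Filter.Eventually.of_forall fun x => ?_
    have : Continuous fun c => h c (G x) := hh.comp (Continuous.prodMk_left (G x))
    exact this.continuousAt

/-- The pointwise subgradient inequality integrates to one for the functional of the coefficients,
whose subgradient is continuous by dominated convergence; the finite-dimensional chain rule then
applies. -/
lemma energy_along_curve {ι : Type*} [Fintype ι] (hG : AEStronglyMeasurable G μ)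
    (hB : ∀ᵐ x ∂μ, ‖G x‖ ≤ B) {f : (ι → ℝ) → E → ℝ} {a : ι → (ι → ℝ) → E → ℝ}
    (hf : Continuous fun q : (ι → ℝ) × E => f q.1 q.2)
    (ha : ∀ j, Continuous fun q : (ι → ℝ) × E => a j q.1 q.2)
    (hsub : ∀ v w y, ∑ j, a j w y * (v j - w j) ≤ f v y - f w y) {c : ι → ℝ → ℝ} {t₀ t₁ : ℝ}
    (hc : ∀ i, AbsolutelyContinuousOnInterval (c i) t₀ t₁) :
    AbsolutelyContinuousOnInterval (fun t => ∫ x, f (fun i => c i t) (G x) ∂μ) t₀ t₁ ∧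
      ∀ (t : ℝ) (c' : ι → ℝ), (∀ i, HasDerivAt (c i) (c' i) t) →
        HasDerivAt (fun t => ∫ x, f (fun i => c i t) (G x) ∂μ)
          (∫ x, ∑ j, a j (fun i => c i t) (G x) * c' j ∂μ) t := by
  have hcf : ∀ v, Continuous (f v) := fun v => hf.comp (Continuous.prodMk_right v)
  have hca : ∀ j v, Continuous (a j v) := fun j v => (ha j).comp (Continuous.prodMk_right v)
  have hif : ∀ v, Integrable (fun x => f v (G x)) μ :=
    fun v => integrable_comp_of_bounded hG hB (hcf v)
  have hia : ∀ j v, Integrable (fun x => a j v (G x)) μ :=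
    fun j v => integrable_comp_of_bounded hG hB (hca j v)
  have hsum : ∀ w e : ι → ℝ, ∫ x, ∑ j, a j w (G x) * e j ∂μ =
      ∑ j, (∫ x, a j w (G x) ∂μ) * e j := by
    intro w e
    rw [integral_finsetSum _ fun j _ => (hia j w).mul_const _]
    exact Finset.sum_congr rfl fun j _ => integral_mul_const _ _
  have hA : Continuous fun (w : ι → ℝ) (j : ι) => ∫ x, a j w (G x) ∂μ :=
    continuous_pi fun j => continuous_integral_comp_of_bounded hG hB (ha j)
  have hsub' : ∀ v w : ι → ℝ, ∑ j, (∫ x, a j w (G x) ∂μ) * (v j - w j) ≤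
      (∫ x, f v (G x) ∂μ) - ∫ x, f w (G x) ∂μ := by
    intro v w
    rw [← hsum w fun j => v j - w j, ← integral_sub (hif v) (hif w)]
    exact integral_mono (integrable_finsetSum _ fun j _ => (hia j w).mul_const _)
      ((hif v).sub (hif w)) fun x => hsub v w (G x)
  refine ⟨absolutelyContinuous_comp_of_subgradient (F := fun v => ∫ x, f v (G x) ∂μ)
    hsub' hA hc, fun t c' hc' => ?_⟩
  rw [hsum]
  exact hasDerivAt_comp_of_subgradient (F := fun v => ∫ x, f v (G x) ∂μ) hsub' hA hc'

end Functional

lemma absolutelyContinuousOnInterval_congr {f g : ℝ → ℝ} {a b : ℝ}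
    (hg : AbsolutelyContinuousOnInterval g a b) (h : ∀ x ∈ uIcc a b, f x = g x) :
    AbsolutelyContinuousOnInterval f a b :=
  absolutelyContinuousOnInterval_of_dist_le (ι := Unit) (c := fun _ => g) (M := 1) (fun _ => hg)
    fun x hx y hy => by simp [h x hx, h y hy]

variable {d k : ℕ} {Ω : Set (Space d)} {𝒯 : Geometry.SimplicialComplex ℝ (Space d)}

/-! ### Discrete functions -/

lemma IsTriangulation.exists_bound (hT : IsTriangulation Ω 𝒯) (hΩ : IsBoundedLipschitz Ω)
    {r : Space d → ℝ} (hr : r ∈ densitySpace 𝒯 k) :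
    ∃ B : ℝ, 0 ≤ B ∧ ∀ x ∈ closure Ω, |r x| ≤ B := by
  obtain ⟨B, hB⟩ := hΩ.isBounded.isCompact_closure.exists_bound_of_continuousOn
    (hT.continuousOn hΩ.isOpen hr)
  exact ⟨max B 0, le_max_right _ _, fun x hx => (hB x hx).trans (le_max_left _ _)⟩

lemma IsTriangulation.aestronglyMeasurable (hT : IsTriangulation Ω 𝒯)
    (hΩ : IsBoundedLipschitz Ω) {r : Space d → ℝ} (hr : r ∈ densitySpace 𝒯 k) :
    AEStronglyMeasurable r (volume.restrict Ω) :=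
  ((hT.continuousOn hΩ.isOpen hr).mono subset_closure).aestronglyMeasurable
    hΩ.isOpen.measurableSet

lemma IsTriangulation.memLp (hT : IsTriangulation Ω 𝒯) (hΩ : IsBoundedLipschitz Ω)
    {r : Space d → ℝ} (hr : r ∈ densitySpace 𝒯 k) (p : ℝ≥0∞) :
    MemLp r p (volume.restrict Ω) := by
  obtain ⟨B, -, hB⟩ := hT.exists_bound hΩ hr
  have := hΩ.isFiniteMeasure
  refine MemLp.of_bound (hT.aestronglyMeasurable hΩ hr) B ?_
  exact (ae_restrict_iff' hΩ.isOpen.measurableSet).2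
    (Filter.Eventually.of_forall fun x hx => hB x (subset_closure hx))

lemma densitySpace_congr (hT : IsTriangulation Ω 𝒯) {u v : Space d → ℝ}
    (hv : v ∈ densitySpace 𝒯 k) (h : ∀ x ∈ closure Ω, u x = v x) : u ∈ densitySpace 𝒯 k := by
  refine hT.mem_densitySpace_iff.2 fun s hs => ?_
  obtain ⟨p, hp, hpv⟩ := hT.mem_densitySpace_iff.1 hv s hs
  exact ⟨p, hp, fun x hx => by rw [h x (hT.simplex_subset_closure hs hx), hpv x hx]⟩

lemma sum_mem_densitySpace {ι : Type*} (s : Finset ι) (c : ι → ℝ) {r : ι → Space d → ℝ}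
    (hr : ∀ j, r j ∈ densitySpace 𝒯 k) : (fun x => ∑ j ∈ s, c j * r j x) ∈ densitySpace 𝒯 k := by
  have h := (densitySubmodule 𝒯 k).sum_mem (t := s) (f := fun j => c j • r j)
    fun j _ => (densitySubmodule 𝒯 k).smul_mem (c j) (hr j)
  have h2 : (fun x => ∑ j ∈ s, c j * r j x) = ∑ j ∈ s, c j • r j := by
    ext x; simp
  rw [h2]
  exact h

/-- The exceptional set depends only on the mesh, so one null set serves all coefficients, in
particular those at all times. -/
lemma ae_gradient_sum (hT : IsTriangulation Ω 𝒯) (hΩ : IsBoundedLipschitz Ω) {ι : Type*}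
    [Fintype ι] {r : ι → Space d → ℝ} (hr : ∀ j, r j ∈ densitySpace 𝒯 k) :
    ∀ᵐ x ∂volume.restrict Ω, ∀ (c : ι → ℝ) (u : Space d → ℝ),
      (∀ x ∈ Ω, u x = ∑ j, c j * r j x) → gradient u x = ∑ j, c j • gradient (r j) x := by
  filter_upwards [hT.ae_differentiableAt hΩ, ae_restrict_mem hΩ.isOpen.measurableSet]
    with x hx hxΩ c u hu
  have h1 : fderiv ℝ u x = fderiv ℝ (fun x => ∑ j, c j * r j x) x := by
    refine Filter.EventuallyEq.fderiv_eq ?_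
    filter_upwards [hΩ.isOpen.mem_nhds hxΩ] with y hy
    exact hu y hy
  rw [gradient, h1, fderiv_fun_sum fun j _ => (hx k _ (hr j)).const_mul (c j), map_sum]
  refine Finset.sum_congr rfl fun j _ => ?_
  rw [fderiv_const_mul (hx k _ (hr j)), map_smul]
  rfl

variable {d k : ℕ} {Ω : Set (Space d)} {𝒯 : Geometry.SimplicialComplex ℝ (Space d)}

/-! ### The energies of a discrete density -/

/-- Absolute continuity at each single point becomes absolute continuity of finitely many nodal
coefficients, which provides one null set of times valid for all points. -/
lemma exists_coordinates (hT : IsTriangulation Ω 𝒯) (hΩ : IsOpen Ω) {T : ℝ} (hT0 : 0 < T)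
    {ρ : ℝ → Space d → ℝ} (hρ : ∀ t ∈ Icc 0 T, ρ t ∈ densitySpace 𝒯 k)
    (hac : ∀ x ∈ closure Ω, AbsolutelyContinuousOnInterval (fun t => ρ t x) 0 T) :
    ∃ (X₀ : Finset (Space d)) (r : X₀ → Space d → ℝ), (∀ j, r j ∈ densitySpace 𝒯 k) ∧
      (∀ j : X₀, AbsolutelyContinuousOnInterval (fun t => ρ t j) 0 T) ∧
      (∀ t ∈ Icc 0 T, ∀ x ∈ closure Ω, ρ t x = ∑ j : X₀, ρ t j * r j x) ∧
      ∀ᵐ t ∂volume.restrict (Ioo 0 T),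
        (∀ j : X₀, HasDerivAt (fun s => ρ s j) (timeDeriv ρ t j) t) ∧
        (∀ x ∈ closure Ω, timeDeriv ρ t x = ∑ j : X₀, timeDeriv ρ t j * r j x) := by
  obtain ⟨X₀, hX₀, r, hr, hrep⟩ := hT.exists_nodal_basis hΩ k
  refine ⟨X₀, r, hr, fun j => hac _ (hX₀ j), fun t ht => hrep _ (hρ t ht), ?_⟩
  have hae : ∀ᵐ t : ℝ, ∀ j : X₀, t ∈ uIcc 0 T → DifferentiableAt ℝ (fun s => ρ s j) t :=
    ae_all_iff.2 fun j => (hac _ (hX₀ j)).ae_differentiableAt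
  rw [ae_restrict_iff' measurableSet_Ioo]
  filter_upwards [hae] with t ht htI
  have htu : t ∈ uIcc 0 T := by rw [uIcc_of_le hT0.le]; exact Ioo_subset_Icc_self htI
  have hder : ∀ j : X₀, HasDerivAt (fun s => ρ s j) (timeDeriv ρ t j) t :=
    fun j => (ht j htu).hasDerivAt
  refine ⟨hder, fun x hx => ?_⟩
  have h1 : HasDerivAt (fun s => ∑ j : X₀, ρ s j * r j x) (∑ j : X₀, timeDeriv ρ t j * r j x) t :=
    HasDerivAt.fun_sum fun j _ => (hder j).mul_const _
  have h2 : (fun s => ρ s x) =ᶠ[nhds t] fun s => ∑ j : X₀, ρ s j * r j x := by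
    filter_upwards [Ioo_mem_nhds htI.1 htI.2] with s hs
    exact hrep _ (hρ s (Ioo_subset_Icc_self hs)) x hx
  exact (h1.congr_of_eventuallyEq h2).deriv

lemma ae_timeDeriv_mem (hT : IsTriangulation Ω 𝒯) (hΩ : IsOpen Ω) {T : ℝ} (hT0 : 0 < T)
    {ρ : ℝ → Space d → ℝ} (hρ : ∀ t ∈ Icc 0 T, ρ t ∈ densitySpace 𝒯 k)
    (hac : ∀ x ∈ closure Ω, AbsolutelyContinuousOnInterval (fun t => ρ t x) 0 T) :
    ∀ᵐ t ∂volume.restrict (Ioo 0 T), timeDeriv ρ t ∈ densitySpace 𝒯 k := by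
  obtain ⟨X₀, r, hr, -, -, hae⟩ := exists_coordinates hT hΩ hT0 hρ hac
  filter_upwards [hae] with t ht
  exact densitySpace_congr hT (sum_mem_densitySpace Finset.univ _ hr) ht.2

/-- The weighted `L²` energy of a discrete density. -/
lemma quadratic_energy (hT : IsTriangulation Ω 𝒯) (hΩ : IsBoundedLipschitz Ω) {T : ℝ}
    (hT0 : 0 < T) {ρ : ℝ → Space d → ℝ} (hρ : ∀ t ∈ Icc 0 T, ρ t ∈ densitySpace 𝒯 k)
    (hac : ∀ x ∈ closure Ω, AbsolutelyContinuousOnInterval (fun t => ρ t x) 0 T)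
    {φ : Space d → ℝ} (hφm : AEStronglyMeasurable φ (volume.restrict Ω)) {B : ℝ}
    (hφ : ∀ x ∈ Ω, 0 ≤ φ x ∧ φ x ≤ B) :
    AbsolutelyContinuousOnInterval (fun t => ∫ x in Ω, 1 / 2 * φ x * ρ t x ^ 2) 0 T ∧
      ∀ᵐ t ∂volume.restrict (Ioo 0 T), HasDerivAt (fun t => ∫ x in Ω, 1 / 2 * φ x * ρ t x ^ 2)
        (∫ x in Ω, φ x * timeDeriv ρ t x * ρ t x) t := by
  obtain ⟨X₀, r, hr, hc, hrep, hae⟩ := exists_coordinates hT hΩ.isOpen hT0 hρ hac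
  have hfin := hΩ.isFiniteMeasure
  have hΩm := hΩ.isOpen.measurableSet
  choose C hC0 hC using fun j => hT.exists_bound hΩ (hr j)
  set G : Space d → ℝ × (X₀ → ℝ) := fun x => (φ x, fun j => r j x) with hG
  have hGm : AEStronglyMeasurable G (volume.restrict Ω) :=
    hφm.prodMk (aemeasurable_pi_lambda _ fun j =>
      (hT.aestronglyMeasurable hΩ (hr j)).aemeasurable).aestronglyMeasurable
  have hGB : ∀ᵐ x ∂volume.restrict Ω, ‖G x‖ ≤ B + ∑ j, C j := by
    refine (ae_restrict_iff' hΩm).2 (Filter.Eventually.of_forall fun x hx => ?_)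
    have hB0 : 0 ≤ B := (hφ x hx).1.trans (hφ x hx).2
    have hS0 : 0 ≤ ∑ j, C j := Finset.sum_nonneg fun j _ => hC0 j
    refine max_le ?_ ?_
    · rw [Real.norm_eq_abs, abs_of_nonneg (hφ x hx).1]
      linarith [(hφ x hx).2]
    · refine (pi_norm_le_iff_of_nonneg (by linarith)).2 fun j => ?_
      have h1 := hC j x (subset_closure hx)
      have h2 := Finset.single_le_sum (f := C) (fun j _ => hC0 j) (Finset.mem_univ j)
      exact (h1.trans h2).trans (by linarith)
  -- The absolute value makes the quadratic form convex for every parameter `y`, as required; on `Ω`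
  -- the weight `φ` is nonnegative and nothing changes.
  obtain ⟨h1, h2⟩ := energy_along_curve hGm hGB
    (f := fun v y => 1 / 2 * |y.1| * (∑ j, v j * y.2 j) ^ 2)
    (a := fun i v y => |y.1| * (∑ j, v j * y.2 j) * y.2 i) (by fun_prop) (fun j => by fun_prop)
    (fun v w y => by
      have e1 : ∀ W, ∑ j, |y.1| * W * y.2 j * (v j - w j) =
          |y.1| * W * ((∑ j, v j * y.2 j) - ∑ j, w j * y.2 j) := by
        intro W
        rw [← Finset.sum_sub_distrib, Finset.mul_sum]
        exact Finset.sum_congr rfl fun j _ => by ring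
      rw [e1]
      nlinarith [mul_nonneg (abs_nonneg y.1)
        (sq_nonneg ((∑ j, v j * y.2 j) - ∑ j, w j * y.2 j))]) hc
  have hint : ∀ t ∈ Icc 0 T, (∫ x in Ω, 1 / 2 * φ x * ρ t x ^ 2) =
      ∫ x in Ω, 1 / 2 * |(G x).1| * (∑ j : X₀, ρ t j * (G x).2 j) ^ 2 := by
    intro t ht
    refine setIntegral_congr_fun hΩm fun x hx => ?_
    simp only [hG]
    rw [abs_of_nonneg (hφ x hx).1, ← hrep t ht x (subset_closure hx)]
  refine ⟨absolutelyContinuousOnInterval_congr h1 fun t ht =>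
    hint t (by rwa [uIcc_of_le hT0.le] at ht), ?_⟩
  filter_upwards [hae, ae_restrict_mem measurableSet_Ioo] with t ht htI
  have h3 := h2 t _ ht.1
  have h4 : (∫ x in Ω, ∑ j, |(G x).1| * (∑ i : X₀, ρ t i * (G x).2 i) * (G x).2 j * timeDeriv ρ t j) =
      ∫ x in Ω, φ x * timeDeriv ρ t x * ρ t x := by
    refine setIntegral_congr_fun hΩm fun x hx => ?_
    have hx' := subset_closure hx
    simp only [hG]
    rw [abs_of_nonneg (hφ x hx).1, ← hrep t (Ioo_subset_Icc_self htI) x hx', ht.2 x hx',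
      Finset.mul_sum, Finset.sum_mul]
    exact Finset.sum_congr rfl fun j _ => by ring
  rw [← h4]
  refine h3.congr_of_eventuallyEq ?_
  filter_upwards [Ioo_mem_nhds htI.1 htI.2] with s hs
  exact hint s (Ioo_subset_Icc_self hs)

/-- The potential energy of the gradient of a discrete density. -/
lemma gradient_energy (hT : IsTriangulation Ω 𝒯) (hΩ : IsBoundedLipschitz Ω)
    (g : ForchheimerPoly) {T : ℝ}
    (hT0 : 0 < T) {ρ : ℝ → Space d → ℝ} (hρ : ∀ t ∈ Icc 0 T, ρ t ∈ densitySpace 𝒯 k)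
    (hac : ∀ x ∈ closure Ω, AbsolutelyContinuousOnInterval (fun t => ρ t x) 0 T) :
    AbsolutelyContinuousOnInterval (fun t => ∫ x in Ω, g.potential ‖gradient (ρ t) x‖) 0 T ∧
      ∀ᵐ t ∂volume.restrict (Ioo 0 T),
        HasDerivAt (fun t => ∫ x in Ω, g.potential ‖gradient (ρ t) x‖)
          (∫ x in Ω, inner ℝ (g.K ‖gradient (ρ t) x‖ • gradient (ρ t) x)
            (gradient (timeDeriv ρ t) x)) t := by
  obtain ⟨X₀, r, hr, hc, hrep, hae⟩ := exists_coordinates hT hΩ.isOpen hT0 hρ hac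
  have hfin := hΩ.isFiniteMeasure
  have hΩm := hΩ.isOpen.measurableSet
  choose C hC0 hC using fun j => hT.exists_gradient_bound hΩ (hr j)
  have hgrad := ae_gradient_sum hT hΩ hr
  set G : Space d → X₀ → Space d := fun x j => gradient (r j) x with hG
  have hGm : AEStronglyMeasurable G (volume.restrict Ω) :=
    (measurable_pi_lambda _ fun j => measurable_gradient (r j)).aestronglyMeasurable
  have hGB : ∀ᵐ x ∂volume.restrict Ω, ‖G x‖ ≤ ∑ j, C j := by
    filter_upwards [ae_all_iff.2 hC] with x hx
    refine (pi_norm_le_iff_of_nonneg (Finset.sum_nonneg fun j _ => hC0 j)).2 fun j => ?_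
    exact (hx j).trans (Finset.single_le_sum (f := C) (fun j _ => hC0 j) (Finset.mem_univ j))
  have hlin : Continuous fun q : (X₀ → ℝ) × (X₀ → Space d) => ∑ j, q.1 j • q.2 j := by fun_prop
  obtain ⟨h1, h2⟩ := energy_along_curve hGm hGB
    (f := fun v y => g.potential ‖∑ j, v j • y j‖)
    (a := fun i v y => inner ℝ (g.flux (∑ j, v j • y j)) (y i))
    (g.continuous_potential.comp hlin.norm)
    (fun j => (g.continuous_flux.comp hlin).inner (by fun_prop))
    (fun v w y => by
      have e1 : ∑ j, inner ℝ (g.flux (∑ i, w i • y i)) (y j) * (v j - w j) =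
          inner ℝ (g.flux (∑ i, w i • y i)) ((∑ j, v j • y j) - ∑ j, w j • y j) := by
        rw [← Finset.sum_sub_distrib, inner_sum]
        exact Finset.sum_congr rfl fun j _ => by rw [← sub_smul, inner_smul_right]; ring
      rw [e1]
      exact g.inner_flux_sub_le _ _) hc
  have hrepg : ∀ t ∈ Icc 0 T, ∀ᵐ x ∂volume.restrict Ω,
      gradient (ρ t) x = ∑ j : X₀, ρ t j • G x j := by
    intro t ht
    filter_upwards [hgrad] with x hx
    exact hx _ _ fun y hy => hrep t ht y (subset_closure hy)
  have hint : ∀ t ∈ Icc 0 T, (∫ x in Ω, g.potential ‖gradient (ρ t) x‖) =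
      ∫ x in Ω, g.potential ‖∑ j : X₀, ρ t j • G x j‖ := by
    intro t ht
    refine integral_congr_ae ?_
    filter_upwards [hrepg t ht] with x hx
    rw [hx]
  refine ⟨absolutelyContinuousOnInterval_congr h1 fun t ht =>
    hint t (by rwa [uIcc_of_le hT0.le] at ht), ?_⟩
  filter_upwards [hae, ae_restrict_mem measurableSet_Ioo] with t ht htI
  have h3 := h2 t _ ht.1
  have h4 : (∫ x in Ω, ∑ j, inner ℝ (g.flux (∑ i : X₀, ρ t i • G x i)) (G x j) *
      timeDeriv ρ t j) = ∫ x in Ω, inner ℝ (g.K ‖gradient (ρ t) x‖ • gradient (ρ t) x)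
            (gradient (timeDeriv ρ t) x) := by
    refine integral_congr_ae ?_
    filter_upwards [hrepg t (Ioo_subset_Icc_self htI), hgrad] with x hx hx2
    rw [hx2 _ _ fun y hy => ht.2 y (subset_closure hy), inner_sum, ← hx]
    exact Finset.sum_congr rfl fun j _ => by
      rw [inner_smul_right, mul_comm]; rfl
  rw [← h4]
  refine h3.congr_of_eventuallyEq ?_
  filter_upwards [Ioo_mem_nhds htI.1 htI.2] with s hs
  exact hint s (Ioo_subset_Icc_self hs)

/-! ### The boundary flux -/

/-- The norm gives, for almost every `t`, a bound off a null set of `x` depending on `t`. A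
countable dense set of good times leaves one null set, and continuity in `t` reaches all times,
endpoints included. -/
lemma ae_forall_abs_le {X : Type*} [MeasurableSpace X] {σ : Measure X} {T : ℝ} (hT0 : 0 < T)
    {h : ℝ → X → ℝ} (hc : ∀ᵐ x ∂σ, ContinuousOn (fun t => h t x) (Icc 0 T)) {M : ℝ≥0}
    (hM : mixedNorm T ∞ ∞ σ h ≤ M) : ∀ᵐ x ∂σ, ∀ t ∈ Icc 0 T, |h t x| ≤ M := by
  have h1 : ∀ᵐ t : ℝ, t ∈ Ioo 0 T → ∀ᵐ x ∂σ, |h t x| ≤ M := by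
    rw [← ae_restrict_iff' measurableSet_Ioo]
    have h2 := ae_le_eLpNormEssSup (μ := volume.restrict (Ioo 0 T))
      (f := fun t => eLpNorm (h t) ∞ σ)
    filter_upwards [h2] with t ht
    rw [mixedNorm, eLpNorm_exponent_top] at hM
    have h3 : eLpNormEssSup (h t) σ ≤ M := by
      have := ht.trans hM
      rwa [enorm_eq_self, eLpNorm_exponent_top] at this
    filter_upwards [ae_le_eLpNormEssSup (μ := σ) (f := h t)] with x hx
    have h4 := hx.trans h3
    rw [enorm_eq_nnnorm, ENNReal.coe_le_coe] at h4
    exact_mod_cast h4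
  set D := Ioo 0 T ∩ {t : ℝ | t ∈ Ioo 0 T → ∀ᵐ x ∂σ, |h t x| ≤ M} with hD
  have hDcl : Icc 0 T ⊆ closure D := by
    rw [← closure_Ioo hT0.ne]
    exact closure_minimal ((Measure.dense_of_ae h1).open_subset_closure_inter isOpen_Ioo) isClosed_closure
  obtain ⟨Q, hQD, hQc, hDQ⟩ :=
    (TopologicalSpace.IsSeparable.of_separableSpace D).exists_countable_dense_subset
  have hQI : Q ⊆ Icc 0 T := fun t ht => Ioo_subset_Icc_self (hQD ht).1
  have hQ : ∀ᵐ x ∂σ, ∀ t ∈ Q, |h t x| ≤ M :=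
    (ae_ball_iff hQc).2 fun t ht => (hQD ht).2 (hQD ht).1
  have hQcl : closure Q = Icc 0 T :=
    (closure_minimal hQI isClosed_Icc).antisymm
      (hDcl.trans (closure_minimal hDQ isClosed_closure))
  filter_upwards [hc, hQ] with x hx hxQ t ht
  rw [← hQcl] at ht hx
  exact le_on_closure hxQ hx.abs continuousOn_const ht

section Flux

variable {X : Type*} [MeasurableSpace X] {σ : Measure X} {T : ℝ} {ψ : ℝ → X → ℝ} {M₀ M₁ : ℝ≥0}

/-- The one-sided `derivWithin` is used because the flux is `C¹` only on the closed interval; it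
agrees with `timeDeriv` at interior times. -/
lemma ae_abs_timeDeriv_le (hT0 : 0 < T)
    (hC1 : ∀ᵐ x ∂σ, ContDiffOn ℝ 1 (fun t => ψ t x) (Icc 0 T))
    (hM₁ : mixedNorm T ∞ ∞ σ (timeDeriv ψ) ≤ M₁) :
    ∀ᵐ x ∂σ, ∀ t ∈ Icc 0 T, |derivWithin (fun t => ψ t x) (Icc 0 T) t| ≤ M₁ := by
  refine ae_forall_abs_le hT0 (h := fun t x => derivWithin (fun t => ψ t x) (Icc 0 T) t) ?_ ?_
  · filter_upwards [hC1] with x hx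
    exact hx.continuousOn_derivWithin (uniqueDiffOn_Icc hT0) le_rfl
  · refine le_trans (le_of_eq ?_) hM₁
    refine eLpNorm_congr_ae ?_
    filter_upwards [ae_restrict_mem measurableSet_Ioo] with t ht
    refine congrArg (fun u => eLpNorm u ∞ σ) (funext fun x => ?_)
    exact derivWithin_of_mem_nhds (Icc_mem_nhds ht.1 ht.2)

variable [IsFiniteMeasure σ]

/-- The bound on the time derivative makes the flux Lipschitz in time, uniformly in `x`; this gives
both absolute continuity and the domination for differentiating under the integral. -/
lemma boundary_pairing (hT0 : 0 < T) (hm : ∀ t ∈ Icc 0 T, AEStronglyMeasurable (ψ t) σ)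
    (hC1 : ∀ᵐ x ∂σ, ContDiffOn ℝ 1 (fun t => ψ t x) (Icc 0 T))
    (hM₀ : mixedNorm T ∞ ∞ σ ψ ≤ M₀) (hM₁ : mixedNorm T ∞ ∞ σ (timeDeriv ψ) ≤ M₁) :
    (∀ t ∈ Icc 0 T, ∀ r : X → ℝ, MemLp r ∞ σ → Integrable (fun x => ψ t x * r x) σ) ∧
    (∀ t ∈ Ioo 0 T, ∀ r : X → ℝ, MemLp r ∞ σ → Integrable (fun x => timeDeriv ψ t x * r x) σ) ∧
    ∀ r : X → ℝ, MemLp r ∞ σ →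
      AbsolutelyContinuousOnInterval (fun t => ∫ x, ψ t x * r x ∂σ) 0 T ∧
      ∀ t ∈ Ioo 0 T,
        HasDerivAt (fun t => ∫ x, ψ t x * r x ∂σ) (∫ x, timeDeriv ψ t x * r x ∂σ) t := by
  have hψ := ae_forall_abs_le hT0 (hC1.mono fun x hx => hx.continuousOn) hM₀
  have hψt := ae_abs_timeDeriv_le hT0 hC1 hM₁
  have hint : ∀ t ∈ Icc 0 T, ∀ r : X → ℝ, MemLp r ∞ σ → Integrable (fun x => ψ t x * r x) σ := by
    intro t ht r hr
    exact (hr.integrable le_top).bdd_mul (c := M₀) (hm t ht)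
      (hψ.mono fun x hx => hx t ht)
  have hlip : ∀ᵐ x ∂σ, ∀ s ∈ Icc 0 T, ∀ t ∈ Icc 0 T, |ψ t x - ψ s x| ≤ M₁ * |t - s| := by
    filter_upwards [hC1, hψt] with x hx hx1 s hs t ht
    exact (convex_Icc 0 T).norm_image_sub_le_of_norm_derivWithin_le
      (hx.differentiableOn one_ne_zero) hx1 hs ht
  have hder : ∀ᵐ x ∂σ, ∀ t ∈ Ioo 0 T, HasDerivAt (fun s => ψ s x) (timeDeriv ψ t x) t := by
    filter_upwards [hC1] with x hx t ht
    exact ((hx.differentiableOn one_ne_zero t (Ioo_subset_Icc_self ht)).differentiableAt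
      (Icc_mem_nhds ht.1 ht.2)).hasDerivAt
  have hmt : ∀ t ∈ Ioo 0 T, AEStronglyMeasurable (timeDeriv ψ t) σ := by
    intro t ht
    -- Steps for difference quotients that never leave `[0, T]`; they exhibit `timeDeriv ψ t` as an
    -- almost everywhere limit of measurable functions.
    set τ : ℕ → ℝ := fun n => (T - t) / (n + 2) with hτ
    have hτpos : ∀ n, 0 < τ n := fun n => div_pos (sub_pos.2 ht.2) (by positivity)
    have hτle : ∀ n, t + τ n ≤ T := by
      intro n
      have : τ n ≤ T - t := div_le_self (sub_pos.2 ht.2).le (by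
        have : (0 : ℝ) ≤ n := Nat.cast_nonneg n
        linarith)
      linarith
    have hτ0 : Filter.Tendsto τ Filter.atTop (nhdsWithin 0 {0}ᶜ) := by
      refine tendsto_nhdsWithin_iff.2 ⟨?_, Filter.Eventually.of_forall fun n => (hτpos n).ne'⟩
      exact Filter.Tendsto.const_div_atTop
        (Filter.tendsto_atTop_add_const_right _ _ tendsto_natCast_atTop_atTop) _
    refine aestronglyMeasurable_of_tendsto_ae Filter.atTop
      (f := fun n x => (τ n)⁻¹ • (ψ (t + τ n) x - ψ t x)) (fun n => ?_) ?_
    · exact ((hm _ ⟨by linarith [ht.1, hτpos n], hτle n⟩).sub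
        (hm t (Ioo_subset_Icc_self ht))).const_smul (τ n)⁻¹
    · filter_upwards [hder] with x hx
      exact (hx t ht).tendsto_slope_zero.comp hτ0
  have hbdt : ∀ t ∈ Ioo 0 T, ∀ᵐ x ∂σ, |timeDeriv ψ t x| ≤ M₁ := by
    intro t ht
    filter_upwards [hψt] with x hx
    have := hx t (Ioo_subset_Icc_self ht)
    rwa [derivWithin_of_mem_nhds (Icc_mem_nhds ht.1 ht.2)] at this
  refine ⟨hint, fun t ht r hr => (hr.integrable le_top).bdd_mul (c := M₁) (hmt t ht) (hbdt t ht),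
    fun r hr => ⟨?_, fun t ht => ?_⟩⟩
  · refine LipschitzOnWith.absolutelyContinuousOnInterval
      (K := Real.toNNReal (M₁ * ∫ x, |r x| ∂σ)) ?_
    rw [uIcc_of_le hT0.le]
    refine LipschitzOnWith.of_dist_le_mul fun t ht s hs => ?_
    have hr1 : Integrable r σ := hr.integrable le_top
    rw [Real.coe_toNNReal _ (mul_nonneg M₁.coe_nonneg (integral_nonneg fun x => abs_nonneg _)),
      Real.dist_eq, Real.dist_eq, ← integral_sub (hint t ht r hr) (hint s hs r hr)]
    have h1 : M₁ * (∫ x, |r x| ∂σ) * |t - s| = ∫ x, M₁ * |t - s| * |r x| ∂σ := by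
      rw [integral_const_mul]; ring
    rw [h1]
    refine norm_integral_le_of_norm_le (G := ℝ) (hr1.abs.const_mul _) ?_
    filter_upwards [hlip] with x hx
    rw [← sub_mul, Real.norm_eq_abs, abs_mul]
    exact mul_le_mul_of_nonneg_right (hx s hs t ht) (abs_nonneg (r x))
  · have hI : Ioo 0 T ∈ nhds t := Ioo_mem_nhds ht.1 ht.2
    have hr1 : Integrable r σ := hr.integrable le_top
    refine (hasDerivAt_integral_of_dominated_loc_of_lip (bound := fun x => M₁ * |r x|)
      (F' := fun x => timeDeriv ψ t x * r x) hI ?_ (hint t (Ioo_subset_Icc_self ht) r hr)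
      ((hmt t ht).mul hr1.aestronglyMeasurable) ?_ (hr1.abs.const_mul _) ?_).2
    · filter_upwards [hI] with s hs
      exact (hint s (Ioo_subset_Icc_self hs) r hr).aestronglyMeasurable
    · filter_upwards [hlip] with x hx
      refine LipschitzOnWith.of_dist_le_mul fun u hu v hv => ?_
      rw [Real.coe_nnabs, Real.dist_eq, Real.dist_eq, ← sub_mul, abs_mul,
        abs_of_nonneg (mul_nonneg M₁.coe_nonneg (abs_nonneg (r x)))]
      have := mul_le_mul_of_nonneg_right
        (hx v (Ioo_subset_Icc_self hv) u (Ioo_subset_Icc_self hu)) (abs_nonneg (r x))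
      linarith
    · filter_upwards [hder] with x hx
      exact (hx t ht).mul_const _

end Flux

variable {d k : ℕ} {Ω : Set (Space d)} {𝒯 : Geometry.SimplicialComplex ℝ (Space d)}

lemma IsBoundedLipschitz.isFiniteMeasure_surface (hd : 1 ≤ d) (hΩ : IsBoundedLipschitz Ω) :
    IsFiniteMeasure (surface Ω) := by
  obtain ⟨C, hC, h, -⟩ := hΩ.exists_trace_bound hd
  exact ⟨h.trans_lt hC.lt_top⟩

lemma ae_surface_mem : ∀ᵐ x ∂surface Ω, x ∈ frontier Ω :=
  ae_restrict_mem isClosed_frontier.measurableSet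

lemma IsTriangulation.memLp_surface (hd : 1 ≤ d) (hT : IsTriangulation Ω 𝒯)
    (hΩ : IsBoundedLipschitz Ω) {r : Space d → ℝ} (hr : r ∈ densitySpace 𝒯 k) :
    MemLp r ∞ (surface Ω) := by
  have := hΩ.isFiniteMeasure_surface hd
  obtain ⟨B, -, hB⟩ := hT.exists_bound hΩ hr
  refine MemLp.of_bound ?_ B ?_
  · exact ((hT.continuousOn hΩ.isOpen hr).mono frontier_subset_closure).aestronglyMeasurable
      isClosed_frontier.measurableSet
  · filter_upwards [ae_surface_mem] with x hx
    exact hB x (frontier_subset_closure hx)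

/-- The trace inequality for Bochner integrals. -/
lemma IsBoundedLipschitz.exists_trace_integral_bound (hd : 1 ≤ d) (hΩ : IsBoundedLipschitz Ω) :
    ∃ C > 0, ∀ (𝒯 : Geometry.SimplicialComplex ℝ (Space d)) (k : ℕ), IsTriangulation Ω 𝒯 →
      ∀ r ∈ densitySpace 𝒯 k,
        ∫ x, |r x| ∂surface Ω ≤ C * ∫ x in Ω, (|r x| + ‖gradient r x‖) := by
  obtain ⟨C, hC, -, h⟩ := hΩ.exists_trace_bound hd
  have hfin := hΩ.isFiniteMeasure
  have hfs := hΩ.isFiniteMeasure_surface hd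
  refine ⟨C.toReal + 1, by positivity, fun 𝒯 k hT r hr => ?_⟩
  have h1 := h 𝒯 k hT r hr
  have hi : Integrable (fun x => |r x| + ‖gradient r x‖) (volume.restrict Ω) :=
    ((hT.memLp hΩ hr 1).integrable le_rfl).abs.add
      ((hT.memLp_gradient hΩ hr 1).integrable le_rfl).norm
  have h0 : 0 ≤ ∫ x in Ω, (|r x| + ‖gradient r x‖) := integral_nonneg fun x => by positivity
  have hs : Integrable r (surface Ω) := (hT.memLp_surface hd hΩ hr).integrable le_top
  have e1 : ∫⁻ x, ‖r x‖ₑ ∂surface Ω = ENNReal.ofReal (∫ x, |r x| ∂surface Ω) := by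
    rw [ofReal_integral_eq_lintegral_ofReal hs.abs
      (Filter.Eventually.of_forall fun x => abs_nonneg _)]
    exact lintegral_congr fun x => Real.enorm_eq_ofReal_abs _
  have e2 : ∫⁻ x in Ω, (‖r x‖ₑ + ‖gradient r x‖ₑ) =
      ENNReal.ofReal (∫ x in Ω, (|r x| + ‖gradient r x‖)) := by
    rw [ofReal_integral_eq_lintegral_ofReal hi
      (Filter.Eventually.of_forall fun x => by positivity)]
    refine lintegral_congr fun x => ?_
    rw [ENNReal.ofReal_add (abs_nonneg _) (norm_nonneg _), Real.enorm_eq_ofReal_abs,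
      ofReal_norm]
  rw [e1, e2, ← ENNReal.ofReal_toReal hC, ← ENNReal.ofReal_mul ENNReal.toReal_nonneg] at h1
  have h2 := (ENNReal.ofReal_le_ofReal_iff (mul_nonneg ENNReal.toReal_nonneg h0)).1 h1
  linarith

/-- The pairing of the boundary flux with a discrete density. -/
lemma boundary_energy (hd : 1 ≤ d) (hT : IsTriangulation Ω 𝒯) (hΩ : IsBoundedLipschitz Ω) {T : ℝ}
    (hT0 : 0 < T) {ρ : ℝ → Space d → ℝ} (hρ : ∀ t ∈ Icc 0 T, ρ t ∈ densitySpace 𝒯 k)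
    (hac : ∀ x ∈ closure Ω, AbsolutelyContinuousOnInterval (fun t => ρ t x) 0 T)
    {ψ : ℝ → Space d → ℝ} (hm : ∀ t ∈ Icc 0 T, AEStronglyMeasurable (ψ t) (surface Ω))
    (hC1 : ∀ x ∈ frontier Ω, ContDiffOn ℝ 1 (fun t => ψ t x) (Icc 0 T)) {M₀ M₁ : ℝ≥0}
    (hM₀ : mixedNorm T ∞ ∞ (surface Ω) ψ ≤ M₀)
    (hM₁ : mixedNorm T ∞ ∞ (surface Ω) (timeDeriv ψ) ≤ M₁) :
    AbsolutelyContinuousOnInterval (fun t => ∫ x, ψ t x * ρ t x ∂surface Ω) 0 T ∧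
      ∀ᵐ t ∂volume.restrict (Ioo 0 T), HasDerivAt (fun t => ∫ x, ψ t x * ρ t x ∂surface Ω)
        ((∫ x, ψ t x * timeDeriv ρ t x ∂surface Ω) + ∫ x, timeDeriv ψ t x * ρ t x ∂surface Ω)
        t := by
  obtain ⟨X₀, r, hr, hc, hrep, hae⟩ := exists_coordinates hT hΩ.isOpen hT0 hρ hac
  have hfs := hΩ.isFiniteMeasure_surface hd
  obtain ⟨hi, hit, hp⟩ := boundary_pairing hT0 hm
    (ae_surface_mem.mono fun x hx => hC1 x hx) hM₀ hM₁
  have hrs : ∀ j, MemLp (r j) ∞ (surface Ω) := fun j => hT.memLp_surface hd hΩ (hr j)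
  have hsum : ∀ (w : Space d → ℝ), (∀ j, Integrable (fun x => w x * r j x) (surface Ω)) →
      ∀ (u : Space d → ℝ) (c : X₀ → ℝ), (∀ x ∈ closure Ω, u x = ∑ j, c j * r j x) →
      ∫ x, w x * u x ∂surface Ω = ∑ j, c j * ∫ x, w x * r j x ∂surface Ω := by
    intro w hw u c hu
    have h1 : ∫ x, w x * u x ∂surface Ω = ∫ x, ∑ j, c j * (w x * r j x) ∂surface Ω := by
      refine integral_congr_ae ?_
      filter_upwards [ae_surface_mem] with x hx
      rw [hu x (frontier_subset_closure hx), Finset.mul_sum]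
      exact Finset.sum_congr rfl fun j _ => by ring
    rw [h1, integral_finsetSum _ fun j _ => (hw j).const_mul _]
    exact Finset.sum_congr rfl fun j _ => integral_const_mul _ _
  have hb : ∀ t ∈ Icc 0 T, ∫ x, ψ t x * ρ t x ∂surface Ω =
      ∑ j : X₀, ρ t j * ∫ x, ψ t x * r j x ∂surface Ω := fun t ht =>
    hsum _ (fun j => hi t ht _ (hrs j)) _ _ (hrep t ht)
  constructor
  · refine absolutelyContinuousOnInterval_congr
      (g := fun t => ∑ j : X₀, ρ t j * ∫ x, ψ t x * r j x ∂surface Ω) ?_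
      fun t ht => hb t (by rwa [uIcc_of_le hT0.le] at ht)
    have h1 : (fun t => ∑ j : X₀, ρ t j * ∫ x, ψ t x * r j x ∂surface Ω) =
        ∑ j : X₀, (fun t => ρ t j) * (fun t => ∫ x, ψ t x * r j x ∂surface Ω) := by
      ext t; simp
    rw [h1]
    refine Finset.sum_induction _ (fun f => AbsolutelyContinuousOnInterval f 0 T)
      (fun f f' hf hf' => hf.add hf') ?_ fun j _ => (hc j).mul (hp _ (hrs j)).1
    exact (LipschitzWith.const (0 : ℝ)).lipschitzOnWith.absolutelyContinuousOnInterval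
  · filter_upwards [hae, ae_restrict_mem measurableSet_Ioo] with t ht htI
    have htI' := Ioo_subset_Icc_self htI
    rw [hsum _ (fun j => hi t htI' _ (hrs j)) _ _ ht.2,
      hsum _ (fun j => hit t htI _ (hrs j)) _ _ (hrep t htI'), ← Finset.sum_add_distrib]
    have h1 : HasDerivAt (fun t => ∑ j : X₀, ρ t j * ∫ x, ψ t x * r j x ∂surface Ω)
        (∑ j : X₀, (timeDeriv ρ t j * (∫ x, ψ t x * r j x ∂surface Ω) +
          ρ t j * ∫ x, timeDeriv ψ t x * r j x ∂surface Ω)) t :=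
      HasDerivAt.fun_sum fun j _ => (ht.1 j).mul ((hp _ (hrs j)).2 t htI)
    refine h1.congr_of_eventuallyEq ?_
    filter_upwards [Ioo_mem_nhds htI.1 htI.2] with s hs
    exact hb s (Ioo_subset_Icc_self hs)

/-! ### Gradients of discrete densities are discrete momenta -/

section Gradient
variable {d : ℕ}

lemma totalDegree_pderiv_le (i : Fin d) (p : MvPolynomial (Fin d) ℝ) :
    (MvPolynomial.pderiv i p).totalDegree ≤ p.totalDegree := by
  conv_lhs => rw [← MvPolynomial.support_sum_monomial_coeff p]
  rw [map_sum]
  refine MvPolynomial.totalDegree_finsetSum_le fun m hm => ?_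
  rw [MvPolynomial.pderiv_monomial]
  refine (MvPolynomial.totalDegree_monomial_le _ _).trans ?_
  refine le_trans ?_ (MvPolynomial.le_totalDegree hm)
  rw [Finsupp.sum_fintype _ _ (by simp), Finsupp.sum_fintype _ _ (by simp)]
  exact Finset.sum_le_sum fun j _ => by simp

lemma hasFDerivAt_polyFun (p : MvPolynomial (Fin d) ℝ) (x : Space d) :
    HasFDerivAt (polyFun p)
      (∑ i, polyFun (MvPolynomial.pderiv i p) x • (EuclideanSpace.proj i : Space d →L[ℝ] ℝ)) x := by
  induction p using MvPolynomial.induction_on with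
  | C a =>
    have : polyFun (MvPolynomial.C a : MvPolynomial (Fin d) ℝ) = fun _ => a := by
      ext x; simp [polyFun]
    rw [this]
    simpa [polyFun] using hasFDerivAt_const a x
  | add p q hp hq =>
    have : polyFun (p + q) = fun x => polyFun p x + polyFun q x := by
      ext x; simp [polyFun]
    rw [this]
    refine (hp.fun_add hq).congr_fderiv ?_
    rw [← Finset.sum_add_distrib]
    exact Finset.sum_congr rfl fun i _ => by simp [polyFun, add_smul]
  | mul_X p j hp =>
    have : polyFun (p * MvPolynomial.X j) =
        fun x => polyFun p x * (EuclideanSpace.proj j : Space d →L[ℝ] ℝ) x := by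
      ext x; simp [polyFun]
    rw [this]
    refine (hp.fun_mul (EuclideanSpace.proj j : Space d →L[ℝ] ℝ).hasFDerivAt).congr_fderiv ?_
    ext v
    simp [polyFun, Derivation.leibniz, MvPolynomial.pderiv_X, add_mul, Finset.sum_add_distrib,
      Pi.single_apply, Finset.mul_sum, apply_ite, ite_mul]
    refine Finset.sum_congr rfl fun i _ => by ring

/-- Partial derivatives do not raise the degree. This inclusion links the two discrete equations: it
admits `∇ρ_h` and `∇ρ_{h,t}` as test momenta. -/
lemma gradient_mem_momentumSpace {k : ℕ} {𝒯 : Geometry.SimplicialComplex ℝ (Space d)}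
    {r : Space d → ℝ} (hr : r ∈ densitySpace 𝒯 k) : gradient r ∈ momentumSpace 𝒯 k := by
  intro S hS i
  obtain ⟨p, hp, hrp⟩ := hr S hS
  refine ⟨MvPolynomial.pderiv i p, (totalDegree_pderiv_le i p).trans hp, fun x hx => ?_⟩
  have h1 : HasFDerivAt r (∑ i, polyFun (MvPolynomial.pderiv i p) x •
      (EuclideanSpace.proj i : Space d →L[ℝ] ℝ)) x := by
    refine (hasFDerivAt_polyFun p x).congr_of_eventuallyEq ?_
    filter_upwards [isOpen_interior.mem_nhds hx] with y hy
    exact hrp y (interior_subset hy)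
  have h2 : gradient r x i = fderiv ℝ r x (EuclideanSpace.single i (1 : ℝ)) := by
    rw [← InnerProductSpace.toDual_symm_apply (𝕜 := ℝ) (y := fderiv ℝ r x),
      EuclideanSpace.inner_single_right]
    simp [gradient]
  refine h2.trans ?_
  rw [h1.fderiv]
  simp [polyFun]

end Gradient

/-! ### Integration of differential inequalities -/

/-- The fundamental theorem of calculus for absolutely continuous functions, applied to `X ≤ R -
E'`. The dissipation `X` enters through `∫⁻` only, so it need not be measurable in time. -/
lemma integrate_energy {E R X : ℝ → ℝ} {T : ℝ}
    (hE : AbsolutelyContinuousOnInterval E 0 T) (hR : IntegrableOn R (Ioo 0 T))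
    (hR0 : ∀ᵐ t ∂volume.restrict (Ioo 0 T), 0 ≤ R t)
    (h : ∀ᵐ t ∂volume.restrict (Ioo 0 T), ∃ E', HasDerivAt E E' t ∧ 0 ≤ X t ∧ E' + X t ≤ R t) :
    (∀ t ∈ Icc 0 T, E t ≤ E 0 + ∫ s in Ioo 0 T, R s) ∧
      ∫⁻ t in Ioo 0 T, ENNReal.ofReal (X t) ≤
        ENNReal.ofReal (E 0 - E T + ∫ s in Ioo 0 T, R s) := by
  have key : ∀ t ∈ Icc 0 T, IntegrableOn (deriv E) (Ioo 0 t) ∧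
      ∫ s in Ioo 0 t, deriv E s = E t - E 0 := by
    intro t ht
    have hac : AbsolutelyContinuousOnInterval E 0 t := hE.mono (by
      rw [uIcc_of_le ht.1, uIcc_of_le (ht.1.trans ht.2)]
      exact Icc_subset_Icc le_rfl ht.2)
    have h1 := hac.integral_deriv_eq_sub
    have h2 := hac.intervalIntegrable_deriv
    rw [intervalIntegral.integral_of_le ht.1, integral_Ioc_eq_integral_Ioo] at h1
    rw [intervalIntegrable_iff_integrableOn_Ioo_of_le ht.1] at h2
    exact ⟨h2, h1⟩
  have hsub : ∀ t ∈ Icc 0 T, Ioo 0 t ⊆ Ioo 0 T := fun t ht => Ioo_subset_Ioo le_rfl ht.2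
  have hpos : ∀ᵐ t ∂volume.restrict (Ioo 0 T), 0 ≤ X t ∧ X t ≤ R t - deriv E t := by
    filter_upwards [h] with t ⟨E', h1, h2, h3⟩
    rw [h1.deriv]
    exact ⟨h2, by linarith⟩
  constructor
  · intro t ht
    obtain ⟨h1, h2⟩ := key t ht
    have h3 : 0 ≤ ∫ s in Ioo 0 t, (R s - deriv E s) := by
      refine integral_nonneg_of_ae ?_
      have := ae_mono (Measure.restrict_mono_set volume (hsub t ht)) hpos
      filter_upwards [this] with s hs
      exact hs.1.trans hs.2
    rw [integral_sub (hR.mono_set (hsub t ht)) h1, h2] at h3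
    have h4 : ∫ s in Ioo 0 t, R s ≤ ∫ s in Ioo 0 T, R s :=
      setIntegral_mono_set hR hR0 (hsub t ht).eventuallyLE
    linarith
  · by_cases hT : 0 ≤ T
    · obtain ⟨h1, h2⟩ := key T ⟨hT, le_rfl⟩
      have h3 : E 0 - E T + ∫ s in Ioo 0 T, R s = ∫ s in Ioo 0 T, (R s - deriv E s) := by
        rw [integral_sub hR h1, h2]; ring
      have hi : IntegrableOn (fun s => R s - deriv E s) (Ioo 0 T) := hR.sub h1
      rw [h3, ofReal_integral_eq_lintegral_ofReal hi
        (hpos.mono fun t ht => ht.1.trans ht.2)]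
      exact lintegral_mono_ae (hpos.mono fun t ht => ENNReal.ofReal_le_ofReal ht.2)
    · rw [Ioo_eq_empty (by linarith)]
      simp

/-- Multiplication by `exp (-A t)` removes the zeroth-order term; the dissipation retains at least
the factor `exp (-A T)`. -/
lemma gronwall_energy {y R X : ℝ → ℝ} {T A : ℝ} (hT : 0 ≤ T) (hA : 0 ≤ A)
    (hy : AbsolutelyContinuousOnInterval y 0 T) (hy0 : ∀ t ∈ Icc 0 T, 0 ≤ y t)
    (hR : IntegrableOn R (Ioo 0 T)) (hR0 : ∀ᵐ t ∂volume.restrict (Ioo 0 T), 0 ≤ R t)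
    (h : ∀ᵐ t ∂volume.restrict (Ioo 0 T),
      ∃ y', HasDerivAt y y' t ∧ 0 ≤ X t ∧ y' + X t ≤ A * (y t + R t)) :
    (∀ t ∈ Icc 0 T, y t ≤ Real.exp (A * T) * (y 0 + A * ∫ s in Ioo 0 T, R s)) ∧
      ∫⁻ t in Ioo 0 T, ENNReal.ofReal (X t) ≤
        ENNReal.ofReal (Real.exp (A * T) * (y 0 + A * ∫ s in Ioo 0 T, R s)) := by
  have hexp : AbsolutelyContinuousOnInterval (fun t => Real.exp (-(A * t))) 0 T := by
    refine ContDiffOn.absolutelyContinuousOnInterval (ContDiff.contDiffOn ?_)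
    fun_prop
  have hE := hexp.mul hy
  obtain ⟨h1, h2⟩ := integrate_energy (X := fun t => Real.exp (-(A * T)) * X t)
    (R := fun t => A * R t) hE (hR.const_mul A)
    (hR0.mono fun t ht => mul_nonneg hA ht) (by
      filter_upwards [h, hR0, ae_restrict_mem measurableSet_Ioo] with t ⟨y', hy', hX, hle⟩ hRt ht
      have hd : HasDerivAt (fun t => Real.exp (-(A * t))) (Real.exp (-(A * t)) * (-A)) t := by
        have := (((hasDerivAt_id t).const_mul A).neg).exp
        simpa using this
      refine ⟨_, hd.mul hy', by positivity, ?_⟩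
      have e1 : Real.exp (-(A * T)) ≤ Real.exp (-(A * t)) :=
        Real.exp_le_exp.2 (by nlinarith [ht.2])
      have e2 : Real.exp (-(A * t)) ≤ 1 := Real.exp_le_one_iff.2 (by nlinarith [ht.1])
      have e3 := Real.exp_pos (-(A * t))
      have e4 := mul_le_mul_of_nonneg_right e1 hX
      have e5 := mul_le_mul_of_nonneg_left hle e3.le
      have e6 := mul_le_mul_of_nonneg_right e2 (mul_nonneg hA hRt)
      linarith)
  simp only [Pi.mul_apply, mul_zero, neg_zero, Real.exp_zero, one_mul, integral_const_mul] at h1 h2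
  have hI : 0 ≤ A * ∫ s in Ioo 0 T, R s := mul_nonneg hA (integral_nonneg_of_ae hR0)
  have hy00 := hy0 0 ⟨le_rfl, hT⟩
  have hinv : Real.exp (A * T) * Real.exp (-(A * T)) = 1 := by
    rw [← Real.exp_add]; simp
  have hp := Real.exp_pos (A * T)
  constructor
  · intro t ht
    have e0 := h1 t ht
    have e1 : Real.exp (-(A * T)) ≤ Real.exp (-(A * t)) :=
      Real.exp_le_exp.2 (by nlinarith [ht.2])
    have e2 := mul_le_mul_of_nonneg_right e1 (hy0 t ht)
    calc y t = Real.exp (A * T) * (Real.exp (-(A * T)) * y t) := by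
          rw [← mul_assoc, hinv, one_mul]
      _ ≤ _ := mul_le_mul_of_nonneg_left (by linarith) hp.le
  · have e1 : ∀ t, ENNReal.ofReal (X t) =
        ENNReal.ofReal (Real.exp (A * T)) * ENNReal.ofReal (Real.exp (-(A * T)) * X t) := by
      intro t
      rw [← ENNReal.ofReal_mul hp.le, ← mul_assoc, hinv, one_mul]
    simp_rw [e1]
    rw [lintegral_const_mul' _ _ ENNReal.ofReal_ne_top, ENNReal.ofReal_mul hp.le]
    refine mul_le_mul_right (h2.trans (ENNReal.ofReal_le_ofReal ?_)) _
    have : 0 ≤ Real.exp (-(A * T)) * y T :=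
      mul_nonneg (Real.exp_pos _).le (hy0 T ⟨hT, le_rfl⟩)
    linarith

variable {d k : ℕ} {Ω : Set (Space d)} {𝒯 : Geometry.SimplicialComplex ℝ (Space d)}

/-! ### Auxiliary bounds for discrete functions -/

lemma integrable_affine {X : Type*} [MeasurableSpace X] {μ : Measure X} [IsFiniteMeasure μ]
    {p q : X → ℝ} (hp : Integrable p μ) (hq : Integrable q μ) (a b c : ℝ) :
    Integrable (fun x => a * p x + b * q x + c) μ :=
  ((hp.const_mul a).add (hq.const_mul b)).add (integrable_const c)

lemma integral_affine {X : Type*} [MeasurableSpace X] {μ : Measure X} [IsFiniteMeasure μ]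
    {p q : X → ℝ} (hp : Integrable p μ) (hq : Integrable q μ) (a b c : ℝ) :
    ∫ x, (a * p x + b * q x + c) ∂μ =
      a * (∫ x, p x ∂μ) + b * (∫ x, q x ∂μ) + μ.real univ * c := by
  have h : Integrable (fun x => a * p x + b * q x) μ := (hp.const_mul a).add (hq.const_mul b)
  rw [integral_add h (integrable_const c), integral_add (hp.const_mul a) (hq.const_mul b),
    integral_const_mul, integral_const_mul, integral_const, smul_eq_mul]

lemma IsTriangulation.integrable_potential (hT : IsTriangulation Ω 𝒯)
    (hΩ : IsBoundedLipschitz Ω) (g : ForchheimerPoly) {r : Space d → ℝ}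
    (hr : r ∈ densitySpace 𝒯 k) :
    Integrable (fun x => g.potential ‖gradient r x‖) (volume.restrict Ω) := by
  obtain ⟨B, -, hB⟩ := hT.exists_gradient_bound hΩ hr
  have := hΩ.isFiniteMeasure
  exact integrable_comp_of_bounded (measurable_gradient r).aestronglyMeasurable hB
    (g.continuous_potential.comp continuous_norm)

lemma ForchheimerPoly.sq_le_one_add_rpow_conjExp (g : ForchheimerPoly) {M : ℝ} (hM : 0 ≤ M) :
    M ^ 2 ≤ 1 + M ^ g.conjExp := by
  have h0 := Real.rpow_nonneg hM g.conjExp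
  rcases le_total M 1 with h | h
  · nlinarith
  · have h1 := Real.rpow_le_rpow_of_exponent_le h g.two_le_conjExp
    rw [Real.rpow_two] at h1
    linarith

/-- Boundary terms are absorbed by the potential energy of the gradient. -/
lemma IsBoundedLipschitz.exists_boundary_absorption (hd : 1 ≤ d) (hΩ : IsBoundedLipschitz Ω)
    (g : ForchheimerPoly) {ε : ℝ} (hε : 0 < ε) :
    ∃ C > 0, ∀ (𝒯 : Geometry.SimplicialComplex ℝ (Space d)) (k : ℕ), IsTriangulation Ω 𝒯 →
      ∀ r ∈ densitySpace 𝒯 k, ∀ M : ℝ, 0 ≤ M →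
        M * ∫ x, |r x| ∂surface Ω ≤ ε * (∫ x in Ω, g.potential ‖gradient r x‖) +
          C * ((∫ x in Ω, r x ^ 2) + 1 + M ^ g.conjExp) := by
  obtain ⟨Ct, hCt, htr⟩ := hΩ.exists_trace_integral_bound hd
  obtain ⟨c₁, hc₁, C₁, hC₁, hpot⟩ := g.exists_le_potential
  -- After multiplication by the trace constant `Ct` this leaves `ε c₁ |∇r|^β`, which is at most `ε
  -- (P + C₁)`.
  obtain ⟨C₂, hC₂, hY⟩ := g.exists_young (ε := ε * c₁ / Ct) (by positivity)
  have hfin := hΩ.isFiniteMeasure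
  set μ := volume.restrict Ω
  set V := μ.real univ with hV
  have hV0 : 0 ≤ V := measureReal_nonneg
  refine ⟨Ct + V * (Ct + ε * C₁) + V * (Ct + Ct * C₂), by positivity, ?_⟩
  intro 𝒯 k hT r hr M hM
  have hMl := Real.rpow_nonneg hM g.conjExp
  have hM2 := g.sq_le_one_add_rpow_conjExp hM
  have hir : Integrable r μ := (hT.memLp hΩ hr 1).integrable le_rfl
  have hir2 : Integrable (fun x => r x ^ 2) μ := (hT.memLp hΩ hr 2).integrable_sq
  have hig : Integrable (fun x => ‖gradient r x‖) μ :=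
    ((hT.memLp_gradient hΩ hr 1).integrable le_rfl).norm
  have hip := hT.integrable_potential hΩ g hr
  have hpt : ∀ x, Ct * (M * (|r x| + ‖gradient r x‖)) ≤ ε * g.potential ‖gradient r x‖ +
      Ct * r x ^ 2 + ((Ct + ε * C₁) + (Ct + Ct * C₂) * M ^ g.conjExp) := by
    intro x
    have h1 := hY M ‖gradient r x‖ hM (norm_nonneg _)
    have h2 := hpot ‖gradient r x‖ (norm_nonneg _)
    have h3 : M * |r x| ≤ r x ^ 2 + M ^ 2 := by
      nlinarith [sq_nonneg (M - |r x|), sq_abs (r x), sq_nonneg M, sq_nonneg (r x)]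
    have h4 := mul_le_mul_of_nonneg_left h1 hCt.le
    have h5 : Ct * (ε * c₁ / Ct * ‖gradient r x‖ ^ g.β + C₂ * M ^ g.conjExp) =
        ε * (c₁ * ‖gradient r x‖ ^ g.β) + Ct * C₂ * M ^ g.conjExp := by
      field_simp
    rw [h5] at h4
    have h6 := mul_le_mul_of_nonneg_left h2 hε.le
    have h7 := mul_le_mul_of_nonneg_left (h3.trans (add_le_add le_rfl hM2)) hCt.le
    linarith
  have hint : Ct * (M * ∫ x, (|r x| + ‖gradient r x‖) ∂μ) ≤
      ε * (∫ x, g.potential ‖gradient r x‖ ∂μ) + Ct * (∫ x, r x ^ 2 ∂μ) +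
        V * ((Ct + ε * C₁) + (Ct + Ct * C₂) * M ^ g.conjExp) := by
    have h1 := integral_mono (μ := μ) (((hir.abs.add hig).const_mul M).const_mul Ct)
      (integrable_affine hip hir2 ε Ct _) hpt
    rw [integral_affine hip hir2] at h1
    simp only [Pi.add_apply, integral_const_mul] at h1
    exact h1
  have htr' := mul_le_mul_of_nonneg_left (htr 𝒯 k hT r hr) hM
  have hr20 : 0 ≤ ∫ x, r x ^ 2 ∂μ := integral_nonneg fun x => sq_nonneg _
  have e1 : 0 ≤ V * (Ct + ε * C₁) := by positivity
  have e2 : 0 ≤ V * (Ct + Ct * C₂) := by positivity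
  nlinarith [mul_nonneg e1 hr20, mul_nonneg e1 hMl, mul_nonneg e2 hr20, mul_nonneg hCt.le hMl]

lemma abs_integral_mul_le {X : Type*} [MeasurableSpace X] {σ : Measure X} {w r : X → ℝ} {M : ℝ}
    (hr : Integrable r σ) (hw : ∀ᵐ x ∂σ, |w x| ≤ M) :
    |∫ x, w x * r x ∂σ| ≤ M * ∫ x, |r x| ∂σ := by
  rw [← integral_const_mul]
  refine norm_integral_le_of_norm_le (G := ℝ) (hr.abs.const_mul M) ?_
  filter_upwards [hw] with x hx
  rw [Real.norm_eq_abs, abs_mul]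
  exact mul_le_mul_of_nonneg_right hx (abs_nonneg _)

lemma IsTriangulation.memLp_momentum (hT : IsTriangulation Ω 𝒯) (hΩ : IsBoundedLipschitz Ω)
    {z : Space d → Space d} (hz : z ∈ momentumSpace 𝒯 k) (p : ℝ≥0∞) :
    MemLp z p (volume.restrict Ω) := by
  have hfin := hΩ.isFiniteMeasure
  have hpoly : ∀ s ∈ elts 𝒯, ∃ q : Fin d → MvPolynomial (Fin d) ℝ,
      ∀ x ∈ interior (convexHull ℝ (s : Set (Space d))), z x =
        WithLp.toLp 2 fun i => polyFun (q i) x := by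
    intro s hs
    choose q _ hq using hz _ (hT.mem_elements hs)
    refine ⟨q, fun x hx => ?_⟩
    ext i
    exact hq i x hx
  choose! q hq using hpoly
  have hcont : ∀ s, Continuous fun x : Space d => (WithLp.toLp 2 fun i => polyFun (q s i) x) :=
    fun s => (PiLp.continuous_toLp 2 _).comp (continuous_pi fun i => continuous_polyFun _)
  have hmeas : AEStronglyMeasurable z (volume.restrict Ω) := by
    rw [Measure.restrict_congr_set (hT.ae_eq_iUnion hΩ)]
    have hU : (⋃ s ∈ elts 𝒯, interior (convexHull ℝ (s : Set (Space d)))) =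
        ⋃ s : elts 𝒯, interior (convexHull ℝ ((s : Finset (Space d)) : Set (Space d))) := by
      ext; simp
    rw [hU]
    refine aestronglyMeasurable_iUnion_iff.2 fun s => ?_
    refine (hcont s.1).aestronglyMeasurable.congr ?_
    filter_upwards [ae_restrict_mem isOpen_interior.measurableSet] with x hx
    exact (hq s.1 s.2 x hx).symm
  choose B hB using fun s : Finset (Space d) =>
    (isCompact_simplex s).exists_bound_of_continuousOn (hcont s).continuousOn
  refine MemLp.of_bound hmeas (∑ s ∈ elts 𝒯, |B s|) ?_
  rw [ae_restrict_iff' hΩ.isOpen.measurableSet]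
  filter_upwards [hT.ae_mem_interior hΩ] with x hx hxΩ
  obtain ⟨s, hs, hxs⟩ := hx hxΩ
  rw [hq s hs x hxs]
  exact ((hB s x (interior_subset hxs)).trans (le_abs_self _)).trans
    (Finset.single_le_sum (f := fun s => |B s|) (fun _ _ => abs_nonneg _) hs)

/-- The momentum is controlled by the potential energy. -/
lemma IsBoundedLipschitz.exists_momentum_bound (hΩ : IsBoundedLipschitz Ω)
    (g : ForchheimerPoly) :
    ∃ C > 0, ∀ (𝒯 : Geometry.SimplicialComplex ℝ (Space d)) (k : ℕ), IsTriangulation Ω 𝒯 →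
      ∀ r ∈ densitySpace 𝒯 k, ∀ m ∈ momentumSpace 𝒯 k,
        (∫ x in Ω, inner ℝ (m x) (m x)) +
          ∫ x in Ω, inner ℝ (g.K ‖gradient r x‖ • gradient r x) (m x) = 0 →
        ∫ x in Ω, ‖m x‖ ^ 2 ≤ C * (1 + ∫ x in Ω, g.potential ‖gradient r x‖) := by
  obtain ⟨c₁, hc₁, C₁, hC₁, hpot⟩ := g.exists_le_potential
  obtain ⟨C₂, hC₂, hroot⟩ := g.exists_root_sq_le
  have hfin := hΩ.isFiniteMeasure
  set μ := volume.restrict Ω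
  set V := μ.real univ with hV
  have hV0 : 0 ≤ V := measureReal_nonneg
  refine ⟨V * (C₂ * (1 + C₁ / c₁)) + C₂ / c₁, by positivity, fun 𝒯 k hT r hr m hm heq => ?_⟩
  have hip := hT.integrable_potential hΩ g hr
  have hm2 : Integrable (fun x => ‖m x‖ ^ 2) μ := (hT.memLp_momentum hΩ hm 2).integrable_norm_pow two_ne_zero
  -- Young's inequality with weights `1/2`: half of `‖m‖²` goes back to the left-hand side, and the
  -- squared flux is controlled by the potential.
  have hpt : ∀ x, -inner ℝ (g.K ‖gradient r x‖ • gradient r x) (m x) ≤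
      1 / 2 * (C₂ / c₁) * g.potential ‖gradient r x‖ + 1 / 2 * ‖m x‖ ^ 2 +
        1 / 2 * (C₂ * (1 + C₁ / c₁)) := by
    intro x
    have h1 := abs_real_inner_le_norm (g.flux (gradient r x)) (m x)
    rw [g.norm_flux] at h1
    have h2 := hroot ‖gradient r x‖ (norm_nonneg _)
    have h3 := hpot ‖gradient r x‖ (norm_nonneg _)
    have h4 : ‖gradient r x‖ ^ g.β ≤ (g.potential ‖gradient r x‖ + C₁) / c₁ := by
      rw [le_div_iff₀ hc₁]; linarith
    have h5 := mul_le_mul_of_nonneg_left (add_le_add (le_refl (1 : ℝ)) h4) hC₂.le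
    have h6 : C₂ * (1 + (g.potential ‖gradient r x‖ + C₁) / c₁) =
        C₂ * (1 + C₁ / c₁) + C₂ / c₁ * g.potential ‖gradient r x‖ := by ring
    rw [h6] at h5
    have h7 := neg_le_abs (inner ℝ (g.flux (gradient r x)) (m x))
    have h8 : -inner ℝ (g.K ‖gradient r x‖ • gradient r x) (m x) ≤
      g.root ‖gradient r x‖ * ‖m x‖ := h7.trans h1
    nlinarith [sq_nonneg (g.root ‖gradient r x‖ - ‖m x‖)]
  have hself : ∫ x, inner ℝ (m x) (m x) ∂μ = ∫ x, ‖m x‖ ^ 2 ∂μ :=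
    integral_congr_ae (Filter.Eventually.of_forall fun x => real_inner_self_eq_norm_sq _)
  have hflux : Integrable (fun x => inner ℝ (g.K ‖gradient r x‖ • gradient r x) (m x)) μ := by
    obtain ⟨B, hB0, hB⟩ := hT.exists_gradient_bound hΩ hr
    refine Integrable.mono' (((hT.memLp_momentum hΩ hm 1).integrable le_rfl).norm.const_mul
      (B / g.a 0)) ((g.continuous_flux.comp_aestronglyMeasurable
        (measurable_gradient r).aestronglyMeasurable).inner
          (hT.memLp_momentum hΩ hm 1).aestronglyMeasurable) ?_
    filter_upwards [hB] with x hx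
    exact (norm_inner_le_norm _ _).trans (mul_le_mul_of_nonneg_right
      ((g.norm_flux_le _).trans (div_le_div_of_nonneg_right hx g.a_zero_pos.le)) (norm_nonneg _))
  have h1 := integral_mono (μ := μ) hflux.neg
    (integrable_affine hip hm2 (1 / 2 * (C₂ / c₁)) (1 / 2) (1 / 2 * (C₂ * (1 + C₁ / c₁)))) hpt
  simp only [Pi.neg_apply] at h1
  rw [integral_neg, integral_affine hip hm2] at h1
  rw [hself] at heq
  have hJ0 : 0 ≤ ∫ x, g.potential ‖gradient r x‖ ∂μ :=
    integral_nonneg fun x => g.potential_nonneg (norm_nonneg _)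
  have e1 : 0 ≤ V * (C₂ * (1 + C₁ / c₁)) := by positivity
  have e2 : 0 ≤ C₂ / c₁ := by positivity
  nlinarith [mul_nonneg e1 hJ0]

variable {d k : ℕ} {Ω : Set (Space d)}

/-! ### A priori estimates -/

/-- A solution of the semidiscrete problem with data for which the energy estimates are not void;
`M₀` bounds the boundary flux. -/
structure IsEnergySolution (Ω : Set (Space d)) (g : ForchheimerPoly) (T φmin φmax : ℝ) (k : ℕ)
    (𝒯 : Geometry.SimplicialComplex ℝ (Space d)) (φ ρ₀ : Space d → ℝ)
    (ψ f : ℝ → Space d → ℝ) (ρ : ℝ → Space d → ℝ) (m : ℝ → Space d → Space d) (M₀ : ℝ≥0) :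
    Prop where
  tri : IsTriangulation Ω 𝒯
  φ_meas : AEStronglyMeasurable φ (volume.restrict Ω)
  φ_bounds : ∀ x ∈ Ω, φmin ≤ φ x ∧ φ x ≤ φmax
  ρ₀_cont : ContinuousOn ρ₀ (closure Ω)
  ψ_meas : ∀ t ∈ Icc 0 T, AEStronglyMeasurable (ψ t) (surface Ω)
  ψ_diff : ∀ x ∈ frontier Ω, ContDiffOn ℝ 1 (fun t => ψ t x) (Icc 0 T)
  ψ_le : mixedNorm T ∞ ∞ (surface Ω) ψ ≤ M₀
  f_memLp : ∀ᵐ t ∂volume.restrict (Ioo 0 T), MemLp (f t) 2 (volume.restrict Ω)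
  f_int : IntegrableOn (fun t => ∫ x in Ω, f t x ^ 2) (Ioo 0 T)
  sol : IsSemidiscreteSolution Ω g T k 𝒯 φ ρ₀ ψ f ρ m

lemma integrable_mul_of_sq {X : Type*} [MeasurableSpace X] {μ : Measure X} {u v : X → ℝ}
    (hu : MemLp u 2 μ) (hv : MemLp v 2 μ) : Integrable (fun x => u x * v x) μ :=
  hu.integrable_mul hv

lemma abs_integral_mul_le_sq {X : Type*} [MeasurableSpace X] {μ : Measure X} {u v : X → ℝ}
    (hu : MemLp u 2 μ) (hv : MemLp v 2 μ) {ε : ℝ} (hε : 0 < ε) :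
    |∫ x, u x * v x ∂μ| ≤ 1 / (4 * ε) * (∫ x, u x ^ 2 ∂μ) + ε * ∫ x, v x ^ 2 ∂μ := by
  have hu2 := hu.integrable_sq
  have hv2 := hv.integrable_sq
  rw [← integral_const_mul, ← integral_const_mul,
    ← integral_add (hu2.const_mul _) (hv2.const_mul _)]
  refine norm_integral_le_of_norm_le (G := ℝ) ((hu2.const_mul _).add (hv2.const_mul _))
    (Filter.Eventually.of_forall fun x => ?_)
  have h1 : 1 / (4 * ε) * u x ^ 2 + ε * v x ^ 2 - |u x| * |v x| =
      ε * (|v x| - |u x| / (2 * ε)) ^ 2 := by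
    rw [← sq_abs (u x), ← sq_abs (v x)]
    field_simp
    ring
  have h2 : 0 ≤ ε * (|v x| - |u x| / (2 * ε)) ^ 2 := by positivity
  rw [Real.norm_eq_abs, abs_mul]
  linarith

namespace IsEnergySolution
variable {g : ForchheimerPoly} {T φmin φmax : ℝ} {𝒯 : Geometry.SimplicialComplex ℝ (Space d)}
  {φ ρ₀ : Space d → ℝ} {ψ f ρ : ℝ → Space d → ℝ} {m : ℝ → Space d → Space d} {M₀ : ℝ≥0}

/-- The projection is tested with `ρ 0` itself, and `½ ρ(0)² - ½ ρ₀² ≤ (ρ(0) - ρ₀) ρ(0)`. -/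
lemma integral_initial_sq_le (S : IsEnergySolution Ω g T φmin φmax k 𝒯 φ ρ₀ ψ f ρ m M₀)
    (hΩ : IsBoundedLipschitz Ω) (hT0 : 0 < T) :
    ∫ x in Ω, ρ 0 x ^ 2 ≤ ∫ x in Ω, ρ₀ x ^ 2 := by
  have hfin := hΩ.isFiniteMeasure
  have hΩm := hΩ.isOpen.measurableSet
  have hρ := S.sol.density_mem 0 ⟨le_rfl, hT0.le⟩
  have h0 := S.sol.initial _ hρ
  have hv := S.tri.memLp hΩ hρ 2
  have hu : MemLp ρ₀ 2 (volume.restrict Ω) := by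
    obtain ⟨B, hB⟩ := hΩ.isBounded.isCompact_closure.exists_bound_of_continuousOn S.ρ₀_cont
    refine MemLp.of_bound ((S.ρ₀_cont.mono subset_closure).aestronglyMeasurable hΩm) B ?_
    exact (ae_restrict_iff' hΩm).2
      (Filter.Eventually.of_forall fun x hx => hB x (subset_closure hx))
  have h1 := integral_mono (μ := volume.restrict Ω)
    ((hv.integrable_sq.const_mul (1 / 2)).sub (hu.integrable_sq.const_mul (1 / 2)))
    (integrable_mul_of_sq (hv.sub hu) hv) (fun x => by
      simp only [Pi.sub_apply]
      nlinarith [sq_nonneg (ρ 0 x - ρ₀ x)])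
  simp only [Pi.sub_apply] at h1
  rw [h0, integral_sub (hv.integrable_sq.const_mul _) (hu.integrable_sq.const_mul _),
    integral_const_mul, integral_const_mul] at h1
  linarith

lemma integral_sq_le (S : IsEnergySolution Ω g T φmin φmax k 𝒯 φ ρ₀ ψ f ρ m M₀)
    (hΩ : IsBoundedLipschitz Ω) (hφ : 0 < φmin) {r : Space d → ℝ} (hr : r ∈ densitySpace 𝒯 k) :
    ∫ x in Ω, r x ^ 2 ≤ 2 / φmin * ∫ x in Ω, 1 / 2 * φ x * r x ^ 2 ∧
      ∫ x in Ω, 1 / 2 * φ x * r x ^ 2 ≤ φmax / 2 * ∫ x in Ω, r x ^ 2 := by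
  have hΩm := hΩ.isOpen.measurableSet
  have hr2 := (S.tri.memLp hΩ hr 2).integrable_sq
  have hi : IntegrableOn (fun x => 1 / 2 * φ x * r x ^ 2) Ω := by
    refine hr2.bdd_mul (c := φmax) (S.φ_meas.const_mul _) ?_
    refine (ae_restrict_iff' hΩm).2 (Filter.Eventually.of_forall fun x hx => ?_)
    obtain ⟨h1, h2⟩ := S.φ_bounds x hx
    rw [Real.norm_of_nonneg (by linarith)]
    linarith
  rw [← integral_const_mul, ← integral_const_mul]
  constructor
  · refine setIntegral_mono_on hr2 (hi.const_mul _) hΩm fun x hx => ?_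
    have h1 := mul_le_mul_of_nonneg_right (S.φ_bounds x hx).1 (sq_nonneg (r x))
    have h2 : 2 / φmin * (1 / 2 * φ x * r x ^ 2) = φ x * r x ^ 2 / φmin := by
      field_simp
    rw [h2, le_div_iff₀ hφ]
    linarith
  · refine setIntegral_mono_on hi (hr2.const_mul _) hΩm fun x hx => ?_
    have h1 := mul_le_mul_of_nonneg_right (S.φ_bounds x hx).2 (sq_nonneg (r x))
    linarith

lemma potential_le_dissipation (S : IsEnergySolution Ω g T φmin φmax k 𝒯 φ ρ₀ ψ f ρ m M₀)
    (hΩ : IsBoundedLipschitz Ω) {r : Space d → ℝ} (hr : r ∈ densitySpace 𝒯 k) :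
    ∫ x in Ω, g.potential ‖gradient r x‖ ≤
      ∫ x in Ω, inner ℝ (g.K ‖gradient r x‖ • gradient r x) (gradient r x) := by
  obtain ⟨B, -, hB⟩ := S.tri.exists_gradient_bound hΩ hr
  have hfin := hΩ.isFiniteMeasure
  refine integral_mono (S.tri.integrable_potential hΩ g hr) ?_ fun x => ?_
  · exact integrable_comp_of_bounded (h := fun v : Space d => inner ℝ (g.flux v) v)
      (measurable_gradient r).aestronglyMeasurable hB (g.continuous_flux.inner continuous_id)
  · exact (g.potential_le (norm_nonneg _)).trans (g.inner_flux_self (gradient r x)).ge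

end IsEnergySolution

/-- The basic energy estimate. -/
theorem exists_energy_estimate (hd : 1 ≤ d) (hΩ : IsBoundedLipschitz Ω) (g : ForchheimerPoly)
    {T : ℝ} (hT0 : 0 < T) {φmin : ℝ} (hφ : 0 < φmin) (φmax : ℝ) (k : ℕ) :
    ∃ C > 0, ∀ {𝒯 φ ρ₀ ψ f ρ m M₀}, IsEnergySolution Ω g T φmin φmax k 𝒯 φ ρ₀ ψ f ρ m M₀ →
      (∀ t ∈ Icc 0 T, ∫ x in Ω, ρ t x ^ 2 ≤ C * ((∫ x in Ω, ρ₀ x ^ 2) + 1 +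
        (M₀ : ℝ) ^ g.conjExp + ∫ t in Ioo 0 T, ∫ x in Ω, f t x ^ 2)) ∧
      ∫⁻ t in Ioo 0 T, ENNReal.ofReal (∫ x in Ω, g.potential ‖gradient (ρ t) x‖) ≤
        ENNReal.ofReal (C * ((∫ x in Ω, ρ₀ x ^ 2) + 1 +
          (M₀ : ℝ) ^ g.conjExp + ∫ t in Ioo 0 T, ∫ x in Ω, f t x ^ 2)) := by
  obtain ⟨C₁, hC₁, habs⟩ := hΩ.exists_boundary_absorption hd g (ε := 1 / 2) (by norm_num)
  set A := 1 + C₁ + (1 + C₁) * (2 / φmin) with hA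
  have hApos : 0 < A := by positivity
  set e := Real.exp (A * T) with he
  have hepos : 0 < e := Real.exp_pos _
  -- The sign of `φmax` is not known when `Ω` is empty, hence the absolute value.
  set c₀ := e * (|φmax| / 2 + A * (1 + T)) with hc₀
  have hc₀pos : 0 < c₀ := by positivity
  refine ⟨2 / φmin * c₀ + 2 * c₀, by positivity, ?_⟩
  intro 𝒯 φ ρ₀ ψ f ρ m M₀ S
  have hfin := hΩ.isFiniteMeasure
  have hfs := hΩ.isFiniteMeasure_surface hd
  have hΩm := hΩ.isOpen.measurableSet
  have hl0 : 0 ≤ (M₀ : ℝ) ^ g.conjExp := Real.rpow_nonneg M₀.coe_nonneg _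
  have hφB : ∀ x ∈ Ω, 0 ≤ φ x ∧ φ x ≤ φmax := fun x hx =>
    ⟨hφ.le.trans (S.φ_bounds x hx).1, (S.φ_bounds x hx).2⟩
  obtain ⟨hyac, hyd⟩ := quadratic_energy S.tri hΩ hT0 S.sol.density_mem
    S.sol.absolutelyContinuous S.φ_meas hφB
  have hy0 : ∀ t, 0 ≤ ∫ x in Ω, 1 / 2 * φ x * ρ t x ^ 2 := fun t =>
    setIntegral_nonneg hΩm fun x hx => mul_nonneg (mul_nonneg (by norm_num) (hφB x hx).1)
      (sq_nonneg _)
  have hF0 : ∀ t, 0 ≤ ∫ x in Ω, f t x ^ 2 := fun t => integral_nonneg fun x => sq_nonneg _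
  have hJ0 : ∀ t, 0 ≤ ∫ x in Ω, g.potential ‖gradient (ρ t) x‖ := fun t =>
    integral_nonneg fun x => g.potential_nonneg (norm_nonneg _)
  have hRint : IntegrableOn (fun t => (∫ x in Ω, f t x ^ 2) + (1 + (M₀ : ℝ) ^ g.conjExp))
      (Ioo 0 T) := by
    have : IsFiniteMeasure (volume.restrict (Ioo (0 : ℝ) T)) := ⟨by simp⟩
    exact Integrable.add S.f_int (integrable_const _)
  have hψ := ae_forall_abs_le hT0 (ae_surface_mem.mono fun x hx => (S.ψ_diff x hx).continuousOn)
    S.ψ_le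
  obtain ⟨h1, h2⟩ := gronwall_energy
    (X := fun t => 1 / 2 * ∫ x in Ω, g.potential ‖gradient (ρ t) x‖) hT0.le hApos.le hyac
    (fun t _ => hy0 t) hRint (Filter.Eventually.of_forall fun t => by
      have := hF0 t
      positivity) (by
      filter_upwards [hyd, S.sol.momentum_eq, S.sol.density_eq, S.f_memLp,
        ae_restrict_mem measurableSet_Ioo] with t hder hmom hden hf ht
      have htI := Ioo_subset_Icc_self ht
      have hρ := S.sol.density_mem t htI
      refine ⟨_, hder, mul_nonneg (by norm_num) (hJ0 t), ?_⟩
      -- Testing with `∇ρ` and with `ρ`: the term `∫ m · ∇ρ` occurs in both equations and cancels in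
      -- the final `linarith`. The boundary absorption takes half of the potential; the other half
      -- is the dissipation `X`.
      have e1 := hmom _ (gradient_mem_momentumSpace hρ)
      have e2 := hden _ hρ
      have e3 := S.potential_le_dissipation hΩ hρ
      have e4 := le_of_abs_le (abs_integral_mul_le_sq hf (S.tri.memLp hΩ hρ 2) one_pos)
      have e5 := neg_le_of_abs_le (abs_integral_mul_le
        ((S.tri.memLp_surface hd hΩ hρ).integrable le_top) (hψ.mono fun x hx => hx t htI))
      have e6 := habs 𝒯 k S.tri _ hρ M₀ M₀.coe_nonneg
      have e7 := (S.integral_sq_le hΩ hφ hρ).1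
      have e8 := mul_le_mul_of_nonneg_left e7 (by positivity : 0 ≤ 1 + C₁)
      have e9 := mul_nonneg hC₁.le (hF0 t)
      have e10 := mul_nonneg (by positivity : 0 ≤ 1 + C₁) (hy0 t)
      have e11 := mul_nonneg (by positivity : 0 ≤ (1 + C₁) * (2 / φmin))
        (add_nonneg (hF0 t) (by positivity : 0 ≤ 1 + (M₀ : ℝ) ^ g.conjExp))
      rw [hA]
      have e12 := hF0 t
      linarith)
  have hsum : (∫ x in Ω, 1 / 2 * φ x * ρ 0 x ^ 2) + A * ∫ t in Ioo 0 T,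
      ((∫ x in Ω, f t x ^ 2) + (1 + (M₀ : ℝ) ^ g.conjExp)) ≤
      (|φmax| / 2 + A * (1 + T)) * ((∫ x in Ω, ρ₀ x ^ 2) + 1 +
        (M₀ : ℝ) ^ g.conjExp + ∫ t in Ioo 0 T, ∫ x in Ω, f t x ^ 2) := by
    have : IsFiniteMeasure (volume.restrict (Ioo (0 : ℝ) T)) := ⟨by simp⟩
    have e1 : ∫ t in Ioo 0 T, ((∫ x in Ω, f t x ^ 2) + (1 + (M₀ : ℝ) ^ g.conjExp)) =
        (∫ t in Ioo 0 T, ∫ x in Ω, f t x ^ 2) + T * (1 + (M₀ : ℝ) ^ g.conjExp) := by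
      rw [integral_add S.f_int (integrable_const _), setIntegral_const, smul_eq_mul]
      simp [hT0.le]
    have e2 := S.integral_initial_sq_le hΩ hT0
    have e3 := (S.integral_sq_le hΩ hφ (S.sol.density_mem 0 ⟨le_rfl, hT0.le⟩)).2
    have e4 : 0 ≤ ∫ x in Ω, ρ 0 x ^ 2 := integral_nonneg fun x => sq_nonneg _
    have e5 : 0 ≤ ∫ t in Ioo 0 T, ∫ x in Ω, f t x ^ 2 := integral_nonneg hF0
    have e6 := mul_le_mul_of_nonneg_right (le_abs_self φmax) e4
    have e7 := mul_le_mul_of_nonneg_left e2 (abs_nonneg φmax)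
    have e8 := abs_nonneg φmax
    have e9 : 0 ≤ ∫ x in Ω, ρ₀ x ^ 2 := e4.trans e2
    rw [e1]
    have q1 := mul_nonneg e8 hl0
    have q2 := mul_nonneg e8 e5
    have q3 := mul_nonneg hApos.le e9
    have q4 := mul_nonneg hApos.le hl0
    have q5 := mul_nonneg (mul_nonneg hApos.le hT0.le) e9
    have q6 := mul_nonneg (mul_nonneg hApos.le hT0.le) e5
    nlinarith
  set D := (∫ x in Ω, ρ₀ x ^ 2) + 1 + (M₀ : ℝ) ^ g.conjExp +
    ∫ t in Ioo 0 T, ∫ x in Ω, f t x ^ 2 with hD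
  have hD0 : 0 ≤ D := by
    have e5 : 0 ≤ ∫ t in Ioo 0 T, ∫ x in Ω, f t x ^ 2 := integral_nonneg hF0
    have e9 : 0 ≤ ∫ x in Ω, ρ₀ x ^ 2 := integral_nonneg fun x => sq_nonneg _
    positivity
  have hsum' := mul_le_mul_of_nonneg_left hsum hepos.le
  rw [← mul_assoc, ← hc₀] at hsum'
  have hcD : 0 ≤ c₀ * D := by positivity
  have hcD' : 0 ≤ 2 / φmin * (c₀ * D) := by positivity
  constructor
  · intro t ht
    have e1 := (S.integral_sq_le hΩ hφ (S.sol.density_mem t ht)).1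
    have e2 := mul_le_mul_of_nonneg_left ((h1 t ht).trans hsum')
      (by positivity : 0 ≤ 2 / φmin)
    nlinarith
  · have e1 : ∀ t, ENNReal.ofReal (∫ x in Ω, g.potential ‖gradient (ρ t) x‖) =
        ENNReal.ofReal 2 *
          ENNReal.ofReal (1 / 2 * ∫ x in Ω, g.potential ‖gradient (ρ t) x‖) := by
      intro t
      rw [← ENNReal.ofReal_mul (by norm_num)]
      congr 1; ring
    simp_rw [e1]
    rw [lintegral_const_mul' _ _ ENNReal.ofReal_ne_top]
    refine (mul_le_mul_right h2 _).trans ?_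
    rw [← ENNReal.ofReal_mul (by norm_num)]
    exact ENNReal.ofReal_le_ofReal (by nlinarith)

variable {d k : ℕ} {Ω : Set (Space d)}

lemma IsTriangulation.integral_potential_le {𝒯 : Geometry.SimplicialComplex ℝ (Space d)}
    (hT : IsTriangulation Ω 𝒯) (hΩ : IsBoundedLipschitz Ω) (g : ForchheimerPoly) {C : ℝ}
    (hC : ∀ ξ, 0 ≤ ξ → g.potential ξ ≤ C * ξ ^ g.β) {r : Space d → ℝ}
    (hr : r ∈ densitySpace 𝒯 k) :
    ∫ x in Ω, g.potential ‖gradient r x‖ ≤ C * ∫ x in Ω, ‖gradient r x‖ ^ g.β := by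
  rw [← integral_const_mul]
  exact integral_mono (hT.integrable_potential hΩ g hr)
    ((hT.integrableOn_gradient_rpow hΩ hr g.β_pos.le).const_mul C)
    fun x => hC _ (norm_nonneg _)

lemma IsTriangulation.integral_gradient_rpow_le {𝒯 : Geometry.SimplicialComplex ℝ (Space d)}
    (hT : IsTriangulation Ω 𝒯) (hΩ : IsBoundedLipschitz Ω) (g : ForchheimerPoly) {c C : ℝ}
    (hc : 0 < c) (hC : ∀ ξ, 0 ≤ ξ → c * ξ ^ g.β - C ≤ g.potential ξ) {r : Space d → ℝ}
    (hr : r ∈ densitySpace 𝒯 k) :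
    ∫ x in Ω, ‖gradient r x‖ ^ g.β ≤
      1 / c * (∫ x in Ω, g.potential ‖gradient r x‖) + (volume.restrict Ω).real univ * (C / c) := by
  have hfin := hΩ.isFiniteMeasure
  have hi := hT.integrable_potential hΩ g hr
  have h1 := integral_mono (hT.integrableOn_gradient_rpow hΩ hr g.β_pos.le)
    (integrable_affine hi hi (1 / c) 0 (C / c)) (fun x => by
      have := hC ‖gradient r x‖ (norm_nonneg _)
      have h2 : ‖gradient r x‖ ^ g.β ≤ (g.potential ‖gradient r x‖ + C) / c := by
        rw [le_div_iff₀ hc]; linarith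
      refine h2.trans (le_of_eq ?_)
      ring)
  rw [integral_affine hi hi] at h1
  linarith

/-- The `W^{1,β}`-stability of the projection, applied to `ρ 0 = π ρ₀`; quasiuniformity of the mesh
enters the estimates only here. An empty `Ω` is treated apart, as it has no mesh size. -/
lemma exists_initial_gradient_bound (hd : 1 ≤ d) (hΩ : IsBoundedLipschitz Ω) (g : ForchheimerPoly)
    {T : ℝ} (hT0 : 0 < T) (φmin φmax : ℝ) (k : ℕ) {c : ℝ} (hc : 0 < c) :
    ∃ C > 0, ∀ {𝒯 φ ρ₀ ψ f ρ m M₀}, IsEnergySolution Ω g T φmin φmax k 𝒯 φ ρ₀ ψ f ρ m M₀ →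
      (∀ S ∈ elements 𝒯, ∀ S' ∈ elements 𝒯,
        ∃ x, Metric.closedBall x (c * Metric.diam S') ⊆ S) →
      ContDiffOn ℝ 1 ρ₀ Ω → IntegrableOn (fun x => ‖gradient ρ₀ x‖ ^ g.β) Ω →
      ∫ x in Ω, g.potential ‖gradient (ρ 0) x‖ ≤
        C * ((∫ x in Ω, ‖gradient ρ₀ x‖ ^ g.β) + (∫ x in Ω, ρ₀ x ^ 2) + 1) := by
  obtain ⟨C, hC, h⟩ := hΩ.exists_projection_gradient_bound k hc g.one_lt_β.le g.β_lt_two.le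
  obtain ⟨C', hC', hpot⟩ := g.exists_potential_le
  refine ⟨C' * C, by positivity, fun {𝒯 φ ρ₀ ψ f ρ m M₀} S hq hρ₀ hint => ?_⟩
  rcases Ω.eq_empty_or_nonempty with hΩe | hne
  · simp only [hΩe, Measure.restrict_empty, integral_zero_measure]
    positivity
  obtain ⟨h', ctr, M⟩ := exists_quasiMesh hd hΩ hne S.tri hc hq
  have hρ := S.sol.density_mem 0 ⟨le_rfl, hT0.le⟩
  refine (S.tri.integral_potential_le hΩ g hpot hρ).trans ?_
  rw [mul_assoc]
  exact mul_le_mul_of_nonneg_left (h M _ hρ ρ₀ S.ρ₀_cont hρ₀ hint S.sol.initial) hC'.le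

/-- The energy estimate for the time derivative. -/
theorem exists_derivative_estimate (hd : 1 ≤ d) (hΩ : IsBoundedLipschitz Ω) (g : ForchheimerPoly)
    {T : ℝ} (hT0 : 0 < T) {φmin : ℝ} (hφ : 0 < φmin) (φmax : ℝ) (k : ℕ) {c : ℝ} (hc : 0 < c) :
    ∃ C > 0, ∀ {𝒯 φ ρ₀ ψ f ρ m M₀}, IsEnergySolution Ω g T φmin φmax k 𝒯 φ ρ₀ ψ f ρ m M₀ →
      (∀ S ∈ elements 𝒯, ∀ S' ∈ elements 𝒯,
        ∃ x, Metric.closedBall x (c * Metric.diam S') ⊆ S) →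
      ContDiffOn ℝ 1 ρ₀ Ω → IntegrableOn (fun x => ‖gradient ρ₀ x‖ ^ g.β) Ω →
      ∀ M₁ : ℝ≥0, mixedNorm T ∞ ∞ (surface Ω) (timeDeriv ψ) ≤ M₁ →
      (∀ t ∈ Icc 0 T, ∫ x in Ω, g.potential ‖gradient (ρ t) x‖ ≤
        C * ((∫ x in Ω, ρ₀ x ^ 2) + (∫ x in Ω, ‖gradient ρ₀ x‖ ^ g.β) +
          (M₁ : ℝ) ^ g.conjExp + 1 + (M₀ : ℝ) ^ g.conjExp +
            ∫ t in Ioo 0 T, ∫ x in Ω, f t x ^ 2)) ∧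
      ∫⁻ t in Ioo 0 T, ENNReal.ofReal (∫ x in Ω, timeDeriv ρ t x ^ 2) ≤
        ENNReal.ofReal (C * ((∫ x in Ω, ρ₀ x ^ 2) + (∫ x in Ω, ‖gradient ρ₀ x‖ ^ g.β) +
          (M₁ : ℝ) ^ g.conjExp + 1 + (M₀ : ℝ) ^ g.conjExp +
            ∫ t in Ioo 0 T, ∫ x in Ω, f t x ^ 2)) := by
  obtain ⟨C₀, hC₀, hfirst⟩ := exists_energy_estimate hd hΩ g hT0 hφ φmax k
  -- Two absorptions: `∫ ψ_t ρ` may cost a full `J`, whose time integral is already bounded, while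
  -- `∫ ψ ρ` sits beside `J(t)` itself and may cost only half of it.
  obtain ⟨C₁, hC₁, habs1⟩ := hΩ.exists_boundary_absorption hd g (ε := 1) (by norm_num)
  obtain ⟨C₂, hC₂, habs2⟩ := hΩ.exists_boundary_absorption hd g (ε := 1 / 2) (by norm_num)
  obtain ⟨C₃, hC₃, hinit⟩ := exists_initial_gradient_bound hd hΩ g hT0 φmin φmax k hc
  -- the bound for the right-hand side, for the boundary terms, and for the sum of them
  set c₁ := 1 / (2 * φmin) + C₀ + C₁ * T * (C₀ + 1) with hc₁
  set c₂ := C₂ * (C₀ + 1) with hc₂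
  set c₃ := 2 * C₃ + 2 * c₂ + c₁ with hc₃
  have hc₁0 : 0 < c₁ := by positivity
  have hc₂0 : 0 < c₂ := by positivity
  have hc₃0 : 0 < c₃ := by positivity
  refine ⟨2 * c₃ + 2 / φmin * c₃, by positivity, ?_⟩
  intro 𝒯 φ ρ₀ ψ f ρ m M₀ S hq hρ₀ hint M₁ hM₁
  have hfin := hΩ.isFiniteMeasure
  have hfs := hΩ.isFiniteMeasure_surface hd
  have hΩm := hΩ.isOpen.measurableSet
  have hIfin : IsFiniteMeasure (volume.restrict (Ioo (0 : ℝ) T)) := ⟨by simp⟩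
  have hl0 : 0 ≤ (M₀ : ℝ) ^ g.conjExp := Real.rpow_nonneg M₀.coe_nonneg _
  have hl1 : 0 ≤ (M₁ : ℝ) ^ g.conjExp := Real.rpow_nonneg M₁.coe_nonneg _
  obtain ⟨hV, hJint⟩ := hfirst S
  have hJ00 := hinit S hq hρ₀ hint
  have hF0 : ∀ t, 0 ≤ ∫ x in Ω, f t x ^ 2 := fun t => integral_nonneg fun x => sq_nonneg _
  have hJ0 : ∀ t, 0 ≤ ∫ x in Ω, g.potential ‖gradient (ρ t) x‖ := fun t =>
    integral_nonneg fun x => g.potential_nonneg (norm_nonneg _)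
  have hFF0 : 0 ≤ ∫ t in Ioo 0 T, ∫ x in Ω, f t x ^ 2 := integral_nonneg hF0
  have hR0 : 0 ≤ ∫ x in Ω, ρ₀ x ^ 2 := integral_nonneg fun x => sq_nonneg _
  have hG0 : 0 ≤ ∫ x in Ω, ‖gradient ρ₀ x‖ ^ g.β :=
    integral_nonneg fun x => Real.rpow_nonneg (norm_nonneg _) _
  set D₀ := (∫ x in Ω, ρ₀ x ^ 2) + 1 + (M₀ : ℝ) ^ g.conjExp +
    ∫ t in Ioo 0 T, ∫ x in Ω, f t x ^ 2 with hD₀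
  set D := (∫ x in Ω, ρ₀ x ^ 2) + (∫ x in Ω, ‖gradient ρ₀ x‖ ^ g.β) +
          (M₁ : ℝ) ^ g.conjExp + 1 + (M₀ : ℝ) ^ g.conjExp +
            ∫ t in Ioo 0 T, ∫ x in Ω, f t x ^ 2 with hD
  have hD₀0 : 0 ≤ D₀ := by positivity
  have hD0 : 0 ≤ D := by positivity
  have hDD : D₀ ≤ D := by rw [hD, hD₀]; linarith
  obtain ⟨hJac, hJd⟩ := gradient_energy S.tri hΩ g hT0 S.sol.density_mem
    S.sol.absolutelyContinuous
  obtain ⟨hbac, hbd⟩ := boundary_energy hd S.tri hΩ hT0 S.sol.density_mem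
    S.sol.absolutelyContinuous S.ψ_meas S.ψ_diff S.ψ_le hM₁
  set J := fun t => ∫ x in Ω, g.potential ‖gradient (ρ t) x‖ with hJdef
  set b := fun t => ∫ x, ψ t x * ρ t x ∂surface Ω with hbdef
  have hJc : IntegrableOn J (Ioo 0 T) := by
    have h1 := hJac.continuousOn
    rw [uIcc_of_le hT0.le] at h1
    exact h1.integrableOn_Icc.mono_set Ioo_subset_Icc_self
  have hJI : ∫ t in Ioo 0 T, J t ≤ C₀ * D₀ := by
    rw [← ofReal_integral_eq_lintegral_ofReal hJc (Filter.Eventually.of_forall hJ0)] at hJint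
    exact (ENNReal.ofReal_le_ofReal_iff (by positivity)).1 hJint
  set R := fun t => 1 / (2 * φmin) * (∫ x in Ω, f t x ^ 2) + 1 * J t +
    C₁ * (C₀ * D₀ + 1 + (M₁ : ℝ) ^ g.conjExp) with hRdef
  have hRint : IntegrableOn R (Ioo 0 T) := integrable_affine S.f_int hJc _ _ _
  have hRI : ∫ t in Ioo 0 T, R t ≤ c₁ * D := by
    have h1 : ∫ t in Ioo 0 T, R t = _ := integral_affine S.f_int hJc (1 / (2 * φmin)) 1
      (C₁ * (C₀ * D₀ + 1 + (M₁ : ℝ) ^ g.conjExp))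
    have h2 : (volume.restrict (Ioo (0 : ℝ) T)).real univ = T := by simp [hT0.le]
    have h3 : ∫ t in Ioo 0 T, ∫ x in Ω, f t x ^ 2 ≤ D := by rw [hD]; linarith
    have h4 : 1 + (M₁ : ℝ) ^ g.conjExp ≤ D := by rw [hD]; linarith
    have h5 := mul_le_mul_of_nonneg_left h3 (by positivity : 0 ≤ 1 / (2 * φmin))
    have h6 := mul_le_mul_of_nonneg_left hDD hC₀.le
    have h7 := mul_le_mul_of_nonneg_left (add_le_add h6 h4)
      (by positivity : 0 ≤ C₁ * T)
    rw [h1, h2, hc₁]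
    linarith
  have hψ0 := ae_forall_abs_le hT0
    (ae_surface_mem.mono fun x hx => (S.ψ_diff x hx).continuousOn) S.ψ_le
  have hψ1 := ae_abs_timeDeriv_le hT0 (ae_surface_mem.mono fun x hx => S.ψ_diff x hx) hM₁
  have hwmem := ae_timeDeriv_mem S.tri hΩ.isOpen hT0 S.sol.density_mem
    S.sol.absolutelyContinuous
  have hbbound : ∀ t ∈ Icc 0 T, |b t| ≤ 1 / 2 * J t + c₂ * D := by
    intro t ht
    have hρ := S.sol.density_mem t ht
    have e1 := abs_integral_mul_le
      ((S.tri.memLp_surface hd hΩ hρ).integrable le_top) (hψ0.mono fun x hx => hx t ht)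
    have e2 := habs2 𝒯 k S.tri _ hρ M₀ M₀.coe_nonneg
    have e3 := hV t ht
    have e4 : 1 + (M₀ : ℝ) ^ g.conjExp ≤ D := by rw [hD]; linarith
    have e5 := mul_le_mul_of_nonneg_left hDD hC₀.le
    have e6 := mul_le_mul_of_nonneg_left (add_le_add (e3.trans e5) e4) hC₂.le
    rw [hc₂]
    refine (e1.trans e2).trans ?_
    change 1 / 2 * J t + _ ≤ _
    linarith
  -- Including `b` in the energy trades `∫ ψ ρ_t` for `∫ ψ_t ρ`, so no trace of `ρ_t` has to be
  -- estimated.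
  obtain ⟨h1, h2⟩ := integrate_energy (E := fun t => J t + b t)
    (X := fun t => φmin / 2 * ∫ x in Ω, timeDeriv ρ t x ^ 2) (R := R) (hJac.add hbac) hRint
    (Filter.Eventually.of_forall fun t => by
      have e1 := hF0 t
      have e2 : 0 ≤ J t := hJ0 t
      positivity) (by
      filter_upwards [hJd, hbd, S.sol.momentum_eq, S.sol.density_eq, S.f_memLp, hwmem,
        ae_restrict_mem measurableSet_Ioo] with t hJ' hb' hmom hden hf hw ht
      have htI := Ioo_subset_Icc_self ht
      have hρ := S.sol.density_mem t htI
      refine ⟨_, hJ'.add hb', mul_nonneg (by positivity)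
        (integral_nonneg fun x => sq_nonneg _), ?_⟩
      have e1 := hmom _ (gradient_mem_momentumSpace hw)
      have e2 := hden _ hw
      have e3 := le_of_abs_le (abs_integral_mul_le_sq hf (S.tri.memLp hΩ hw 2)
        (by positivity : 0 < φmin / 2))
      have e4 := le_of_abs_le (abs_integral_mul_le (w := timeDeriv ψ t)
        ((S.tri.memLp_surface hd hΩ hρ).integrable le_top) (hψ1.mono fun x hx => by
          have := hx t htI
          rwa [derivWithin_of_mem_nhds (Icc_mem_nhds ht.1 ht.2)] at this))
      have e5 := habs1 𝒯 k S.tri _ hρ M₁ M₁.coe_nonneg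
      have e6 := mul_le_mul_of_nonneg_left (hV t htI) hC₁.le
      have e7 : φmin * ∫ x in Ω, timeDeriv ρ t x ^ 2 ≤
          ∫ x in Ω, φ x * timeDeriv ρ t x * timeDeriv ρ t x := by
        have hw2 := (S.tri.memLp hΩ hw 2).integrable_sq
        have hi : IntegrableOn (fun x => φ x * timeDeriv ρ t x ^ 2) Ω := by
          refine hw2.bdd_mul (c := φmax) S.φ_meas ?_
          refine (ae_restrict_iff' hΩm).2 (Filter.Eventually.of_forall fun x hx => ?_)
          obtain ⟨h1, h2⟩ := S.φ_bounds x hx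
          rw [Real.norm_of_nonneg (by linarith)]
          exact h2
        have hi' : ∫ x in Ω, φ x * timeDeriv ρ t x * timeDeriv ρ t x =
            ∫ x in Ω, φ x * timeDeriv ρ t x ^ 2 :=
          integral_congr_ae (Filter.Eventually.of_forall fun x => by
            change φ x * timeDeriv ρ t x * timeDeriv ρ t x = φ x * timeDeriv ρ t x ^ 2
            ring)
        rw [hi', ← integral_const_mul]
        exact setIntegral_mono_on (hw2.const_mul _) hi hΩm fun x hx =>
          mul_le_mul_of_nonneg_right (S.φ_bounds x hx).1 (sq_nonneg _)
      have e8 : 1 / (4 * (φmin / 2)) = 1 / (2 * φmin) := by ring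
      rw [e8] at e3
      change _ ≤ 1 / (2 * φmin) * (∫ x in Ω, f t x ^ 2) +
        1 * (∫ x in Ω, g.potential ‖gradient (ρ t) x‖) + C₁ * (C₀ * D₀ + 1 + (M₁ : ℝ) ^ g.conjExp)
      linarith)
  have hJ00' : J 0 ≤ C₃ * D := by
    refine hJ00.trans (mul_le_mul_of_nonneg_left ?_ hC₃.le)
    rw [hD]; linarith
  -- The initial boundary pairing is absorbed like that at any other time, at the cost of `J 0`,
  -- which the projection bound controls.
  have hb0 := abs_le.1 (hbbound 0 ⟨le_rfl, hT0.le⟩)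
  have hJnn : ∀ t, 0 ≤ J t := hJ0
  have hc₃D : 0 ≤ c₃ * D := by positivity
  have hc₃D' : 0 ≤ 2 / φmin * (c₃ * D) := by positivity
  have hE0 : J 0 + b 0 + (∫ t in Ioo 0 T, R t) + c₂ * D ≤ c₃ * D := by
    have e1 : 0 ≤ C₃ * D := by positivity
    rw [hc₃]
    linarith [hb0.2]
  constructor
  · intro t ht
    have e1 := h1 t ht
    have e2 := (abs_le.1 (hbbound t ht)).1
    have e3 : J t ≤ 2 * (c₃ * D) := by
      have e1' : J t + b t ≤ J 0 + b 0 + ∫ t in Ioo 0 T, R t := e1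
      linarith
    change J t ≤ _
    linarith
  · have e1 : ∀ t, ENNReal.ofReal (∫ x in Ω, timeDeriv ρ t x ^ 2) =
        ENNReal.ofReal (2 / φmin) *
          ENNReal.ofReal (φmin / 2 * ∫ x in Ω, timeDeriv ρ t x ^ 2) := by
      intro t
      rw [← ENNReal.ofReal_mul (by positivity)]
      congr 1; field_simp
    simp_rw [e1]
    rw [lintegral_const_mul' _ _ ENNReal.ofReal_ne_top]
    refine (mul_le_mul_right h2 _).trans ?_
    rw [← ENNReal.ofReal_mul (by positivity)]
    refine ENNReal.ofReal_le_ofReal ?_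
    have e2 := (abs_le.1 (hbbound T ⟨hT0.le, le_rfl⟩)).1
    have e3 := hJnn T
    have e4 : J 0 + b 0 - (J T + b T) + ∫ t in Ioo 0 T, R t ≤ c₃ * D := by linarith
    have e5 := mul_le_mul_of_nonneg_left e4 (by positivity : 0 ≤ 2 / φmin)
    refine e5.trans ?_
    linarith

/-! ### Mixed norms -/

section Norms
variable {X F : Type*} [MeasurableSpace X] [NormedAddCommGroup F] {μ : Measure X}

lemma eLpNorm_ofReal_rpow {p : ℝ} (hp : 0 < p) (u : X → F) :
    eLpNorm u (ENNReal.ofReal p) μ ^ p = ∫⁻ x, ‖u x‖ₑ ^ p ∂μ := by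
  rw [eLpNorm_eq_lintegral_rpow_enorm_toReal (by simpa using hp) ENNReal.ofReal_ne_top,
    ENNReal.toReal_ofReal hp.le, ← ENNReal.rpow_mul, one_div_mul_cancel hp.ne', ENNReal.rpow_one]

lemma eLpNorm_rpow_eq_ofReal {p : ℝ} (hp : 0 < p) {u : X → F}
    (hu : Integrable (fun x => ‖u x‖ ^ p) μ) :
    eLpNorm u (ENNReal.ofReal p) μ ^ p = ENNReal.ofReal (∫ x, ‖u x‖ ^ p ∂μ) := by
  rw [eLpNorm_ofReal_rpow hp, ofReal_integral_eq_lintegral_ofReal hu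
    (Filter.Eventually.of_forall fun x => by positivity)]
  refine lintegral_congr fun x => ?_
  rw [← ENNReal.ofReal_rpow_of_nonneg (norm_nonneg _) hp.le, ofReal_norm]

lemma eLpNorm_sq_eq_ofReal {u : X → F} (hu : MemLp u 2 μ) :
    eLpNorm u 2 μ ^ 2 = ENNReal.ofReal (∫ x, ‖u x‖ ^ 2 ∂μ) := by
  have h : Integrable (fun x => ‖u x‖ ^ (2 : ℝ)) μ := by
    simpa using hu.integrable_norm_pow two_ne_zero
  have := eLpNorm_rpow_eq_ofReal two_pos h
  simpa using this

lemma mixedNorm_rpow {p : ℝ} (hp : 0 < p) (T : ℝ) (q : ℝ≥0∞) (u : ℝ → X → F) :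
    mixedNorm T (ENNReal.ofReal p) q μ u ^ p = ∫⁻ t in Ioo 0 T, eLpNorm (u t) q μ ^ p := by
  rw [mixedNorm, eLpNorm_eq_lintegral_rpow_enorm_toReal (by simpa using hp) ENNReal.ofReal_ne_top,
    ENNReal.toReal_ofReal hp.le, ← ENNReal.rpow_mul, one_div_mul_cancel hp.ne', ENNReal.rpow_one]
  simp only [enorm_eq_self]

lemma mixedNorm_two_sq (T : ℝ) (q : ℝ≥0∞) (u : ℝ → X → F) :
    mixedNorm T 2 q μ u ^ 2 = ∫⁻ t in Ioo 0 T, eLpNorm (u t) q μ ^ 2 := by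
  have := mixedNorm_rpow two_pos T q u (μ := μ)
  simpa using this

lemma mixedNorm_top_le {T : ℝ} {q B : ℝ≥0∞} {u : ℝ → X → F}
    (h : ∀ᵐ t ∂volume.restrict (Ioo 0 T), eLpNorm (u t) q μ ≤ B) :
    mixedNorm T ∞ q μ u ≤ B := by
  rw [mixedNorm, eLpNorm_exponent_top]
  refine eLpNormEssSup_le_of_ae_enorm_bound ?_
  filter_upwards [h] with t ht
  rwa [enorm_eq_self]

lemma mixedNorm_top_rpow_le {T p : ℝ} (hp : 0 < p) {q B : ℝ≥0∞} {u : ℝ → X → F}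
    (h : ∀ᵐ t ∂volume.restrict (Ioo 0 T), eLpNorm (u t) q μ ^ p ≤ B) :
    mixedNorm T ∞ q μ u ^ p ≤ B := by
  rw [← ENNReal.le_rpow_inv_iff hp]
  exact mixedNorm_top_le (h.mono fun t ht => (ENNReal.le_rpow_inv_iff hp).2 ht)

lemma mixedNorm_top_sq_le {T : ℝ} {q B : ℝ≥0∞} {u : ℝ → X → F}
    (h : ∀ᵐ t ∂volume.restrict (Ioo 0 T), eLpNorm (u t) q μ ^ 2 ≤ B) :
    mixedNorm T ∞ q μ u ^ 2 ≤ B := by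
  have := mixedNorm_top_rpow_le (μ := μ) (u := u) (q := q) (T := T) (B := B) two_pos
    (by simpa only [ENNReal.rpow_two] using h)
  rwa [ENNReal.rpow_two] at this

end Norms

/-- Needed because the momentum norm appears unsquared in the theorem, while the energy controls its
square. -/
lemma le_one_add_sq (x : ℝ≥0∞) : x ≤ 1 + x ^ 2 := by
  rcases le_total x 1 with h | h
  · exact h.trans le_self_add
  · refine le_trans ?_ le_add_self
    rw [sq]
    exact le_mul_of_one_le_left' h

/-! ### From integral estimates to mixed norms -/

section DiscreteNorms
variable {d k : ℕ} {Ω : Set (Space d)} {𝒯 : Geometry.SimplicialComplex ℝ (Space d)}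
  {g : ForchheimerPoly} {T c₀ C₀ B : ℝ} {ρ : ℝ → Space d → ℝ}

lemma IsTriangulation.eLpNorm_gradient_rpow_le (hT : IsTriangulation Ω 𝒯)
    (hΩ : IsBoundedLipschitz Ω) (hc₀ : 0 < c₀)
    (hpot : ∀ ξ, 0 ≤ ξ → c₀ * ξ ^ g.β - C₀ ≤ g.potential ξ) {r : Space d → ℝ}
    (hr : r ∈ densitySpace 𝒯 k) (hB : ∫ x in Ω, g.potential ‖gradient r x‖ ≤ B) :
    eLpNorm (gradient r) (ENNReal.ofReal g.β) (volume.restrict Ω) ^ g.β ≤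
      ENNReal.ofReal (B / c₀ + (volume.restrict Ω).real univ * (C₀ / c₀)) := by
  rw [eLpNorm_rpow_eq_ofReal g.β_pos (hT.integrableOn_gradient_rpow hΩ hr g.β_pos.le)]
  refine ENNReal.ofReal_le_ofReal ((hT.integral_gradient_rpow_le hΩ g hc₀ hpot hr).trans ?_)
  rw [one_div_mul_eq_div]
  exact add_le_add (div_le_div_of_nonneg_right hB hc₀.le) le_rfl

lemma energy_norm_le (hT : IsTriangulation Ω 𝒯) (hΩ : IsBoundedLipschitz Ω) (hT0 : 0 < T)
    (hc₀ : 0 < c₀) (hC₀ : 0 < C₀) (hpot : ∀ ξ, 0 ≤ ξ → c₀ * ξ ^ g.β - C₀ ≤ g.potential ξ)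
    (hρ : ∀ t ∈ Icc 0 T, ρ t ∈ densitySpace 𝒯 k) (hB0 : 0 ≤ B)
    (h1 : ∀ t ∈ Icc 0 T, ∫ x in Ω, ρ t x ^ 2 ≤ B)
    (h2 : ∫⁻ t in Ioo 0 T, ENNReal.ofReal (∫ x in Ω, g.potential ‖gradient (ρ t) x‖) ≤
      ENNReal.ofReal B) :
    mixedNorm T ∞ 2 (volume.restrict Ω) ρ ^ 2
        + mixedNorm T (ENNReal.ofReal g.β) (ENNReal.ofReal g.β) (volume.restrict Ω)
            (fun t => gradient (ρ t)) ^ g.β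
      ≤ ENNReal.ofReal (B + (B / c₀ + T * ((volume.restrict Ω).real univ * (C₀ / c₀)))) := by
  have hβ := g.β_pos
  set V := (volume.restrict Ω).real univ with hV
  have hV0 : 0 ≤ V := measureReal_nonneg
  have hVC : 0 ≤ V * (C₀ / c₀) := by positivity
  -- The lower growth bound of the potential costs an additive constant at each time, which
  -- integrates to the term with the factor `T`.
  have hBc : 0 ≤ B / c₀ := by positivity
  have hTV : 0 ≤ T * (V * (C₀ / c₀)) := by positivity
  rw [ENNReal.ofReal_add hB0 (add_nonneg hBc hTV)]
  refine add_le_add ?_ ?_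
  · refine mixedNorm_top_sq_le ?_
    filter_upwards [ae_restrict_mem measurableSet_Ioo] with t ht
    have htI := Ioo_subset_Icc_self ht
    rw [eLpNorm_sq_eq_ofReal (hT.memLp hΩ (hρ t htI) 2)]
    refine ENNReal.ofReal_le_ofReal ?_
    simpa using h1 t htI
  · rw [mixedNorm_rpow hβ]
    calc ∫⁻ t in Ioo 0 T, eLpNorm (gradient (ρ t)) (ENNReal.ofReal g.β)
          (volume.restrict Ω) ^ g.β
        ≤ ∫⁻ t in Ioo 0 T, (ENNReal.ofReal c₀⁻¹ *
            ENNReal.ofReal (∫ x in Ω, g.potential ‖gradient (ρ t) x‖) +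
              ENNReal.ofReal (V * (C₀ / c₀))) := by
          refine setLIntegral_mono' measurableSet_Ioo fun t ht => ?_
          refine (hT.eLpNorm_gradient_rpow_le hΩ hc₀ hpot (hρ t (Ioo_subset_Icc_self ht))
            le_rfl).trans (le_of_eq ?_)
          have hJ0 : 0 ≤ ∫ x in Ω, g.potential ‖gradient (ρ t) x‖ :=
            integral_nonneg fun x => g.potential_nonneg (norm_nonneg _)
          rw [← ENNReal.ofReal_mul (by positivity), ← ENNReal.ofReal_add
            (mul_nonneg (by positivity) hJ0) hVC, div_eq_inv_mul]
      _ = ENNReal.ofReal c₀⁻¹ * (∫⁻ t in Ioo 0 T,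
            ENNReal.ofReal (∫ x in Ω, g.potential ‖gradient (ρ t) x‖)) +
              ENNReal.ofReal (V * (C₀ / c₀)) * ENNReal.ofReal T := by
          rw [lintegral_add_right _ measurable_const,
            lintegral_const_mul' _ _ ENNReal.ofReal_ne_top, setLIntegral_const]
          simp
      _ ≤ ENNReal.ofReal c₀⁻¹ * ENNReal.ofReal B +
              ENNReal.ofReal (V * (C₀ / c₀)) * ENNReal.ofReal T := by gcongr
      _ = _ := by
          rw [← ENNReal.ofReal_mul (by positivity), ← ENNReal.ofReal_mul hVC,
            ← ENNReal.ofReal_add (by positivity) (mul_nonneg hVC hT0.le)]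
          congr 1
          ring

lemma derivative_norm_le (hT : IsTriangulation Ω 𝒯) (hΩ : IsBoundedLipschitz Ω)
    (hc₀ : 0 < c₀) (hC₀ : 0 < C₀) (hpot : ∀ ξ, 0 ≤ ξ → c₀ * ξ ^ g.β - C₀ ≤ g.potential ξ)
    (hρ : ∀ t ∈ Icc 0 T, ρ t ∈ densitySpace 𝒯 k)
    (hw : ∀ᵐ t ∂volume.restrict (Ioo 0 T), timeDeriv ρ t ∈ densitySpace 𝒯 k) (hB0 : 0 ≤ B)
    (h1 : ∀ t ∈ Icc 0 T, ∫ x in Ω, g.potential ‖gradient (ρ t) x‖ ≤ B)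
    (h2 : ∫⁻ t in Ioo 0 T, ENNReal.ofReal (∫ x in Ω, timeDeriv ρ t x ^ 2) ≤ ENNReal.ofReal B)
    {m : ℝ → Space d → Space d} {C₃ : ℝ} (hC₃ : 0 < C₃)
    (hm : ∀ᵐ t ∂volume.restrict (Ioo 0 T), m t ∈ momentumSpace 𝒯 k)
    (h3 : ∀ᵐ t ∂volume.restrict (Ioo 0 T), ∫ x in Ω, ‖m t x‖ ^ 2 ≤
      C₃ * (1 + ∫ x in Ω, g.potential ‖gradient (ρ t) x‖)) :
    mixedNorm T 2 2 (volume.restrict Ω) (timeDeriv ρ) ^ 2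
        + mixedNorm T ∞ (ENNReal.ofReal g.β) (volume.restrict Ω)
            (fun t => gradient (ρ t)) ^ g.β
        + mixedNorm T ∞ 2 (volume.restrict Ω) m
      ≤ ENNReal.ofReal (B + (B / c₀ + (volume.restrict Ω).real univ * (C₀ / c₀)) +
          (1 + C₃ * (1 + B))) := by
  have hV0 : 0 ≤ (volume.restrict Ω).real univ := measureReal_nonneg
  have hBc : 0 ≤ B / c₀ + (volume.restrict Ω).real univ * (C₀ / c₀) := by positivity
  have hBm : 0 ≤ C₃ * (1 + B) := by positivity
  rw [ENNReal.ofReal_add (add_nonneg hB0 hBc) (add_nonneg zero_le_one hBm),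
    ENNReal.ofReal_add hB0 hBc]
  refine add_le_add (add_le_add ?_ ?_) ?_
  · rw [mixedNorm_two_sq]
    refine le_trans (lintegral_mono_ae ?_) h2
    filter_upwards [hw] with t ht
    rw [eLpNorm_sq_eq_ofReal (hT.memLp hΩ ht 2)]
    simp
  · refine mixedNorm_top_rpow_le g.β_pos ?_
    filter_upwards [ae_restrict_mem measurableSet_Ioo] with t ht
    have htI := Ioo_subset_Icc_self ht
    exact hT.eLpNorm_gradient_rpow_le hΩ hc₀ hpot (hρ t htI) (h1 t htI)
  · refine mixedNorm_top_le ?_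
    filter_upwards [hm, h3, ae_restrict_mem measurableSet_Ioo] with t hmt hle ht
    refine (le_one_add_sq _).trans ?_
    rw [eLpNorm_sq_eq_ofReal (hT.memLp_momentum hΩ hmt 2), ENNReal.ofReal_add zero_le_one hBm,
      ENNReal.ofReal_one]
    refine add_le_add le_rfl (ENNReal.ofReal_le_ofReal (hle.trans ?_))
    exact mul_le_mul_of_nonneg_left (add_le_add le_rfl (h1 t (Ioo_subset_Icc_self ht))) hC₃.le

end DiscreteNorms

section SquareIntegrable
variable {d : ℕ} {Ω : Set (Space d)} {T : ℝ} {f : ℝ → Space d → ℝ}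

lemma ae_memLp_of_memLp_prod (hf : MemLp (fun p : ℝ × Space d => f p.1 p.2) 2
    ((volume.restrict (Ioo 0 T)).prod (volume.restrict Ω))) :
    (∀ᵐ t ∂volume.restrict (Ioo 0 T), MemLp (f t) 2 (volume.restrict Ω)) ∧
      IntegrableOn (fun t => ∫ x in Ω, f t x ^ 2) (Ioo 0 T) := by
  have h2 := hf.integrable_sq
  refine ⟨?_, h2.integral_prod_left⟩
  filter_upwards [h2.prod_right_ae, hf.aestronglyMeasurable.prodMk_left] with t h3 h4
  exact (memLp_two_iff_integrable_sq h4).2 h3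

lemma mixedNorm_sq_eq_ofReal
    (hf : ∀ᵐ t ∂volume.restrict (Ioo 0 T), MemLp (f t) 2 (volume.restrict Ω))
    (hi : IntegrableOn (fun t => ∫ x in Ω, f t x ^ 2) (Ioo 0 T)) :
    mixedNorm T 2 2 (volume.restrict Ω) f ^ 2 =
      ENNReal.ofReal (∫ t in Ioo 0 T, ∫ x in Ω, f t x ^ 2) := by
  rw [mixedNorm_two_sq, ofReal_integral_eq_lintegral_ofReal hi
    (Filter.Eventually.of_forall fun t => integral_nonneg fun x => sq_nonneg _)]
  refine lintegral_congr_ae ?_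
  filter_upwards [hf] with t ht
  rw [eLpNorm_sq_eq_ofReal ht]
  simp

end SquareIntegrable

end MixedFEM

/-! ### The a priori estimates in terms of the data norms -/

open MixedFEM
theorem theorem4p1 (d : ℕ) (hd : 2 ≤ d) (Ω : Set (Space d)) (hΩ : IsBoundedLipschitz Ω)
    (g : ForchheimerPoly) (T : ℝ) (hT : 0 < T) (φmin φmax : ℝ) (hφmin : 0 < φmin)
    (k : ℕ) (𝓣 : Set (Geometry.SimplicialComplex ℝ (Space d)))
    (h𝓣 : ∀ 𝒯 ∈ 𝓣, IsTriangulation Ω 𝒯) (hqu : IsQuasiuniform 𝓣) :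
    ∃ C : ℝ, 0 < C ∧
      ∀ φ : Space d → ℝ, ContDiffOn ℝ 1 φ Ω → (∀ x ∈ Ω, φmin < φ x ∧ φ x < φmax) →
      ∀ ρ₀ : Space d → ℝ, ContinuousOn ρ₀ (closure Ω) → ContDiffOn ℝ 1 ρ₀ Ω →
      ∀ ψ : ℝ → Space d → ℝ,
        (∀ t ∈ Icc 0 T, AEStronglyMeasurable (ψ t) (surface Ω)) →
        (∀ x ∈ frontier Ω, ContDiffOn ℝ 1 (fun t => ψ t x) (Icc 0 T)) →
      ∀ f : ℝ → Space d → ℝ,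
        MemLp (fun p : ℝ × Space d => f p.1 p.2) 2
          ((volume.restrict (Ioo 0 T)).prod (volume.restrict Ω)) →
      ∀ 𝒯 ∈ 𝓣, ∀ (ρ : ℝ → Space d → ℝ) (m : ℝ → Space d → Space d),
        IsSemidiscreteSolution Ω g T k 𝒯 φ ρ₀ ψ f ρ m →
        (mixedNorm T ∞ 2 (volume.restrict Ω) ρ ^ 2
            + mixedNorm T (ENNReal.ofReal g.β) (ENNReal.ofReal g.β) (volume.restrict Ω)
                (fun t => gradient (ρ t)) ^ g.β
          ≤ ENNReal.ofReal C *
              (eLpNorm ρ₀ 2 (volume.restrict Ω) ^ 2 + boundA Ω g T ψ f)) ∧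
        (mixedNorm T 2 2 (volume.restrict Ω) (timeDeriv ρ) ^ 2
            + mixedNorm T ∞ (ENNReal.ofReal g.β) (volume.restrict Ω)
                (fun t => gradient (ρ t)) ^ g.β
            + mixedNorm T ∞ 2 (volume.restrict Ω) m
          ≤ ENNReal.ofReal C * boundB Ω g T ρ₀ ψ f) := by

  have hd1 : 1 ≤ d := by omega
  have hfin := hΩ.isFiniteMeasure
  have hΩm := hΩ.isOpen.measurableSet
  obtain ⟨c, hc, hq⟩ := hqu
  obtain ⟨C₁, hC₁, hfirst⟩ := exists_energy_estimate hd1 hΩ g hT hφmin φmax k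
  obtain ⟨C₂, hC₂, hsecond⟩ := exists_derivative_estimate hd1 hΩ g hT hφmin φmax k hc
  obtain ⟨C₃, hC₃, hmom⟩ := hΩ.exists_momentum_bound g
  obtain ⟨c₀, hc₀, C₀, hC₀, hpot⟩ := g.exists_le_potential
  set V := (volume.restrict Ω).real univ with hV
  have hV0 : 0 ≤ V := measureReal_nonneg
  -- Additive constants are merged into multiplicative ones: the summand `1` in `boundA` makes the
  -- total data `D` at least `1`.
  set A₁ := C₁ + C₁ / c₀ + T * (V * (C₀ / c₀)) with hA₁
  set A₂ := C₂ + (C₂ / c₀ + V * (C₀ / c₀)) + (1 + C₃ * (1 + C₂)) with hA₂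
  have hA₁0 : 0 < A₁ := by positivity
  have hA₂0 : 0 < A₂ := by positivity
  refine ⟨A₁ + A₂, by positivity, ?_⟩
  intro φ hφ hφb ρ₀ hρ₀ hρ₀' ψ hψm hψ f hf 𝒯 h𝒯 ρ m hsol
  have hT𝒯 := h𝓣 𝒯 h𝒯
  have hC : ENNReal.ofReal (A₁ + A₂) ≠ 0 := by
    simpa using (by positivity : 0 < A₁ + A₂)
  obtain ⟨hf1, hf2⟩ := ae_memLp_of_memLp_prod hf
  have hfnorm := mixedNorm_sq_eq_ofReal hf1 hf2
  have hρ₀2 : MemLp ρ₀ 2 (volume.restrict Ω) := by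
    obtain ⟨B, hB⟩ := hΩ.isBounded.isCompact_closure.exists_bound_of_continuousOn hρ₀
    refine MemLp.of_bound ((hρ₀.mono subset_closure).aestronglyMeasurable hΩm) B ?_
    exact (ae_restrict_iff' hΩm).2
      (Filter.Eventually.of_forall fun x hx => hB x (subset_closure hx))
  have hρ₀norm : eLpNorm ρ₀ 2 (volume.restrict Ω) ^ 2 = ENNReal.ofReal (∫ x in Ω, ρ₀ x ^ 2) := by
    rw [eLpNorm_sq_eq_ofReal hρ₀2]; simp
  have hR0 : 0 ≤ ∫ x in Ω, ρ₀ x ^ 2 := integral_nonneg fun x => sq_nonneg _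
  have hF0 : 0 ≤ ∫ t in Ioo 0 T, ∫ x in Ω, f t x ^ 2 :=
    integral_nonneg fun t => integral_nonneg fun x => sq_nonneg _
  have hconj : 0 < g.conjExp := by linarith [g.two_le_conjExp]
  have hβ := g.β_pos
  have hdata : ∀ M₀ : ℝ≥0, mixedNorm T ∞ ∞ (surface Ω) ψ ≤ M₀ →
      IsEnergySolution Ω g T φmin φmax k 𝒯 φ ρ₀ ψ f ρ m M₀ := fun M₀ hM₀ =>
    { tri := hT𝒯
      φ_meas := hφ.continuousOn.aestronglyMeasurable hΩm
      φ_bounds := fun x hx => ⟨(hφb x hx).1.le, (hφb x hx).2.le⟩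
      ρ₀_cont := hρ₀
      ψ_meas := hψm
      ψ_diff := hψ
      ψ_le := hM₀
      f_memLp := hf1
      f_int := hf2
      sol := hsol }
  constructor
  -- An infinite flux norm makes the right-hand side infinite; the norms of `ρ₀` and `f` in this
  -- bound are finite by assumption on the data.
  · by_cases hψtop : mixedNorm T ∞ ∞ (surface Ω) ψ = ∞
    · have : boundA Ω g T ψ f = ∞ := by
        simp [boundA, hψtop, ENNReal.top_rpow_of_pos hconj]
      simp [this, ENNReal.mul_top hC]
    set M₀ := (mixedNorm T ∞ ∞ (surface Ω) ψ).toNNReal with hM₀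
    have hM₀' : mixedNorm T ∞ ∞ (surface Ω) ψ = M₀ := (ENNReal.coe_toNNReal hψtop).symm
    have S := hdata M₀ hM₀'.le
    have hl0 : 0 ≤ (M₀ : ℝ) ^ g.conjExp := Real.rpow_nonneg M₀.coe_nonneg _
    obtain ⟨h1, h2⟩ := hfirst S
    set D := (∫ x in Ω, ρ₀ x ^ 2) + 1 + (M₀ : ℝ) ^ g.conjExp +
      ∫ t in Ioo 0 T, ∫ x in Ω, f t x ^ 2 with hD
    have hD1 : 1 ≤ D := by rw [hD]; linarith
    have hrhs : ENNReal.ofReal D = eLpNorm ρ₀ 2 (volume.restrict Ω) ^ 2 + boundA Ω g T ψ f := by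
      rw [hD, ENNReal.ofReal_add (by positivity) hF0, ENNReal.ofReal_add (by positivity) hl0,
        ENNReal.ofReal_add hR0 zero_le_one, ENNReal.ofReal_one, boundA, hM₀', hfnorm, hρ₀norm,
        ← ENNReal.ofReal_rpow_of_nonneg M₀.coe_nonneg hconj.le, ENNReal.ofReal_coe_nnreal]
      ring
    rw [← hrhs, ← ENNReal.ofReal_mul (by positivity)]
    refine (energy_norm_le hT𝒯 hΩ hT hc₀ hC₀ hpot hsol.density_mem
      (mul_nonneg hC₁.le (by linarith)) h1 h2).trans (ENNReal.ofReal_le_ofReal ?_)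
    have e3 : T * (V * (C₀ / c₀)) * 1 ≤ T * (V * (C₀ / c₀)) * D :=
      mul_le_mul_of_nonneg_left hD1 (by positivity)
    have e4 : 0 ≤ A₂ * D := by positivity
    have e5 : C₁ * D / c₀ = C₁ / c₀ * D := by ring
    rw [e5, add_mul, hA₁]
    linarith
  · by_cases hBtop : boundB Ω g T ρ₀ ψ f = ∞
    · simp [hBtop, ENNReal.mul_top hC]
    have hparts := hBtop
    simp only [boundB, boundA, ENNReal.add_eq_top, not_or] at hparts
    -- A finite `boundB` yields exactly what the derivative estimate needs: `∇ρ₀` in `L^β`, and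
    -- essential bounds for the flux and its time derivative.
    obtain ⟨⟨⟨⟨-, hG⟩, -⟩, hM1⟩, ⟨-, hM0⟩, -⟩ := hparts
    have hψtop : mixedNorm T ∞ ∞ (surface Ω) ψ ≠ ∞ := fun h => hM0 (by
      rw [h, ENNReal.top_rpow_of_pos hconj])
    have hψttop : mixedNorm T ∞ ∞ (surface Ω) (timeDeriv ψ) ≠ ∞ := fun h => hM1 (by
      rw [h, ENNReal.top_rpow_of_pos hconj])
    set M₀ := (mixedNorm T ∞ ∞ (surface Ω) ψ).toNNReal with hM₀
    have hM₀' : mixedNorm T ∞ ∞ (surface Ω) ψ = M₀ := (ENNReal.coe_toNNReal hψtop).symm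
    set M₁ := (mixedNorm T ∞ ∞ (surface Ω) (timeDeriv ψ)).toNNReal with hM₁
    have hM₁' : mixedNorm T ∞ ∞ (surface Ω) (timeDeriv ψ) = M₁ :=
      (ENNReal.coe_toNNReal hψttop).symm
    have S := hdata M₀ hM₀'.le
    have hl0 : 0 ≤ (M₀ : ℝ) ^ g.conjExp := Real.rpow_nonneg M₀.coe_nonneg _
    have hl1 : 0 ≤ (M₁ : ℝ) ^ g.conjExp := Real.rpow_nonneg M₁.coe_nonneg _
    have hGi : IntegrableOn (fun x => ‖gradient ρ₀ x‖ ^ g.β) Ω := by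
      refine ⟨((measurable_gradient ρ₀).norm.pow_const _).aestronglyMeasurable, ?_⟩
      rw [eLpNorm_ofReal_rpow hβ] at hG
      refine lt_of_eq_of_lt (lintegral_congr fun x => ?_) (lt_top_iff_ne_top.2 hG)
      rw [← ofReal_norm, ← ofReal_norm, ENNReal.ofReal_rpow_of_nonneg (norm_nonneg _) hβ.le,
        Real.norm_of_nonneg (Real.rpow_nonneg (norm_nonneg _) _)]
    have hG0 : 0 ≤ ∫ x in Ω, ‖gradient ρ₀ x‖ ^ g.β :=
      integral_nonneg fun x => Real.rpow_nonneg (norm_nonneg _) _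
    obtain ⟨h1, h2⟩ := hsecond S (hq 𝒯 h𝒯) hρ₀' hGi M₁ hM₁'.le
    set D := (∫ x in Ω, ρ₀ x ^ 2) + (∫ x in Ω, ‖gradient ρ₀ x‖ ^ g.β) +
          (M₁ : ℝ) ^ g.conjExp + 1 + (M₀ : ℝ) ^ g.conjExp +
            ∫ t in Ioo 0 T, ∫ x in Ω, f t x ^ 2 with hD
    have hD1 : 1 ≤ D := by rw [hD]; linarith
    have hrhs : ENNReal.ofReal D ≤ boundB Ω g T ρ₀ ψ f := by
      rw [hD, ENNReal.ofReal_add (by positivity) hF0, ENNReal.ofReal_add (by positivity) hl0,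
        ENNReal.ofReal_add (by positivity) zero_le_one, ENNReal.ofReal_add (by positivity) hl1,
        ENNReal.ofReal_add hR0 hG0, ENNReal.ofReal_one, boundB, boundA, hM₀', hM₁', hfnorm,
        hρ₀norm, eLpNorm_rpow_eq_ofReal hβ hGi,
        ← ENNReal.ofReal_rpow_of_nonneg M₀.coe_nonneg hconj.le,
        ← ENNReal.ofReal_rpow_of_nonneg M₁.coe_nonneg hconj.le, ENNReal.ofReal_coe_nnreal,
        ENNReal.ofReal_coe_nnreal]
      -- The product of the boundary norms of `ψ(0)` and `ρ₀` is simply discarded: the initial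
      -- boundary pairing was already absorbed using the other terms.
      refine le_trans (le_of_eq ?_)
        (add_le_add (add_le_add (le_self_add (a := _ + _)) le_rfl) le_rfl)
      ring
    refine le_trans ?_ (mul_le_mul_right hrhs _)
    rw [← ENNReal.ofReal_mul (by positivity)]
    have hw := ae_timeDeriv_mem hT𝒯 hΩ.isOpen hT hsol.density_mem hsol.absolutelyContinuous
    refine (derivative_norm_le hT𝒯 hΩ hc₀ hC₀ hpot hsol.density_mem hw
      (mul_nonneg hC₂.le (by linarith)) h1 h2 hC₃ hsol.momentum_mem ?_).trans
        (ENNReal.ofReal_le_ofReal ?_)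
    · filter_upwards [hsol.momentum_mem, hsol.momentum_eq, ae_restrict_mem measurableSet_Ioo]
        with t hm heq ht
      exact hmom 𝒯 k hT𝒯 _ (hsol.density_mem t (Ioo_subset_Icc_self ht)) _ hm (heq _ hm)
    have q1 : V * (C₀ / c₀) * 1 ≤ V * (C₀ / c₀) * D :=
      mul_le_mul_of_nonneg_left hD1 (by positivity)
    have q2 : C₃ * 1 ≤ C₃ * D := mul_le_mul_of_nonneg_left hD1 hC₃.le
    have q4 : 0 ≤ A₁ * D := by positivity
    have q5 : C₂ * D / c₀ = C₂ / c₀ * D := by ring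
    rw [q5, add_mul, hA₂]
    linarith
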